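/- Let $\Gamma=\mathrm{diag}(1,1,-1)$, let $G=SU(2,1)=\{g\in GL(3,\mathbb C): \det g=1,\ g^*\Gamma g=\Gamma\}$, let $K\cong U(2)$ be the maximal compact subgroup of unitary elements of $G$, and let $\mathfrak g=\mathfrak{sl}(3,\mathbb C)=\mathfrak k\oplus\mathfrak p$ be the complexified Cartan decomposition. Put $E=e_{12}$, $F=e_{21}$, $H_i=e_{ii}-e_{33}$, $E_i=e_{i3}$, $F_i=e_{3i}$ $(i=1,2)$, $h_1=\frac{2H_1-H_2}{3}$, $h_2=\frac{2H_2-H_1}{3}$, so that $\mathfrak k=\mathrm{span}\{H_1,H_2,E,F\}$ and $\mathfrak p=\mathrm{span}\{E_1,E_2,F_1,F_2\}$. Let $C(\mathfrak p)$ be the Clifford algebra with relations $xy+yx=-2\,\mathrm{tr}(xy)$ for $x,y\in\mathfrak p$, let $S=\bigwedge\mathrm{span}\{E_1,E_2\}$ be the spin module ($E_i$ acts by exterior multiplication, $F_i$ by $-2$ times contraction with $\mathrm{tr}(F_i\,\cdot)$), and let $\mathcal A=U(\mathfrak g)\otimes C(\mathfrak p)$, on which $K$ acts by the adjoint action on both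 factors. Let $\mathcal A^K$ be the algebra of $K$-invariants, $D=E_1\otimes F_1+E_2\otimes F_2+F_1\otimes E_1+F_2\otimes E_2\in\mathcal A^K$ the Dirac operator, and $\mathcal I$ the two-sided ideal of $\mathcal A^K$ generated by $D$. For $x\in\mathfrak k$ put $x_\Delta=x\otimes 1+1\otimes\alpha(x)$, where $\alpha:\mathfrak k\to\mathfrak{so}(\mathfrak p)\to C(\mathfrak p)$ is the natural map, $\alpha(x)=-\frac14\sum_i[x,b_i]d_i$ for a basis $b_i$ of $\mathfrak p$ with dual basis $d_i$ with respect to the trace form. Let $\mathcal B\subset\mathcal A$ be the subalgebra generated by $\mathfrak k_\Delta=\{x_\Delta:x\in\mathfrak k\}$ and $\mathcal A^K$. Identify $\hat K$ with the set of highest weights $(q_1,q_2,-q_1-q_2)$, $q_1,q_2\in\frac13\mathbb Z$, $q_1-q_2\in\mathbb Z_{\ge 0}$ (a highest weight vector $x$ satisfies $Ex=0$, $h_1x=q_1x$, $h_2x=q_2x$). Let $X$ be the $(\mathfrak g,K)$-module of a nonholomorphic discrete series representation of $SU(2,1)$; that is, $X$ is irreducible and unitary, with a minimal $K$-type $p=(p_1,p_2,-p_1-p_2)\in\hat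 K$ (a $K$-type of $X$ with $\|p+2\rho_K\|$ minimal) such that $p+\rho_K-\rho_P\in D_1=\{s\in\mathbb R^3: s_1+s_2+s_3=0,\ s_1>s_3>s_2\}$, where $\rho_K=(\frac12,-\frac12,0)$ and $\rho_P$ is half the sum of the noncompact roots $\epsilon_1-\epsilon_3,\ \epsilon_3-\epsilon_2$. Let $W=H^D(X)=\{v\in X\otimes S: av=0 \text{ for all } a\in\mathcal I\}$. Let $v\in X$ be a highest weight vector of weight $p$ and put $$w_s=F^s v\otimes E_1-(p_1-p_2-(s-1))\,F^{s-1}v\otimes E_2,\qquad s=1,\dots,p_1-p_2 .$$ Theorem. The space $W$ is stable under $\mathcal B$, the vectors $w_s$ $(1\le s\le p_1-p_2)$ belong to $W$, and the complex vector space $\mathcal A\otimes_{\mathcal B}W=(\mathcal A\otimes_{\mathbb C} W)/\mathrm{span}\{ab\otimes w-a\otimes bw: a\in\mathcal A,\ b\in\mathcal B,\ w\in W\}$ is spanned by the elements $$(E_1^nF_2^m\otimes y)\otimes w_s,\qquad n,m\in\mathbb N_0,\ 1\le s\le p_1-p_2,\ y\in\{F_2,\,E_1F_2,\,E_2F_2,\,E_1\},$$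 together with the elements $$(x\otimes y')\otimes w_{p_1-p_2},\qquad y'\in\{F_1,\,E_1F_1,\,E_2F_1,\,E_2\},\quad x=(\mathrm{ad}F)^j(E_1^nF_2^m),\ n,m\in\mathbb N_0,\ 0\le j\le n+m .$$ -/

import Mathlib

open scoped TensorProduct Matrix
open LieAlgebra.SpecialLinear (sl single singleSubSingle)

namespace SU21

noncomputable section

attribute [local instance 100] LieRing.ofAssociativeRing

/-! ### The group `SU(2,1)`, its maximal compact subgroup and the Lie algebras -/

/-- `Γ = diag(1, 1, -1)`. -/
def Gam : Matrix (Fin 3) (Fin 3) ℂ := Matrix.diagonal ![1, 1, -1]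

/-- The group `SU(2,1) = {g ∈ GL(3, ℂ) : det g = 1, g* Γ g = Γ}`. -/
def G : Subgroup (GL (Fin 3) ℂ) where
  carrier := {g | (g : Matrix (Fin 3) (Fin 3) ℂ).det = 1 ∧
    (g : Matrix (Fin 3) (Fin 3) ℂ)ᴴ * Gam * (g : Matrix (Fin 3) (Fin 3) ℂ) = Gam}
  one_mem' := by simp
  mul_mem' := by
    rintro a b ⟨ha, ha'⟩ ⟨hb, hb'⟩
    refine ⟨by simp [ha, hb], ?_⟩
    rw [Units.val_mul, Matrix.conjTranspose_mul]
    calc _ = (b : Matrix (Fin 3) (Fin 3) ℂ)ᴴ *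
            ((a : Matrix (Fin 3) (Fin 3) ℂ)ᴴ * Gam * (a : Matrix (Fin 3) (Fin 3) ℂ)) *
            (b : Matrix (Fin 3) (Fin 3) ℂ) := by simp only [mul_assoc]
      _ = Gam := by rw [ha', hb']
  inv_mem' := by
    rintro a ⟨ha, ha'⟩
    have h1 : (a : Matrix (Fin 3) (Fin 3) ℂ) * ((a⁻¹ : GL (Fin 3) ℂ) : Matrix _ _ ℂ) = 1 := by
      rw [← Units.val_mul, mul_inv_cancel, Units.val_one]
    have h2 : (((a⁻¹ : GL (Fin 3) ℂ) : Matrix _ _ ℂ))ᴴ * (a : Matrix (Fin 3) (Fin 3) ℂ)ᴴ = 1 := by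
      rw [← Matrix.conjTranspose_mul, h1, Matrix.conjTranspose_one]
    refine ⟨?_, ?_⟩
    · simp [ha]
    · calc _ = (((a⁻¹ : GL (Fin 3) ℂ) : Matrix _ _ ℂ))ᴴ *
            ((a : Matrix (Fin 3) (Fin 3) ℂ)ᴴ * Gam * (a : Matrix (Fin 3) (Fin 3) ℂ)) *
            ((a⁻¹ : GL (Fin 3) ℂ) : Matrix _ _ ℂ) := by rw [ha']
        _ = ((((a⁻¹ : GL (Fin 3) ℂ) : Matrix _ _ ℂ))ᴴ * (a : Matrix (Fin 3) (Fin 3) ℂ)ᴴ) * Gam *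
            ((a : Matrix (Fin 3) (Fin 3) ℂ) * ((a⁻¹ : GL (Fin 3) ℂ) : Matrix _ _ ℂ)) := by
              simp only [mul_assoc]
        _ = Gam := by rw [h1, h2, one_mul, mul_one]

/-- The maximal compact subgroup `K = {g ∈ SU(2,1) : Θ(g) = g}`, where `Θ(g) = (g⁻¹)*`;
it consists of the unitary elements of `SU(2,1)` and is isomorphic to `U(2)`. -/
def K : Subgroup (GL (Fin 3) ℂ) where
  carrier := {g | g ∈ G ∧
    ((g⁻¹ : GL (Fin 3) ℂ) : Matrix (Fin 3) (Fin 3) ℂ)ᴴ = (g : Matrix (Fin 3) (Fin 3) ℂ)}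
  one_mem' := ⟨G.one_mem, by simp⟩
  mul_mem' := by
    rintro a b ⟨ha, ha'⟩ ⟨hb, hb'⟩
    refine ⟨G.mul_mem ha hb, ?_⟩
    rw [mul_inv_rev, Units.val_mul, Matrix.conjTranspose_mul, ha', hb', Units.val_mul]
  inv_mem' := by
    rintro a ⟨ha, ha'⟩
    refine ⟨G.inv_mem ha, ?_⟩
    rw [inv_inv, ← ha', Matrix.conjTranspose_conjTranspose]

/-- The complexified Lie algebra `𝔤 = 𝔰𝔩(3, ℂ)`. -/
abbrev g : Type := ↥(sl (Fin 3) ℂ)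

/-- `x ∈ 𝔤₀ = 𝔰𝔲(2,1)`, i.e. `tr x = 0` and `x* Γ + Γ x = 0`. -/
def InG0 (x : g) : Prop := x.1ᴴ * Gam + Gam * x.1 = 0

/-- `𝔨 = {x ∈ 𝔤 : Γ x = x Γ}`: block diagonal matrices, the complexified Lie algebra of `K`. -/
def k : Submodule ℂ g where
  carrier := {x | Gam * x.1 = x.1 * Gam}
  zero_mem' := by simp
  add_mem' := by
    intro a b ha hb
    simp only [Set.mem_ofPred_eq] at *
    simp [mul_add, add_mul, ha, hb]
  smul_mem' := by
    intro c a ha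
    simp only [Set.mem_ofPred_eq] at *
    simp [ha]

/-- `𝔭 = {x ∈ 𝔤 : Γ x = - x Γ}`: block antidiagonal matrices. -/
def p : Submodule ℂ g where
  carrier := {x | Gam * x.1 = -(x.1 * Gam)}
  zero_mem' := by simp
  add_mem' := by
    intro a b ha hb
    simp only [Set.mem_ofPred_eq] at *
    simp [mul_add, add_mul, ha, hb, add_comm]
  smul_mem' := by
    intro c a ha
    simp only [Set.mem_ofPred_eq] at *
    simp [ha]

/-- `E = e₁₂`. -/
def E : g := single 0 1 (by decide) 1
/-- `F = e₂₁`. -/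
def F : g := single 1 0 (by decide) 1
/-- `H₁ = e₁₁ - e₃₃`. -/
def H₁ : g := singleSubSingle 0 2 1
/-- `H₂ = e₂₂ - e₃₃`. -/
def H₂ : g := singleSubSingle 1 2 1
/-- `h₁ = (2 H₁ - H₂) / 3`. -/
def h₁ : g := (1 / 3 : ℂ) • ((2 : ℂ) • H₁ - H₂)
/-- `h₂ = (2 H₂ - H₁) / 3`. -/
def h₂ : g := (1 / 3 : ℂ) • ((2 : ℂ) • H₂ - H₁)
/-- `E₁ = e₁₃`. -/
def E₁ : g := single 0 2 (by decide) 1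
/-- `E₂ = e₂₃`. -/
def E₂ : g := single 1 2 (by decide) 1
/-- `F₁ = e₃₁`. -/
def F₁ : g := single 2 0 (by decide) 1
/-- `F₂ = e₃₂`. -/
def F₂ : g := single 2 1 (by decide) 1

lemma mem_p_E₁ : E₁ ∈ p := by
  change Gam * (Matrix.single 0 2 (1 : ℂ)) = -(Matrix.single 0 2 (1 : ℂ) * Gam)
  ext i j
  fin_cases i <;> fin_cases j <;> simp [Gam]
lemma mem_p_E₂ : E₂ ∈ p := by
  change Gam * (Matrix.single 1 2 (1 : ℂ)) = -(Matrix.single 1 2 (1 : ℂ) * Gam)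
  ext i j
  fin_cases i <;> fin_cases j <;> simp [Gam]
lemma mem_p_F₁ : F₁ ∈ p := by
  change Gam * (Matrix.single 2 0 (1 : ℂ)) = -(Matrix.single 2 0 (1 : ℂ) * Gam)
  ext i j
  fin_cases i <;> fin_cases j <;> simp [Gam]
lemma mem_p_F₂ : F₂ ∈ p := by
  change Gam * (Matrix.single 2 1 (1 : ℂ)) = -(Matrix.single 2 1 (1 : ℂ) * Gam)
  ext i j
  fin_cases i <;> fin_cases j <;> simp [Gam]

/-- The adjoint action `Ad(a) x = a x a⁻¹` of `GL(3, ℂ)` (in particular of `K`) on `𝔤`. -/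
def Ad (a : GL (Fin 3) ℂ) : g →ₗ⁅ℂ⁆ g where
  toFun x := ⟨(a : Matrix (Fin 3) (Fin 3) ℂ) * x.1 * ((a⁻¹ : GL (Fin 3) ℂ) : Matrix _ _ ℂ), by
    have hx : Matrix.trace x.1 = 0 := x.2
    change Matrix.trace ((a : Matrix (Fin 3) (Fin 3) ℂ) * x.1 *
      ((a⁻¹ : GL (Fin 3) ℂ) : Matrix (Fin 3) (Fin 3) ℂ)) = 0
    rw [Matrix.trace_mul_comm, ← mul_assoc, ← Units.val_mul, inv_mul_cancel]
    simpa using hx⟩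
  map_add' x y := Subtype.ext (by simp [mul_add, add_mul])
  map_smul' c x := Subtype.ext (by simp)
  map_lie' := by
    intro x y
    apply Subtype.ext
    have h : ((a⁻¹ : GL (Fin 3) ℂ) : Matrix (Fin 3) (Fin 3) ℂ) * (a : Matrix _ _ ℂ) = 1 := by
      rw [← Units.val_mul, inv_mul_cancel, Units.val_one]
    have key : ∀ u v : Matrix (Fin 3) (Fin 3) ℂ,
        ((a : Matrix _ _ ℂ) * u * ((a⁻¹ : GL (Fin 3) ℂ) : Matrix _ _ ℂ)) *
        ((a : Matrix _ _ ℂ) * v * ((a⁻¹ : GL (Fin 3) ℂ) : Matrix _ _ ℂ)) =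
        (a : Matrix _ _ ℂ) * (u * v) * ((a⁻¹ : GL (Fin 3) ℂ) : Matrix _ _ ℂ) := by
      intro u v
      calc _ = (a : Matrix _ _ ℂ) * u * (((a⁻¹ : GL (Fin 3) ℂ) : Matrix _ _ ℂ) *
              (a : Matrix _ _ ℂ)) * v * ((a⁻¹ : GL (Fin 3) ℂ) : Matrix _ _ ℂ) := by
                simp only [mul_assoc]
        _ = _ := by rw [h]; simp only [mul_assoc, one_mul]
    simp only [LieAlgebra.SpecialLinear.sl_bracket, key, mul_sub, sub_mul]

/-! ### The algebra `𝒜 = U(𝔤) ⊗ C(𝔭)` -/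

/-- The trace form `B(x, y) = tr(x y)` on `𝔭`. -/
def B : LinearMap.BilinForm ℂ p :=
  LinearMap.mk₂ ℂ (fun x y => Matrix.trace (x.1.1 * y.1.1))
    (by intros; simp [add_mul]) (by intros; simp) (by intros; simp [mul_add]) (by intros; simp)

/-- The quadratic form `x ↦ - B(x, x)` on `𝔭`. -/
def Q : QuadraticForm ℂ p := -B.toQuadraticMap

/-- The Clifford algebra `C(𝔭)` of `𝔭` with respect to `B`, with relations
`x y + y x = - 2 B(x, y)`. -/
abbrev Cl : Type := CliffordAlgebra Q

/-- The universal enveloping algebra `U(𝔤)`. -/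
abbrev Ug : Type := UniversalEnvelopingAlgebra ℂ g

/-- The algebra `𝒜 = U(𝔤) ⊗ C(𝔭)`. -/
abbrev A : Type := Ug ⊗[ℂ] Cl

/-- The inclusion of `𝔤` into `U(𝔤)`. -/
abbrev u (x : g) : Ug := UniversalEnvelopingAlgebra.ι ℂ x

/-- `E₁` as an element of `C(𝔭)`. -/
def cE₁ : Cl := CliffordAlgebra.ι Q ⟨E₁, mem_p_E₁⟩
/-- `E₂` as an element of `C(𝔭)`. -/
def cE₂ : Cl := CliffordAlgebra.ι Q ⟨E₂, mem_p_E₂⟩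
/-- `F₁` as an element of `C(𝔭)`. -/
def cF₁ : Cl := CliffordAlgebra.ι Q ⟨F₁, mem_p_F₁⟩
/-- `F₂` as an element of `C(𝔭)`. -/
def cF₂ : Cl := CliffordAlgebra.ι Q ⟨F₂, mem_p_F₂⟩

/-- The Dirac operator `D = ∑ bᵢ ⊗ dᵢ` for the basis `E₁, E₂, F₁, F₂` of `𝔭` and its dual
basis `F₁, F₂, E₁, E₂` with respect to `B`. -/
def D : A := u E₁ ⊗ₜ[ℂ] cF₁ + u E₂ ⊗ₜ[ℂ] cF₂ + u F₁ ⊗ₜ[ℂ] cE₁ + u F₂ ⊗ₜ[ℂ] cE₂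

lemma lie_mem_p (x : k) (y : p) : ⁅x.1, y.1⁆ ∈ p := by
  have hx : Gam * x.1.1 = x.1.1 * Gam := x.2
  have hy : Gam * y.1.1 = -(y.1.1 * Gam) := y.2
  change Gam * (⁅x.1, y.1⁆ : g).1 = -((⁅x.1, y.1⁆ : g).1 * Gam)
  rw [LieAlgebra.SpecialLinear.sl_bracket]
  have e1 : Gam * (x.1.1 * y.1.1) = -(x.1.1 * y.1.1 * Gam) := by
    rw [← mul_assoc, hx, mul_assoc, hy, mul_neg, mul_assoc]
  have e2 : Gam * (y.1.1 * x.1.1) = -(y.1.1 * x.1.1 * Gam) := by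
    rw [← mul_assoc, hy, neg_mul, mul_assoc, hx, mul_assoc]
  rw [mul_sub, sub_mul, e1, e2]
  abel

/-- The adjoint action of `x ∈ 𝔨` on `𝔭`, followed by the inclusion of `𝔭` into `C(𝔭)`. -/
def cAd (x : k) (y : p) : Cl := CliffordAlgebra.ι Q ⟨⁅x.1, y.1⁆, lie_mem_p x y⟩

/-- The map `α : 𝔨 → 𝔰𝔬(𝔭) → C(𝔭)`, `α(x) = - (1/4) ∑ᵢ [x, bᵢ] dᵢ`; it satisfies
`α(x) y - y α(x) = [x, y]` for `y ∈ 𝔭`. -/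
def α (x : k) : Cl :=
  (-(1 / 4) : ℂ) • (cAd x ⟨E₁, mem_p_E₁⟩ * cF₁ + cAd x ⟨E₂, mem_p_E₂⟩ * cF₂ +
    cAd x ⟨F₁, mem_p_F₁⟩ * cE₁ + cAd x ⟨F₂, mem_p_F₂⟩ * cE₂)

/-- The diagonal embedding `x ↦ x_Δ = x ⊗ 1 + 1 ⊗ α(x)` of `𝔨` into `𝒜`. -/
def Δ (x : k) : A := u x.1 ⊗ₜ[ℂ] (1 : Cl) + (1 : Ug) ⊗ₜ[ℂ] α x

lemma Gam_comm (a : K) : Gam * ((a : GL (Fin 3) ℂ) : Matrix (Fin 3) (Fin 3) ℂ) =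
    ((a : GL (Fin 3) ℂ) : Matrix (Fin 3) (Fin 3) ℂ) * Gam := by
  obtain ⟨a, ⟨ha1, ha2⟩, ha3⟩ := a
  have h1 : (a : Matrix (Fin 3) (Fin 3) ℂ) * (a : Matrix (Fin 3) (Fin 3) ℂ)ᴴ = 1 := by
    rw [← ha3, Matrix.conjTranspose_conjTranspose, ha3, ← Units.val_mul, mul_inv_cancel,
      Units.val_one]
  change Gam * (a : Matrix (Fin 3) (Fin 3) ℂ) = (a : Matrix (Fin 3) (Fin 3) ℂ) * Gam
  calc _ = ((a : Matrix (Fin 3) (Fin 3) ℂ) * (a : Matrix (Fin 3) (Fin 3) ℂ)ᴴ) * Gam *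
          (a : Matrix (Fin 3) (Fin 3) ℂ) := by rw [h1, one_mul]
    _ = (a : Matrix (Fin 3) (Fin 3) ℂ) * ((a : Matrix (Fin 3) (Fin 3) ℂ)ᴴ * Gam *
          (a : Matrix (Fin 3) (Fin 3) ℂ)) := by simp only [mul_assoc]
    _ = _ := by rw [ha2]

lemma Ad_mem_p (a : K) (y : p) : Ad a y.1 ∈ p := by
  have hy : Gam * y.1.1 = -(y.1.1 * Gam) := y.2
  have h1 := Gam_comm a
  have h2 := Gam_comm a⁻¹
  change Gam * (((a : GL (Fin 3) ℂ) : Matrix (Fin 3) (Fin 3) ℂ) * y.1.1 *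
      (((a : GL (Fin 3) ℂ)⁻¹ : GL (Fin 3) ℂ) : Matrix (Fin 3) (Fin 3) ℂ)) =
    -((((a : GL (Fin 3) ℂ) : Matrix (Fin 3) (Fin 3) ℂ) * y.1.1 *
      (((a : GL (Fin 3) ℂ)⁻¹ : GL (Fin 3) ℂ) : Matrix (Fin 3) (Fin 3) ℂ)) * Gam)
  rw [InvMemClass.coe_inv] at h2
  rw [mul_assoc _ _ Gam, ← h2, ← mul_assoc, ← mul_assoc, h1, mul_assoc _ Gam, hy]
  simp [mul_assoc]

/-- The adjoint action of `a ∈ K` on `𝔭`, as an isometry. -/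
def AdP (a : K) : Q →qᵢ Q where
  toFun y := ⟨Ad a y.1, Ad_mem_p a y⟩
  map_add' x y := Subtype.ext (by simp)
  map_smul' c x := Subtype.ext (by simp)
  map_app' y := by
    have h : (((a : GL (Fin 3) ℂ)⁻¹ : GL (Fin 3) ℂ) : Matrix (Fin 3) (Fin 3) ℂ) *
        ((a : GL (Fin 3) ℂ) : Matrix (Fin 3) (Fin 3) ℂ) = 1 := by
      rw [← Units.val_mul, inv_mul_cancel, Units.val_one]
    change -(Matrix.trace ((((a : GL (Fin 3) ℂ) : Matrix (Fin 3) (Fin 3) ℂ) * y.1.1 *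
      (((a : GL (Fin 3) ℂ)⁻¹ : GL (Fin 3) ℂ) : Matrix (Fin 3) (Fin 3) ℂ)) *
      (((a : GL (Fin 3) ℂ) : Matrix (Fin 3) (Fin 3) ℂ) * y.1.1 *
      (((a : GL (Fin 3) ℂ)⁻¹ : GL (Fin 3) ℂ) : Matrix (Fin 3) (Fin 3) ℂ)))) =
      -(Matrix.trace (y.1.1 * y.1.1))
    congr 1
    rw [← mul_assoc, Matrix.trace_mul_comm]
    simp only [← mul_assoc, h, one_mul]
    rw [mul_assoc _ (((a : GL (Fin 3) ℂ)⁻¹ : GL (Fin 3) ℂ) : Matrix (Fin 3) (Fin 3) ℂ), h, mul_one]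

/-- The action of `a ∈ K` on `𝒜 = U(𝔤) ⊗ C(𝔭)`, induced by the adjoint action on both
factors. -/
def AdA (a : K) : A →ₐ[ℂ] A :=
  Algebra.TensorProduct.map
    (UniversalEnvelopingAlgebra.lift ℂ ((UniversalEnvelopingAlgebra.ι ℂ).comp (Ad a)))
    (CliffordAlgebra.map (AdP a))

/-- The algebra `𝒜^K` of `K`-invariants in `𝒜`. -/
def AK : Subalgebra ℂ A := ⨅ a : K, AlgHom.equalizer (AdA a) (AlgHom.id ℂ A)

/-- The two-sided ideal `ℐ` of `𝒜^K` generated by `D`. -/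
def I : Submodule ℂ A := Submodule.span ℂ {x | ∃ a ∈ AK, ∃ b ∈ AK, x = a * D * b}

/-- The subalgebra `ℬ` of `𝒜` generated by `𝔨_Δ` and `𝒜^K`. -/
def BB : Subalgebra ℂ A := Algebra.adjoin ℂ (Set.range Δ ∪ (AK : Set A))

/-! ### The spin module -/

/-- The space `S = ⋀ 𝔭⁺`, with `𝔭⁺ = span {E₁, E₂}` identified with `ℂ²` by the basis
`E₁, E₂`. -/
abbrev S : Type := ExteriorAlgebra ℂ (Fin 2 → ℂ)

/-- The vector `E₁` of `S`. -/
def sE₁ : S := ExteriorAlgebra.ι ℂ (Pi.single 0 1)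
/-- The vector `E₂` of `S`. -/
def sE₂ : S := ExteriorAlgebra.ι ℂ (Pi.single 1 1)

/-- The `𝔭⁺`-coordinates of `x ∈ 𝔭`. -/
def plus : p →ₗ[ℂ] (Fin 2 → ℂ) where
  toFun x := ![x.1.1 0 2, x.1.1 1 2]
  map_add' x y := by simp
  map_smul' c x := by simp

/-- For `x ∈ 𝔭`, the functional `z ↦ B(x, z)` on `𝔭⁺`. -/
def minus : p →ₗ[ℂ] Module.Dual ℂ (Fin 2 → ℂ) where
  toFun x := x.1.1 2 0 • LinearMap.proj 0 + x.1.1 2 1 • LinearMap.proj 1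
  map_add' x y := by ext i; fin_cases i <;> simp
  map_smul' c x := by ext i; fin_cases i <;> simp

/-- The action of `𝔭` on `S`: elements of `𝔭⁺` act by exterior multiplication, elements `x` of
`𝔭⁻` by `-2` times the contraction with `B(x, ·)`. -/
def spinP : p →ₗ[ℂ] Module.End ℂ S :=
  (LinearMap.mul ℂ S).comp ((ExteriorAlgebra.ι ℂ).comp plus) -
    (2 : ℂ) • (CliffordAlgebra.contractLeft (Q := (0 : QuadraticForm ℂ (Fin 2 → ℂ)))).comp minus

lemma trace_sq (x : p) : Matrix.trace (x.1.1 * x.1.1) =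
    2 * (x.1.1 0 2 * x.1.1 2 0 + x.1.1 1 2 * x.1.1 2 1) := by
  have hx : Gam * x.1.1 = -(x.1.1 * Gam) := x.2
  have h : ∀ i j, (Gam * x.1.1) i j = (-(x.1.1 * Gam)) i j := fun i j => by rw [hx]
  have h00 := h 0 0
  have h01 := h 0 1
  have h10 := h 1 0
  have h11 := h 1 1
  have h22 := h 2 2
  simp [Gam] at h00 h01 h10 h11 h22
  have z : ∀ c : ℂ, c = -c → c = 0 := fun c hc => self_eq_neg.mp hc
  have h22' : x.1.1 2 2 = 0 := z _ (by linear_combination -h22)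
  simp [Matrix.trace, Matrix.mul_apply, Fin.sum_univ_three, z _ h00, z _ h01, z _ h10, z _ h11, h22']
  ring

lemma spinP_sq (x : p) : spinP x * spinP x = algebraMap ℂ (Module.End ℂ S) (Q x) := by
  have e : ∀ s : S, spinP x s = ExteriorAlgebra.ι ℂ (plus x) * s -
      (2 : ℂ) • CliffordAlgebra.contractLeft (Q := (0 : QuadraticForm ℂ (Fin 2 → ℂ)))
        (minus x) s := fun s => rfl
  have hQ : Q x = -(2 * minus x (plus x)) := by
    change -(Matrix.trace (x.1.1 * x.1.1)) = -(2 * (x.1.1 2 0 * x.1.1 0 2 + x.1.1 2 1 * x.1.1 1 2))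
    rw [trace_sq]
    ring
  apply LinearMap.ext
  intro s
  have h1 : ExteriorAlgebra.ι ℂ (plus x) * (ExteriorAlgebra.ι ℂ (plus x) * s) = 0 := by
    rw [← mul_assoc, ExteriorAlgebra.ι_sq_zero, zero_mul]
  have h2 := CliffordAlgebra.contractLeft_ι_mul (Q := (0 : QuadraticForm ℂ (Fin 2 → ℂ)))
    (d := minus x) (plus x) s
  have h3 := CliffordAlgebra.contractLeft_contractLeft (Q := (0 : QuadraticForm ℂ (Fin 2 → ℂ)))
    (d := minus x) s
  change spinP x (spinP x s) = Q x • s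
  rw [e, e, hQ, mul_sub, h1, map_sub, map_smul, h3, mul_smul_comm]
  change _ - (2 : ℂ) • (CliffordAlgebra.contractLeft (minus x)
    (CliffordAlgebra.ι (0 : QuadraticForm ℂ (Fin 2 → ℂ)) (plus x) * s) - _) = _
  rw [h2]
  change 0 - (2 : ℂ) • (ExteriorAlgebra.ι ℂ (plus x) * _) - _ = _
  simp only [smul_sub, smul_zero, neg_smul, mul_smul, zero_sub, sub_zero]
  change _ - (_ - (2 : ℂ) • (ExteriorAlgebra.ι ℂ (plus x) * _)) = _
  abel

/-- The spin module: the action of `C(𝔭)` on `S`. -/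
def spin : Cl →ₐ[ℂ] Module.End ℂ S := CliffordAlgebra.lift Q ⟨spinP, spinP_sq⟩

/-! ### `(𝔤, K)`-modules -/

section Modules

variable {X : Type*} [AddCommGroup X] [Module ℂ X] [LieRingModule g X] [LieModule ℂ g X]

/-- A `𝔤`-module `X` with a representation `ρ` of `K` is a `(𝔤, K)`-module: the `K`-action is
locally finite and continuous, its differential is the restriction of the `𝔤`-action, and the
two actions are compatible. Continuity and differentiability of the orbit maps are tested
on linear functionals; each orbit spans a finite-dimensional space. -/
structure IsGKModule (ρ : Representation ℂ K X) : Prop where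
  locallyFinite : ∀ x : X, ∃ V : Submodule ℂ X, FiniteDimensional ℂ V ∧ x ∈ V ∧
    ∀ a : K, ∀ y ∈ V, ρ a y ∈ V
  continuous : ∀ (x : X) (f : Module.Dual ℂ X), Continuous fun a : K => f (ρ a x)
  differential : ∀ (Y : g) (γ : ℝ → K),
    (∀ t : ℝ, ((γ t : GL (Fin 3) ℂ) : Matrix (Fin 3) (Fin 3) ℂ) = NormedSpace.exp (t • Y.1)) →
    ∀ (x : X) (f : Module.Dual ℂ X),
      HasDerivAt (fun t : ℝ => f (ρ (γ t) x)) (f ⁅Y, x⁆) 0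
  compatible : ∀ (a : K) (Y : g) (x : X), ρ a ⁅Y, x⁆ = ⁅Ad a Y, ρ a x⁆

/-- `X` is unitary: it carries a positive definite Hermitian form for which `K` acts by isometries
and `𝔤₀` by skew-Hermitian operators. -/
def IsUnitary (ρ : Representation ℂ K X) : Prop :=
  ∃ φ : X →ₗ⋆[ℂ] X →ₗ[ℂ] ℂ,
    (∀ x y, starRingEnd ℂ (φ x y) = φ y x) ∧
    (∀ x, x ≠ 0 → 0 < (φ x x).re) ∧
    (∀ (a : K) x y, φ (ρ a x) (ρ a y) = φ x y) ∧
    ∀ Y : g, InG0 Y → ∀ x y, φ ⁅Y, x⁆ y = -φ x ⁅Y, y⁆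

/-- `K̂`, as the set of highest weights `(q₁, q₂, -q₁-q₂)` with `q₁, q₂ ∈ (1/3) ℤ` and
`q₁ - q₂ ∈ {0, 1, 2, …}`. -/
def KHat : Set (Fin 3 → ℝ) :=
  {q | q 0 + q 1 + q 2 = 0 ∧ (∃ a : ℤ, q 0 = a / 3) ∧ (∃ b : ℤ, q 1 = b / 3) ∧
    ∃ n : ℕ, q 0 - q 1 = n}

/-- `x ∈ X` is a highest weight vector of weight `q` for `𝔨`. -/
def IsHighestWeightVector (q : Fin 3 → ℝ) (x : X) : Prop :=
  x ≠ 0 ∧ ⁅E, x⁆ = 0 ∧ ⁅h₁, x⁆ = (q 0 : ℂ) • x ∧ ⁅h₂, x⁆ = (q 1 : ℂ) • x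

variable (X) in
/-- The `K`-type with highest weight `q` occurs in the `(𝔤, K)`-module `X`. -/
def HasKType (q : Fin 3 → ℝ) : Prop := q ∈ KHat ∧ ∃ x : X, IsHighestWeightVector q x

/-- `ρ_K`, half the sum of the positive compact roots. -/
def rhoK : Fin 3 → ℝ := ![1 / 2, -1 / 2, 0]

/-- `ρ_P`, half the sum `((ε₁ - ε₃) + (ε₃ - ε₂)) / 2` of the noncompact roots that are positive
on the chamber `D₁`. -/
def rhoP : Fin 3 → ℝ := (1 / 2 : ℝ) • (![1, 0, -1] + ![0, -1, 1])

/-- The Weyl chamber `D₁ = {s : s₁ > s₃ > s₂}` in `{s ∈ ℝ³ : s₁ + s₂ + s₃ = 0}`. -/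
def D₁ : Set (Fin 3 → ℝ) := {s | s 0 + s 1 + s 2 = 0 ∧ s 0 > s 2 ∧ s 2 > s 1}

variable (X) in
/-- `q` is a minimal `K`-type of `X`: it occurs in `X`, and `‖q + 2 ρ_K‖` is minimal among the
`K`-types that occur. -/
def IsMinimalKType (q : Fin 3 → ℝ) : Prop :=
  HasKType X q ∧ ∀ r, HasKType X r →
    ∑ i, (q i + 2 * rhoK i) ^ 2 ≤ ∑ i, (r i + 2 * rhoK i) ^ 2

/-- `X` is (the `(𝔤, K)`-module of) the nonholomorphic discrete series representation `π_q` of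
`SU(2,1)`: the irreducible unitary module with minimal `K`-type `q`, where
`q + ρ_K - ρ_P ∈ D₁`. Since `K` is connected, irreducibility as a `(𝔤, K)`-module is
irreducibility as a `𝔤`-module. -/
structure IsNonholomorphicDiscreteSeries (ρ : Representation ℂ K X) (q : Fin 3 → ℝ) : Prop where
  isGKModule : IsGKModule ρ
  irreducible : LieModule.IsIrreducible ℂ g X
  unitary : IsUnitary ρ
  minimalKType : IsMinimalKType X q
  chamber : q + rhoK - rhoP ∈ D₁

variable (X) in
/-- The action of `𝒜 = U(𝔤) ⊗ C(𝔭)` on `X ⊗ S`. -/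
def act : A →ₐ[ℂ] Module.End ℂ (X ⊗[ℂ] S) :=
  (Module.endTensorEndAlgHom (R := ℂ) (S := ℂ) (A := ℂ) (M := X) (N := S)).comp
    (Algebra.TensorProduct.map
      (UniversalEnvelopingAlgebra.lift ℂ (LieModule.toEnd ℂ g X)) spin)

variable (X) in
/-- The Dirac cohomology `H^D(X) = {v ∈ X ⊗ S : a v = 0 for all a ∈ ℐ}`. -/
def HD : Submodule ℂ (X ⊗[ℂ] S) where
  carrier := {v | ∀ a ∈ I, act X a v = 0}
  zero_mem' := by simp
  add_mem' := by
    intro v w hv hw a ha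
    rw [map_add, hv a ha, hw a ha, add_zero]
  smul_mem' := by
    intro c v hv a ha
    rw [map_smul, hv a ha, smul_zero]

/-- `Z = span {a b ⊗ w - a ⊗ b w : a ∈ 𝒜, b ∈ ℬ, w ∈ W}` for a subspace `W` of `X ⊗ S`
(stable under `ℬ`). -/
def Z (W : Submodule ℂ (X ⊗[ℂ] S)) : Submodule ℂ (A ⊗[ℂ] W) :=
  Submodule.span ℂ {z | ∃ (a b : A) (w w' : W), b ∈ BB ∧ (w' : X ⊗[ℂ] S) = act X b w ∧
    z = (a * b) ⊗ₜ[ℂ] w - a ⊗ₜ[ℂ] w'}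

/-- The induced space `𝒜 ⊗_ℬ W`, for a `ℬ`-stable subspace `W` of `X ⊗ S`. -/
abbrev Ind (W : Submodule ℂ (X ⊗[ℂ] S)) : Type _ := (A ⊗[ℂ] W) ⧸ Z W

/-- The element `a ⊗ w` of `𝒜 ⊗_ℬ W`. -/
def ind {W : Submodule ℂ (X ⊗[ℂ] S)} (a : A) (w : W) : Ind W := (Z W).mkQ (a ⊗ₜ[ℂ] w)

/-- The vectors `w_s = F^s v ⊗ E₁ - (d - (s - 1)) F^(s-1) v ⊗ E₂` of `X ⊗ S`, for `s ≥ 1`, where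
`v` is a highest weight vector of weight `(p₁, p₂)` and `d = p₁ - p₂`. -/
def w (v : X) (d s : ℕ) : X ⊗[ℂ] S :=
  ((LieModule.toEnd ℂ g X F) ^ s) v ⊗ₜ[ℂ] sE₁ -
    ((d : ℂ) - ((s : ℂ) - 1)) • ((LieModule.toEnd ℂ g X F) ^ (s - 1)) v ⊗ₜ[ℂ] sE₂

end Modules

/-- The operator `(ad F)(a) = F a - a F` on `U(𝔤)`. -/
def adF (a : Ug) : Ug := u F * a - a * u F

end

end SU21

namespace SU21

attribute [local instance 100] LieRing.ofAssociativeRing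

/-! ### Structure constants -/

/-! Write `a = p₁ - p₃`, `b = p₂ - p₃` for the weights of `v` under `H₁, H₂`, and `d = a - b = p₁ -
p₂`. Everything rests on one computation about a `𝔨`-highest weight vector in a `𝔤`-module, carried
out for an arbitrary `𝔤`-module and used twice.

Call `v` a bottom vector (`IsBottom`) if the two highest weight vectors of `𝔭 · v` that lower `a -
b`, namely `F E₁ v - (d+1) E₂ v` and `F F₂ v + (d+1) F₁ v`, vanish. Then `F₁E₁ + F₂E₂` acts on `v`
by `-(a+1)`, each `E₁ⁿF₂ᵐv` is a highest weight vector on which that operator is an explicit scalar,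
and `E₂`, `F₁` are expressed through `F` up to terms of smaller `n + m`. So the `FʲE₁ⁿF₂ᵐv` span a
`𝔤`-submodule (`IsBottom.apply_mem_iSup`). Moreover `E₁ⁿF₂ᵐFʲv` is a nonzero multiple of `FʲE₁ⁿF₂ᵐv`
modulo lower level when `j ≤ d`; this triangularity gives the spanning set of
`IsBottom.iSup_strings_le`.

First use: in `X` the vector `v` is a bottom vector, since a nonzero lower component would be a
`K`-type of smaller norm. By irreducibility the strings exhaust `X`, and the Casimir element acts by
a scalar. Hence `D²` is, up to a scalar, the Casimir element of `𝔨_Δ` (`act_D_sq`); the highest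
weight vectors of `X ⊗ S` built from `E₁ⁿF₂ᵐv` are eigenvectors of `D²`, and only `w₁` has
eigenvalue `0`. So `ker D²` is the span of the `w_s`. It is stable under `𝒜^K`, which commutes with
`𝔨_Δ`, and it is killed by `D`; hence `W` is the span of the `w_s` (`HD_eq_wSpan`).

Second use: in `𝒜 ⊗_ℬ W` put `j_s = 1 ⊗ w_s`. Elements of `ℬ` may be moved across the tensor sign,
so `D`, `1 ⊗ (E₁F₁ + E₂F₂)`, `(F₁E₁ + F₂E₂) ⊗ 1` and `𝔨_Δ` act on `j_s` as they do on `w_s`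
(`IsDiracString`). These relations alone imply that `(1 ⊗ F₂) j₁` is again a bottom vector of weight
`(a, b)`; its counterpart in `X ⊗ S` is `2d · v ⊗ 1`. Its `F`-string runs, up to nonzero factors,
through `(1 ⊗ F₂) j_1, …, (1 ⊗ F₂) j_d` and ends in `(1 ⊗ F₁) j_d`; this is why the second family
involves `w_d` only, and `ad F` appears because `F` kills that last vector. Multiplication by `1,
E₁, E₂, E₁E₂ ∈ C(𝔭)` then produces the whole module; on `j_s` one has `E₁E₂F₂ = -2E₁` and `E₁E₂F₁ =
2E₂`, which accounts for the last entries of the two lists of Clifford factors. -/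

lemma val_E : E.1 = !![0, 1, 0; 0, 0, 0; 0, 0, 0] := by
  ext i j; fin_cases i <;> fin_cases j <;> simp [E]
lemma val_F : F.1 = !![0, 0, 0; 1, 0, 0; 0, 0, 0] := by
  ext i j; fin_cases i <;> fin_cases j <;> simp [F]
lemma val_H₁ : H₁.1 = !![1, 0, 0; 0, 0, 0; 0, 0, -1] := by
  ext i j; fin_cases i <;> fin_cases j <;> simp [H₁]
lemma val_H₂ : H₂.1 = !![0, 0, 0; 0, 1, 0; 0, 0, -1] := by
  ext i j; fin_cases i <;> fin_cases j <;> simp [H₂]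
lemma val_E₁ : E₁.1 = !![0, 0, 1; 0, 0, 0; 0, 0, 0] := by
  ext i j; fin_cases i <;> fin_cases j <;> simp [E₁]
lemma val_E₂ : E₂.1 = !![0, 0, 0; 0, 0, 1; 0, 0, 0] := by
  ext i j; fin_cases i <;> fin_cases j <;> simp [E₂]
lemma val_F₁ : F₁.1 = !![0, 0, 0; 0, 0, 0; 1, 0, 0] := by
  ext i j; fin_cases i <;> fin_cases j <;> simp [F₁]
lemma val_F₂ : F₂.1 = !![0, 0, 0; 0, 0, 0; 0, 1, 0] := by
  ext i j; fin_cases i <;> fin_cases j <;> simp [F₂]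

lemma ext_bracket {x y z : g} (h : x.1 * y.1 - y.1 * x.1 = z.1) : ⁅x, y⁆ = z :=
  Subtype.ext (by rw [LieAlgebra.SpecialLinear.sl_bracket, h])

lemma lie_E_F : ⁅E, F⁆ = H₁ - H₂ := by
  apply ext_bracket; change _ = H₁.1 - H₂.1
  ext i j; fin_cases i <;> fin_cases j <;> simp [val_E, val_F, val_H₁, val_H₂]
lemma lie_H₁_F : ⁅H₁, F⁆ = -F := by
  apply ext_bracket; change _ = -F.1
  ext i j; fin_cases i <;> fin_cases j <;> simp [val_F, val_H₁]
lemma lie_H₂_F : ⁅H₂, F⁆ = F := by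
  apply ext_bracket
  ext i j; fin_cases i <;> fin_cases j <;> simp [val_F, val_H₂]
lemma lie_E_E₁ : ⁅E, E₁⁆ = 0 := by
  apply ext_bracket; change _ = 0
  ext i j; fin_cases i <;> fin_cases j <;> simp [val_E, val_E₁]
lemma lie_E_E₂ : ⁅E, E₂⁆ = E₁ := by
  apply ext_bracket
  ext i j; fin_cases i <;> fin_cases j <;> simp [val_E, val_E₁, val_E₂]
lemma lie_E_F₁ : ⁅E, F₁⁆ = -F₂ := by
  apply ext_bracket; change _ = -F₂.1
  ext i j; fin_cases i <;> fin_cases j <;> simp [val_E, val_F₁, val_F₂]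
lemma lie_E_F₂ : ⁅E, F₂⁆ = 0 := by
  apply ext_bracket; change _ = 0
  ext i j; fin_cases i <;> fin_cases j <;> simp [val_E, val_F₂]
lemma lie_F_E₁ : ⁅F, E₁⁆ = E₂ := by
  apply ext_bracket
  ext i j; fin_cases i <;> fin_cases j <;> simp [val_F, val_E₁, val_E₂]
lemma lie_F_E₂ : ⁅F, E₂⁆ = 0 := by
  apply ext_bracket; change _ = 0
  ext i j; fin_cases i <;> fin_cases j <;> simp [val_F, val_E₂]
lemma lie_F_F₁ : ⁅F, F₁⁆ = 0 := by
  apply ext_bracket; change _ = 0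
  ext i j; fin_cases i <;> fin_cases j <;> simp [val_F, val_F₁]
lemma lie_F_F₂ : ⁅F, F₂⁆ = -F₁ := by
  apply ext_bracket; change _ = -F₁.1
  ext i j; fin_cases i <;> fin_cases j <;> simp [val_F, val_F₁, val_F₂]
lemma lie_H₁_E₁ : ⁅H₁, E₁⁆ = (2 : ℂ) • E₁ := by
  apply ext_bracket; change _ = (2 : ℂ) • E₁.1
  ext i j; fin_cases i <;> fin_cases j <;> simp [val_H₁, val_E₁] <;> norm_num
lemma lie_H₁_E₂ : ⁅H₁, E₂⁆ = E₂ := by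
  apply ext_bracket
  ext i j; fin_cases i <;> fin_cases j <;> simp [val_H₁, val_E₂]
lemma lie_H₂_E₁ : ⁅H₂, E₁⁆ = E₁ := by
  apply ext_bracket
  ext i j; fin_cases i <;> fin_cases j <;> simp [val_H₂, val_E₁]
lemma lie_H₂_E₂ : ⁅H₂, E₂⁆ = (2 : ℂ) • E₂ := by
  apply ext_bracket; change _ = (2 : ℂ) • E₂.1
  ext i j; fin_cases i <;> fin_cases j <;> simp [val_H₂, val_E₂] <;> norm_num
lemma lie_H₁_F₁ : ⁅H₁, F₁⁆ = (-2 : ℂ) • F₁ := by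
  apply ext_bracket; change _ = (-2 : ℂ) • F₁.1
  ext i j; fin_cases i <;> fin_cases j <;> simp [val_H₁, val_F₁] <;> norm_num
lemma lie_H₁_F₂ : ⁅H₁, F₂⁆ = -F₂ := by
  apply ext_bracket; change _ = -F₂.1
  ext i j; fin_cases i <;> fin_cases j <;> simp [val_H₁, val_F₂]
lemma lie_H₂_F₁ : ⁅H₂, F₁⁆ = -F₁ := by
  apply ext_bracket; change _ = -F₁.1
  ext i j; fin_cases i <;> fin_cases j <;> simp [val_H₂, val_F₁]
lemma lie_H₂_F₂ : ⁅H₂, F₂⁆ = (-2 : ℂ) • F₂ := by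
  apply ext_bracket; change _ = (-2 : ℂ) • F₂.1
  ext i j; fin_cases i <;> fin_cases j <;> simp [val_H₂, val_F₂] <;> norm_num
lemma lie_E₁_E₂ : ⁅E₁, E₂⁆ = 0 := by
  apply ext_bracket; change _ = 0
  ext i j; fin_cases i <;> fin_cases j <;> simp [val_E₁, val_E₂]
lemma lie_F₁_F₂ : ⁅F₁, F₂⁆ = 0 := by
  apply ext_bracket; change _ = 0
  ext i j; fin_cases i <;> fin_cases j <;> simp [val_F₁, val_F₂]
lemma lie_E₁_F₁ : ⁅E₁, F₁⁆ = H₁ := by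
  apply ext_bracket
  ext i j; fin_cases i <;> fin_cases j <;> simp [val_E₁, val_F₁, val_H₁]
lemma lie_E₁_F₂ : ⁅E₁, F₂⁆ = E := by
  apply ext_bracket
  ext i j; fin_cases i <;> fin_cases j <;> simp [val_E₁, val_F₂, val_E]
lemma lie_E₂_F₁ : ⁅E₂, F₁⁆ = F := by
  apply ext_bracket
  ext i j; fin_cases i <;> fin_cases j <;> simp [val_E₂, val_F₁, val_F]
lemma lie_E₂_F₂ : ⁅E₂, F₂⁆ = H₂ := by
  apply ext_bracket
  ext i j; fin_cases i <;> fin_cases j <;> simp [val_E₂, val_F₂, val_H₂]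

lemma eq_sum_basis (x : g) :
    x = x.1 0 1 • E + x.1 1 0 • F + x.1 0 0 • H₁ + x.1 1 1 • H₂ +
      x.1 0 2 • E₁ + x.1 1 2 • E₂ + x.1 2 0 • F₁ + x.1 2 1 • F₂ := by
  have hx : x.1 0 0 + x.1 1 1 + x.1 2 2 = 0 := by
    have : Matrix.trace x.1 = 0 := x.2
    simpa [Matrix.trace, Fin.sum_univ_three] using this
  apply Subtype.ext
  change x.1 = x.1 0 1 • E.1 + x.1 1 0 • F.1 + x.1 0 0 • H₁.1 + x.1 1 1 • H₂.1 +
      x.1 0 2 • E₁.1 + x.1 1 2 • E₂.1 + x.1 2 0 • F₁.1 + x.1 2 1 • F₂.1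
  ext i j
  fin_cases i <;> fin_cases j <;>
    simp [val_E, val_F, val_H₁, val_H₂, val_E₁, val_E₂, val_F₁, val_F₂]
  -- Only the entry at position (3,3) is left; it is determined by the vanishing of the trace.
  linear_combination hx

/-- A subspace of `𝔤` containing the eight basis vectors is everything. -/
lemma submodule_eq_top {N : Submodule ℂ g} (hE : E ∈ N) (hF : F ∈ N) (hH₁ : H₁ ∈ N)
    (hH₂ : H₂ ∈ N) (hE₁ : E₁ ∈ N) (hE₂ : E₂ ∈ N) (hF₁ : F₁ ∈ N) (hF₂ : F₂ ∈ N) : N = ⊤ := by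
  refine eq_top_iff.2 fun x _ => ?_
  rw [eq_sum_basis x]
  exact N.add_mem (N.add_mem (N.add_mem (N.add_mem (N.add_mem (N.add_mem (N.add_mem
    (N.smul_mem _ hE) (N.smul_mem _ hF)) (N.smul_mem _ hH₁)) (N.smul_mem _ hH₂))
    (N.smul_mem _ hE₁)) (N.smul_mem _ hE₂)) (N.smul_mem _ hF₁)) (N.smul_mem _ hF₂)

lemma apply_of_mem_k {x : g} (hx : x ∈ k) :
    x.1 0 2 = 0 ∧ x.1 1 2 = 0 ∧ x.1 2 0 = 0 ∧ x.1 2 1 = 0 := by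
  have hx : Gam * x.1 = x.1 * Gam := hx
  have h : ∀ i j, (Gam * x.1) i j = (x.1 * Gam) i j := fun i j => by rw [hx]
  have h1 := h 0 2
  have h2 := h 1 2
  have h3 := h 2 0
  have h4 := h 2 1
  simp [Gam] at h1 h2 h3 h4
  have z : ∀ c : ℂ, c = -c → c = 0 := fun c hc => self_eq_neg.mp hc
  exact ⟨z _ h1, z _ h2, z _ h3.symm, z _ h4.symm⟩

lemma apply_of_mem_p {x : g} (hx : x ∈ p) :
    x.1 0 0 = 0 ∧ x.1 0 1 = 0 ∧ x.1 1 0 = 0 ∧ x.1 1 1 = 0 := by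
  have hx : Gam * x.1 = -(x.1 * Gam) := hx
  have h : ∀ i j, (Gam * x.1) i j = (-(x.1 * Gam)) i j := fun i j => by rw [hx]
  have h1 := h 0 0
  have h2 := h 0 1
  have h3 := h 1 0
  have h4 := h 1 1
  simp [Gam] at h1 h2 h3 h4
  have z : ∀ c : ℂ, c = -c → c = 0 := fun c hc => self_eq_neg.mp hc
  exact ⟨z _ h1, z _ h2, z _ h3, z _ h4⟩

lemma p_eq_sum (y : p) : y = y.1.1 0 2 • ⟨E₁, mem_p_E₁⟩ + y.1.1 1 2 • ⟨E₂, mem_p_E₂⟩ +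
    y.1.1 2 0 • ⟨F₁, mem_p_F₁⟩ + y.1.1 2 1 • ⟨F₂, mem_p_F₂⟩ := by
  obtain ⟨h1, h2, h3, h4⟩ := apply_of_mem_p y.2
  apply Subtype.ext
  change y.1 = y.1.1 0 2 • E₁ + y.1.1 1 2 • E₂ + y.1.1 2 0 • F₁ + y.1.1 2 1 • F₂
  conv_lhs => rw [eq_sum_basis y.1, h1, h2, h3, h4]
  simp

lemma mem_k_iff {x : g} : x ∈ k ↔ Gam * x.1 = x.1 * Gam := Iff.rfl

lemma mem_k_E : E ∈ k := by
  rw [mem_k_iff, val_E]; ext i j; fin_cases i <;> fin_cases j <;> simp [Gam]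
lemma mem_k_F : F ∈ k := by
  rw [mem_k_iff, val_F]; ext i j; fin_cases i <;> fin_cases j <;> simp [Gam]
lemma mem_k_H₁ : H₁ ∈ k := by
  rw [mem_k_iff, val_H₁]; ext i j; fin_cases i <;> fin_cases j <;> simp [Gam]
lemma mem_k_H₂ : H₂ ∈ k := by
  rw [mem_k_iff, val_H₂]; ext i j; fin_cases i <;> fin_cases j <;> simp [Gam]

/-- `E` as an element of `𝔨`. -/
def kE : k := ⟨E, mem_k_E⟩
/-- `F` as an element of `𝔨`. -/
def kF : k := ⟨F, mem_k_F⟩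
/-- `H₁` as an element of `𝔨`. -/
def kH₁ : k := ⟨H₁, mem_k_H₁⟩
/-- `H₂` as an element of `𝔨`. -/
def kH₂ : k := ⟨H₂, mem_k_H₂⟩

lemma k_eq_sum (x : k) : x = x.1.1 0 1 • kE + x.1.1 1 0 • kF + x.1.1 0 0 • kH₁ +
    x.1.1 1 1 • kH₂ := by
  obtain ⟨h1, h2, h3, h4⟩ := apply_of_mem_k x.2
  apply Subtype.ext
  change x.1 = x.1.1 0 1 • E + x.1.1 1 0 • F + x.1.1 0 0 • H₁ + x.1.1 1 1 • H₂
  conv_lhs => rw [eq_sum_basis x.1, h1, h2, h3, h4]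
  simp

/-! ### Highest weight vectors for `𝔨` in a `𝔤`-module -/

section HighestWeight

variable {V : Type*} [AddCommGroup V] [Module ℂ V] (φ : g →ₗ⁅ℂ⁆ Module.End ℂ V)

lemma apply_apply (x y : g) (m : V) : φ x (φ y m) = φ y (φ x m) + φ ⁅x, y⁆ m := by
  rw [LieHom.map_lie, LieRing.of_associative_ring_bracket]
  simp

/-- `y` is annihilated by `E` and has weight `(a, b)` for `H₁, H₂`. -/
structure IsHW (a b : ℂ) (y : V) : Prop where
  map_E : φ E y = 0
  map_H₁ : φ H₁ y = a • y
  map_H₂ : φ H₂ y = b • y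

/-- The operator `F₁ E₁ + F₂ E₂`. -/
def opT : Module.End ℂ V := φ F₁ * φ E₁ + φ F₂ * φ E₂

/-- The operator `F E₁ - (c + 1) E₂`, which lowers highest weight vectors. -/
def lower₁ (c : ℂ) : Module.End ℂ V := φ F * φ E₁ - (c + 1) • φ E₂

/-- The operator `F F₂ + (c + 1) F₁`, which lowers highest weight vectors. -/
def lower₂ (c : ℂ) : Module.End ℂ V := φ F * φ F₂ + (c + 1) • φ F₁

lemma opT_apply (y : V) : opT φ y = φ F₁ (φ E₁ y) + φ F₂ (φ E₂ y) := rfl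

lemma lower₁_apply (c : ℂ) (y : V) : lower₁ φ c y = φ F (φ E₁ y) - (c + 1) • φ E₂ y := rfl

lemma lower₂_apply (c : ℂ) (y : V) : lower₂ φ c y = φ F (φ F₂ y) + (c + 1) • φ F₁ y := rfl

variable {φ}
variable {a b c : ℂ} {y : V}

lemma IsHW.apply_E₁ (h : IsHW φ a b y) : IsHW φ (a + 2) (b + 1) (φ E₁ y) where
  map_E := by rw [apply_apply, h.map_E, lie_E_E₁]; simp
  map_H₁ := by rw [apply_apply, h.map_H₁, lie_H₁_E₁]; simp only [map_smul, LinearMap.smul_apply]; module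
  map_H₂ := by rw [apply_apply, h.map_H₂, lie_H₂_E₁]; simp only [map_smul]; module

lemma IsHW.apply_F₂ (h : IsHW φ a b y) : IsHW φ (a - 1) (b - 2) (φ F₂ y) where
  map_E := by rw [apply_apply, h.map_E, lie_E_F₂]; simp
  map_H₁ := by
    rw [apply_apply, h.map_H₁, lie_H₁_F₂]; simp only [map_smul, map_neg, LinearMap.neg_apply]; module
  map_H₂ := by
    rw [apply_apply, h.map_H₂, lie_H₂_F₂]
    simp only [map_smul, LinearMap.smul_apply]
    module

lemma IsHW.E₁_F₂ (h : IsHW φ a b y) : φ E₁ (φ F₂ y) = φ F₂ (φ E₁ y) := by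
  rw [apply_apply, lie_E₁_F₂, h.map_E, add_zero]

/-- `opT` does not commute with `𝔭`, but on highest weight vectors the correction terms collapse to
weights. Together with `IsHW.opT_F₂` this makes the eigenvalue of `opT` on every `E₁ⁿF₂ᵐv`
computable by recursion. -/
lemma IsHW.opT_E₁ (h : IsHW φ a b y) : opT φ (φ E₁ y) = φ E₁ (opT φ y) - (a + 3) • φ E₁ y := by
  have h1 := apply_apply φ E₁ F₁ (φ E₁ y)
  have h2 := apply_apply φ E₁ F₂ (φ E₂ y)
  have h3 := apply_apply φ E₁ E₂ y
  have h4 := apply_apply φ E E₂ y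
  rw [lie_E₁_F₁, h.apply_E₁.map_H₁] at h1
  rw [lie_E₁_F₂, h4, lie_E_E₂, h.map_E, h3, lie_E₁_E₂] at h2
  simp only [map_zero, LinearMap.zero_apply, zero_add, add_zero] at h2 h3
  rw [opT_apply, opT_apply, map_add, h1, h2]
  module

lemma IsHW.opT_F₂ (h : IsHW φ a b y) : opT φ (φ F₂ y) = φ F₂ (opT φ y) + b • φ F₂ y := by
  have h1 := apply_apply φ F₁ F₂ (φ E₁ y)
  have h2 := apply_apply φ E₂ F₂ y
  rw [lie_F₁_F₂] at h1
  rw [lie_E₂_F₂, h.map_H₂] at h2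
  rw [opT_apply, opT_apply, h.E₁_F₂, h1, h2]
  simp only [map_zero, LinearMap.zero_apply, map_add, map_smul]
  module

/-- The parameter goes up by one because `E₁` raises `a - b` by one. No highest weight hypothesis is
needed: `E₁` commutes with `E₂ = [F, E₁]`. -/
lemma lower₁_E₁ (c : ℂ) (y : V) : lower₁ φ (c + 1) (φ E₁ y) = φ E₁ (lower₁ φ c y) := by
  have h1 := apply_apply φ F E₁ (φ E₁ y)
  have h2 := apply_apply φ E₁ E₂ y
  rw [lie_F_E₁] at h1
  rw [lie_E₁_E₂] at h2
  rw [lower₁_apply, lower₁_apply, map_sub, map_smul, h1, h2]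
  simp only [map_zero, LinearMap.zero_apply]
  module

/-- Unlike `E₁`, the operator `F₂` has nontrivial brackets with the ingredients of `lower₁`; the
defect consists of `opT` and `H₂`, both scalars on the vectors of interest. -/
lemma IsHW.lower₁_F₂ (h : IsHW φ a b y) (c : ℂ) :
    lower₁ φ (c + 1) (φ F₂ y) = φ F₂ (lower₁ φ c y) - opT φ y - ((c + 2) * b) • y := by
  have h1 := apply_apply φ F F₂ (φ E₁ y)
  have h2 := apply_apply φ E₂ F₂ y
  rw [lie_F_F₂, map_neg, LinearMap.neg_apply] at h1
  rw [lie_E₂_F₂, h.map_H₂] at h2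
  rw [lower₁_apply, lower₁_apply, opT_apply, map_sub, map_smul, h.E₁_F₂, h1, h2]
  module

lemma lower₂_F₂ (c : ℂ) (y : V) : lower₂ φ (c + 1) (φ F₂ y) = φ F₂ (lower₂ φ c y) := by
  have h1 := apply_apply φ F F₂ (φ F₂ y)
  have h2 := apply_apply φ F₁ F₂ y
  rw [lie_F_F₂, map_neg, LinearMap.neg_apply] at h1
  rw [lie_F₁_F₂] at h2
  rw [lower₂_apply, lower₂_apply, map_add, map_smul, h1, h2]
  simp only [map_zero, LinearMap.zero_apply]
  module

lemma IsHW.lower₂_E₁ (h : IsHW φ a b y) (c : ℂ) :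
    lower₂ φ (c + 1) (φ E₁ y) =
      φ E₁ (lower₂ φ c y) + opT φ y + (a + b - (c + 2) * a) • y := by
  have h1 := apply_apply φ F E₁ (φ F₂ y)
  have h2 := apply_apply φ E₂ F₂ y
  have h3 := apply_apply φ E₁ F₁ y
  rw [lie_F_E₁] at h1
  rw [lie_E₂_F₂, h.map_H₂] at h2
  rw [lie_E₁_F₁, h.map_H₁] at h3
  rw [lower₂_apply, lower₂_apply, opT_apply, map_add, map_smul, ← h.E₁_F₂, h1, h2, h3]
  module

/-- On a highest weight vector `y` with vanishing lower components, `F₁ E₁ + F₂ E₂` acts by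
the scalar `-(a + 1)`. -/
lemma IsHW.opT_of_lower (h : IsHW φ a b y) (hab : a - b ≠ 0) (h₁ : lower₁ φ (a - b) y = 0)
    (h₂ : lower₂ φ (a - b) y = 0) : opT φ y = (-(a + 1)) • y := by
  -- Evaluate `lower₂` on `E₁ y` in two ways. Moving `E₁` out leaves `opT y` plus a scalar;
  -- expanding and replacing `F E₁ y` by `(a - b + 1) E₂ y` gives `(a - b + 1) opT y`. The
  -- difference determines `(a - b) opT y`.
  have h3 := h.lower₂_E₁ (a - b)
  have h4 := apply_apply φ F F₂ (φ E₁ y)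
  rw [lie_F_F₂, map_neg, LinearMap.neg_apply] at h4
  rw [h₂, map_zero, zero_add, lower₂_apply, h4] at h3
  have h5 : φ F (φ E₁ y) = (a - b + 1) • φ E₂ y := by
    rw [lower₁_apply, sub_eq_zero] at h₁; exact h₁
  rw [h5, map_smul] at h3
  have h6 := opT_apply φ y
  apply smul_right_injective V hab
  change (a - b) • _ = (a - b) • _
  linear_combination (norm := module) h3 + (a - b + 1) • h6

/-! ### Commutation of the basis vectors with powers of `F` -/

section Pow

lemma E₂_F_pow (j : ℕ) (y : V) : φ E₂ ((φ F ^ j) y) = (φ F ^ j) (φ E₂ y) := by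
  induction j with
  | zero => simp
  | succ j ih =>
    have h := apply_apply φ F E₂ ((φ F ^ j) y)
    rw [lie_F_E₂, map_zero, LinearMap.zero_apply, add_zero] at h
    rw [pow_succ', Module.End.mul_apply, Module.End.mul_apply, ← h, ih]

lemma F₁_F_pow (j : ℕ) (y : V) : φ F₁ ((φ F ^ j) y) = (φ F ^ j) (φ F₁ y) := by
  induction j with
  | zero => simp
  | succ j ih =>
    have h := apply_apply φ F F₁ ((φ F ^ j) y)
    rw [lie_F_F₁, map_zero, LinearMap.zero_apply, add_zero] at h
    rw [pow_succ', Module.End.mul_apply, Module.End.mul_apply, ← h, ih]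

/-- Only two terms occur because `ad F` sends `E₁` to `E₂` and `E₂` to `0`. The formula for `F₂`
below has the same shape, with `F₂ ↦ -F₁ ↦ 0`. -/
lemma E₁_F_pow (j : ℕ) (y : V) : φ E₁ ((φ F ^ (j + 1)) y) =
    (φ F ^ (j + 1)) (φ E₁ y) - (j + 1 : ℂ) • (φ F ^ j) (φ E₂ y) := by
  have key : ∀ m, φ E₁ (φ F m) = φ F (φ E₁ m) - φ E₂ m := fun m => by
    rw [apply_apply φ F E₁ m, lie_F_E₁, add_sub_cancel_right]
  induction j with
  | zero => simp [key]
  | succ j ih =>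
    rw [pow_succ', Module.End.mul_apply, key, ih, E₂_F_pow, map_sub, map_smul, Module.End.mul_apply,
      ← Module.End.mul_apply (φ F) (φ F ^ j), ← pow_succ']
    push_cast
    module

lemma F₂_F_pow (j : ℕ) (y : V) : φ F₂ ((φ F ^ (j + 1)) y) =
    (φ F ^ (j + 1)) (φ F₂ y) + (j + 1 : ℂ) • (φ F ^ j) (φ F₁ y) := by
  have key : ∀ m, φ F₂ (φ F m) = φ F (φ F₂ m) + φ F₁ m := fun m => by
    rw [apply_apply φ F F₂ m, lie_F_F₂, map_neg, LinearMap.neg_apply]; abel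
  induction j with
  | zero => simp [key]
  | succ j ih =>
    rw [pow_succ', Module.End.mul_apply, key, ih, F₁_F_pow, map_add, map_smul, Module.End.mul_apply,
      ← Module.End.mul_apply (φ F) (φ F ^ j), ← pow_succ']
    push_cast
    module

lemma IsHW.H₁_F_pow (h : IsHW φ a b y) (j : ℕ) :
    φ H₁ ((φ F ^ j) y) = (a - j) • (φ F ^ j) y := by
  induction j with
  | zero => simp [h.map_H₁]
  | succ j ih =>
    rw [pow_succ', Module.End.mul_apply, apply_apply, ih, lie_H₁_F, map_smul, map_neg,
      LinearMap.neg_apply]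
    push_cast
    module

lemma IsHW.H₂_F_pow (h : IsHW φ a b y) (j : ℕ) :
    φ H₂ ((φ F ^ j) y) = (b + j) • (φ F ^ j) y := by
  induction j with
  | zero => simp [h.map_H₂]
  | succ j ih =>
    rw [pow_succ', Module.End.mul_apply, apply_apply, ih, lie_H₂_F, map_smul]
    push_cast
    module

/-- The `𝔰𝔩₂` string formula. The coefficient vanishes at `j = a - b`, which is what forces `F^(d+1)
v = 0` in a unitary module. -/
lemma IsHW.E_F_pow (h : IsHW φ a b y) (j : ℕ) :
    φ E ((φ F ^ (j + 1)) y) = ((j + 1) * (a - b - j)) • (φ F ^ j) y := by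
  induction j with
  | zero =>
    rw [zero_add, pow_one, apply_apply, h.map_E, lie_E_F, map_sub, LinearMap.sub_apply, h.map_H₁, h.map_H₂]
    simp [sub_smul]
  | succ j ih =>
    rw [pow_succ', Module.End.mul_apply, apply_apply, ih, lie_E_F, map_sub, LinearMap.sub_apply,
      h.H₁_F_pow, h.H₂_F_pow, map_smul, ← Module.End.mul_apply (φ F), ← pow_succ']
    push_cast
    module

end Pow

end HighestWeight

/-! ### The `𝔤`-module generated by a highest weight vector with vanishing lower components -/

section Strings

variable {V : Type*} [AddCommGroup V] [Module ℂ V] (φ : g →ₗ⁅ℂ⁆ Module.End ℂ V) (v : V)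

/-- The vector `E₁ⁿ F₂ᵐ v`. -/
def top (n m : ℕ) : V := (φ E₁ ^ n) ((φ F₂ ^ m) v)

/-- The span of the vectors `Fʲ E₁ⁿ F₂ᵐ v` with `n + m < N`. -/
def strings (N : ℕ) : Submodule ℂ V :=
  Submodule.span ℂ {x | ∃ j n m : ℕ, n + m < N ∧ x = (φ F ^ j) (top φ v n m)}

/-- `v` is a highest weight vector of weight `(a, b)`, `a - b = d`, without lower components. -/
structure IsBottom (a b : ℂ) (d : ℕ) : Prop where
  hw : IsHW φ a b v
  sub_eq : a - b = d
  pos : 0 < d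
  lower₁_eq : lower₁ φ d v = 0
  lower₂_eq : lower₂ φ d v = 0

variable {φ v}
variable {a b : ℂ} {d : ℕ}

lemma top_zero_zero : top φ v 0 0 = v := rfl

lemma top_succ (n m : ℕ) : top φ v (n + 1) m = φ E₁ (top φ v n m) := by
  rw [top, pow_succ', Module.End.mul_apply, top]

lemma top_zero_succ (m : ℕ) : top φ v 0 (m + 1) = φ F₂ (top φ v 0 m) := by
  simp only [top, pow_zero, Module.End.one_apply, pow_succ', Module.End.mul_apply]

lemma strings_mono {N N' : ℕ} (h : N ≤ N') : strings φ v N ≤ strings φ v N' := by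
  refine Submodule.span_mono ?_
  rintro x ⟨j, n, m, hnm, rfl⟩
  exact ⟨j, n, m, hnm.trans_le h, rfl⟩

lemma pow_top_mem {N n m : ℕ} (h : n + m < N) (j : ℕ) :
    (φ F ^ j) (top φ v n m) ∈ strings φ v N :=
  Submodule.subset_span ⟨j, n, m, h, rfl⟩

lemma top_mem {N n m : ℕ} (h : n + m < N) : top φ v n m ∈ strings φ v N :=
  pow_top_mem h 0

lemma apply_mem_of_forall {N N' : ℕ} {x : g}
    (h : ∀ j n m : ℕ, n + m < N → φ x ((φ F ^ j) (top φ v n m)) ∈ strings φ v N')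
    {y : V} (hy : y ∈ strings φ v N) : φ x y ∈ strings φ v N' := by
  have : strings φ v N ≤ (strings φ v N').comap (φ x) := by
    refine Submodule.span_le.2 ?_
    rintro z ⟨j, n, m, hnm, rfl⟩
    exact h j n m hnm
  exact this hy

lemma F_mem_strings {N : ℕ} {y : V} (hy : y ∈ strings φ v N) : φ F y ∈ strings φ v N := by
  refine apply_mem_of_forall (fun j n m h => ?_) hy
  rw [← Module.End.mul_apply, ← pow_succ']
  exact pow_top_mem h _

lemma F_pow_mem_strings {N : ℕ} {y : V} (hy : y ∈ strings φ v N) (j : ℕ) :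
    (φ F ^ j) y ∈ strings φ v N := by
  induction j with
  | zero => simpa
  | succ j ih => rw [pow_succ', Module.End.mul_apply]; exact F_mem_strings ih

/-! ### Triangular action of `𝔭` on the strings over a bottom vector -/

namespace IsBottom

variable (h : IsBottom φ v a b d)
include h

/-- `E₁` and `F₂` are the root vectors of `𝔭` annihilated by `ad E`, so they preserve highest weight
vectors and shift the weight by their roots. The string over `E₁ⁿF₂ᵐv` therefore has `a - b`
replaced by `d + n + m`. -/
lemma hw_top (n m : ℕ) : IsHW φ (a + 2 * n - m) (b + n - 2 * m) (top φ v n m) := by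
  induction n with
  | zero =>
    induction m with
    | zero => simpa [top_zero_zero] using h.hw
    | succ m ih =>
      rw [top_zero_succ]
      convert ih.apply_F₂ using 1 <;> (push_cast; ring)
  | succ n ih =>
    rw [top_succ]
    convert ih.apply_E₁ using 1 <;> (push_cast; ring)

lemma F₂_top (n m : ℕ) : φ F₂ (top φ v n m) = top φ v n (m + 1) := by
  induction n with
  | zero => rw [top_zero_succ]
  | succ n ih => rw [top_succ, top_succ, ← (h.hw_top n m).E₁_F₂, ih]

lemma opT_bottom : opT φ v = (-(a + 1)) • v := by
  refine h.hw.opT_of_lower ?_ ?_ ?_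
  · rw [h.sub_eq]; exact_mod_cast h.pos.ne'
  · rw [h.sub_eq, h.lower₁_eq]
  · rw [h.sub_eq, h.lower₂_eq]

lemma opT_top (n m : ℕ) : opT φ (top φ v n m) =
    (-(a + 1) + m * b - m ^ 2 + m - n * a + n * m - n ^ 2 - 2 * n) • top φ v n m := by
  induction n with
  | zero =>
    induction m with
    | zero => rw [top_zero_zero, h.opT_bottom]; congr 1; push_cast; ring
    | succ m ih =>
      rw [top_zero_succ, (h.hw_top 0 m).opT_F₂, ih, map_smul, ← add_smul]
      congr 1; push_cast; ring
  | succ n ih =>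
    rw [top_succ, (h.hw_top n m).opT_E₁, ih, map_smul, ← sub_smul]
    congr 1; push_cast; ring

lemma lower₁_top_zero (n : ℕ) : lower₁ φ (d + n) (top φ v n 0) = 0 := by
  induction n with
  | zero => simpa [top_zero_zero] using h.lower₁_eq
  | succ n ih =>
    rw [top_succ, Nat.cast_succ, ← add_assoc, lower₁_E₁, ih, map_zero]

/-- By induction on `m`, and then on `n`: passing `F₂` creates only multiples of the vector one
level below, since `opT` and `H₂` are scalars there, and passing `E₁` creates nothing. -/
lemma lower₁_top_succ (n m : ℕ) :
    ∃ s : ℂ, lower₁ φ (d + n + (m + 1)) (top φ v n (m + 1)) = s • top φ v n m := by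
  induction n with
  | zero =>
    induction m with
    | zero =>
      have key := (h.hw_top 0 0).lower₁_F₂ (d + (0 : ℕ))
      rw [h.lower₁_top_zero 0, map_zero, zero_sub, h.opT_top, ← neg_smul, ← sub_smul,
        ← top_zero_succ] at key
      rw [show (d + (0 : ℕ) + ((0 : ℕ) + 1) : ℂ) = d + (0 : ℕ) + 1 by push_cast; ring]
      exact ⟨_, key⟩
    | succ m ih =>
      obtain ⟨s, hs⟩ := ih
      have key := (h.hw_top 0 (m + 1)).lower₁_F₂ (d + (0 : ℕ) + (m + 1))
      rw [hs, h.opT_top, map_smul, ← top_zero_succ, ← top_zero_succ, ← sub_smul, ← sub_smul] at key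
      rw [Nat.cast_succ, ← add_assoc]
      exact ⟨_, key⟩
  | succ n ih =>
    obtain ⟨s, hs⟩ := ih
    refine ⟨s, ?_⟩
    rw [top_succ, top_succ, ← map_smul, ← hs, ← lower₁_E₁]
    congr 2; push_cast; ring

lemma lower₂_top_zero (m : ℕ) : lower₂ φ (d + m) (top φ v 0 m) = 0 := by
  induction m with
  | zero => simpa [top_zero_zero] using h.lower₂_eq
  | succ m ih =>
    rw [top_zero_succ, Nat.cast_succ, ← add_assoc, lower₂_F₂, ih, map_zero]

lemma lower₂_top_succ (n m : ℕ) :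
    ∃ s : ℂ, lower₂ φ (d + (n + 1) + m) (top φ v (n + 1) m) = s • top φ v n m := by
  induction n with
  | zero =>
    have key := (h.hw_top 0 m).lower₂_E₁ (d + m)
    rw [h.lower₂_top_zero m, map_zero, zero_add, h.opT_top, ← add_smul, ← top_succ] at key
    rw [show (d + ((0 : ℕ) + 1) + m : ℂ) = d + m + 1 by push_cast; ring]
    exact ⟨_, key⟩
  | succ n ih =>
    obtain ⟨s, hs⟩ := ih
    have key := (h.hw_top (n + 1) m).lower₂_E₁ (d + (n + 1) + m)
    rw [hs, h.opT_top, map_smul, ← top_succ, ← top_succ, ← add_smul, ← add_smul] at key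
    rw [show (d + ((n + 1 : ℕ) + 1) + m : ℂ) = d + (n + 1) + m + 1 by push_cast; ring]
    exact ⟨_, key⟩

/-- The lower component of a vector of level `n + m` lies on level `n + m - 1`. This is the
triangularity behind all later estimates. -/
lemma lower₁_top_mem (n m : ℕ) :
    lower₁ φ (d + n + m) (top φ v n m) ∈ strings φ v (n + m) := by
  cases m with
  | zero => simp [h.lower₁_top_zero n]
  | succ m =>
    obtain ⟨s, hs⟩ := h.lower₁_top_succ n m
    rw [Nat.cast_succ, hs]
    exact Submodule.smul_mem _ _ (top_mem (by omega))

lemma lower₂_top_mem (n m : ℕ) :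
    lower₂ φ (d + n + m) (top φ v n m) ∈ strings φ v (n + m) := by
  cases n with
  | zero => simp [h.lower₂_top_zero m]
  | succ n =>
    obtain ⟨s, hs⟩ := h.lower₂_top_succ n m
    rw [Nat.cast_succ, hs]
    exact Submodule.smul_mem _ _ (top_mem (by omega))

omit h in
lemma cast_ne_zero (d n m : ℕ) : (d + n + m + 1 : ℂ) ≠ 0 := by
  exact_mod_cast Nat.succ_ne_zero (d + n + m)

omit h in
-- The definition of `lower₁` solved for `E₂`; the denominator `d + n + m + 1` is a positive
-- integer.
lemma E₂_top (n m : ℕ) : φ E₂ (top φ v n m) = (d + n + m + 1 : ℂ)⁻¹ •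
    (φ F (top φ v (n + 1) m) - lower₁ φ (d + n + m) (top φ v n m)) := by
  rw [lower₁_apply, top_succ, sub_sub_cancel, inv_smul_smul₀ (cast_ne_zero d n m)]

lemma F₁_top (n m : ℕ) : φ F₁ (top φ v n m) = (d + n + m + 1 : ℂ)⁻¹ •
    (lower₂ φ (d + n + m) (top φ v n m) - φ F (top φ v n (m + 1))) := by
  rw [lower₂_apply, h.F₂_top, add_sub_cancel_left, inv_smul_smul₀ (cast_ne_zero d n m)]

lemma E₂_pow_mem (j n m : ℕ) : φ E₂ ((φ F ^ j) (top φ v n m)) ∈ strings φ v (n + m + 2) := by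
  rw [E₂_F_pow, E₂_top]
  refine F_pow_mem_strings (Submodule.smul_mem _ _ (Submodule.sub_mem _ ?_ ?_)) j
  · exact F_mem_strings (top_mem (by omega))
  · exact strings_mono (by omega) (h.lower₁_top_mem n m)

lemma F₁_pow_mem (j n m : ℕ) : φ F₁ ((φ F ^ j) (top φ v n m)) ∈ strings φ v (n + m + 2) := by
  rw [F₁_F_pow, h.F₁_top]
  refine F_pow_mem_strings (Submodule.smul_mem _ _ (Submodule.sub_mem _ ?_ ?_)) j
  · exact strings_mono (by omega) (h.lower₂_top_mem n m)
  · exact F_mem_strings (top_mem (by omega))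

/-- Commuting `E₁` past `Fʲ` costs `j` copies of `E₂`, and `E₂_top` turns each into `F E₁ / (d + n +
m + 1)` modulo lower level. This produces the leading coefficient `1 - j/(d + n + m + 1)`. -/
lemma E₁_pow_sub_mem (j n m : ℕ) : φ E₁ ((φ F ^ j) (top φ v n m)) -
    (1 - j / (d + n + m + 1) : ℂ) • (φ F ^ j) (top φ v (n + 1) m) ∈ strings φ v (n + m) := by
  cases j with
  | zero => simp [top_succ]
  | succ j =>
    have : φ E₁ ((φ F ^ (j + 1)) (top φ v n m)) -
        (1 - (j + 1 : ℕ) / (d + n + m + 1) : ℂ) • (φ F ^ (j + 1)) (top φ v (n + 1) m) =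
        ((j + 1) * (d + n + m + 1 : ℂ)⁻¹) •
          (φ F ^ j) (lower₁ φ (d + n + m) (top φ v n m)) := by
      rw [E₁_F_pow, E₂_top, ← top_succ, map_smul, map_sub, ← Module.End.mul_apply (φ F ^ j) (φ F),
        ← pow_succ, div_eq_mul_inv]
      push_cast
      module
    rw [this]
    exact Submodule.smul_mem _ _ (F_pow_mem_strings (h.lower₁_top_mem n m) j)

lemma F₂_pow_sub_mem (j n m : ℕ) : φ F₂ ((φ F ^ j) (top φ v n m)) -
    (1 - j / (d + n + m + 1) : ℂ) • (φ F ^ j) (top φ v n (m + 1)) ∈ strings φ v (n + m) := by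
  cases j with
  | zero => simp [h.F₂_top]
  | succ j =>
    have : φ F₂ ((φ F ^ (j + 1)) (top φ v n m)) -
        (1 - (j + 1 : ℕ) / (d + n + m + 1) : ℂ) • (φ F ^ (j + 1)) (top φ v n (m + 1)) =
        ((j + 1) * (d + n + m + 1 : ℂ)⁻¹) •
          (φ F ^ j) (lower₂ φ (d + n + m) (top φ v n m)) := by
      rw [F₂_F_pow, h.F₁_top, h.F₂_top, map_smul, map_sub, ← Module.End.mul_apply (φ F ^ j) (φ F),
        ← pow_succ, div_eq_mul_inv]
      push_cast
      module
    rw [this]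
    exact Submodule.smul_mem _ _ (F_pow_mem_strings (h.lower₂_top_mem n m) j)

lemma E₁_pow_mem (j n m : ℕ) : φ E₁ ((φ F ^ j) (top φ v n m)) ∈ strings φ v (n + m + 2) := by
  rw [← sub_add_cancel (φ E₁ _) ((1 - j / (d + n + m + 1) : ℂ) • (φ F ^ j) (top φ v (n + 1) m))]
  exact Submodule.add_mem _ (strings_mono (by omega) (h.E₁_pow_sub_mem j n m))
    (Submodule.smul_mem _ _ (pow_top_mem (by omega) j))

lemma F₂_pow_mem (j n m : ℕ) : φ F₂ ((φ F ^ j) (top φ v n m)) ∈ strings φ v (n + m + 2) := by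
  rw [← sub_add_cancel (φ F₂ _) ((1 - j / (d + n + m + 1) : ℂ) • (φ F ^ j) (top φ v n (m + 1)))]
  exact Submodule.add_mem _ (strings_mono (by omega) (h.F₂_pow_sub_mem j n m))
    (Submodule.smul_mem _ _ (pow_top_mem (by omega) j))

lemma E_pow_mem (j n m : ℕ) : φ E ((φ F ^ j) (top φ v n m)) ∈ strings φ v (n + m + 1) := by
  cases j with
  | zero => simp [(h.hw_top n m).map_E]
  | succ j =>
    rw [(h.hw_top n m).E_F_pow]
    exact Submodule.smul_mem _ _ (pow_top_mem (by omega) j)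

/-- The span of all `Fʲ E₁ⁿ F₂ᵐ v` is a `𝔤`-submodule. -/
lemma apply_mem_iSup (x : g) {y : V} (hy : y ∈ ⨆ N, strings φ v N) :
    φ x y ∈ ⨆ N, strings φ v N := by
  have key : ∀ x : g, (∀ j n m : ℕ, φ x ((φ F ^ j) (top φ v n m)) ∈ ⨆ N, strings φ v N) →
      (⨆ N, strings φ v N) ≤ (⨆ N, strings φ v N).comap (φ x) := by
    intro x hx
    refine iSup_le fun N => Submodule.span_le.2 ?_
    rintro z ⟨j, n, m, -, rfl⟩
    exact hx j n m
  have le : ∀ N, strings φ v N ≤ ⨆ N, strings φ v N := le_iSup _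
  -- The condition of preserving the span is linear in `x`, being the kernel of a linear map on `𝔤`,
  -- so it suffices to test the eight basis vectors.
  have htop : (LinearMap.ker (LinearMap.pi fun y : ↥(⨆ N, strings φ v N) =>
      (⨆ N, strings φ v N).mkQ ∘ₗ LinearMap.applyₗ y.1 ∘ₗ (φ : g →ₗ[ℂ] Module.End ℂ V))) = ⊤ := by
    have mem : ∀ x : g, (∀ j n m : ℕ, φ x ((φ F ^ j) (top φ v n m)) ∈ ⨆ N, strings φ v N) →
        x ∈ LinearMap.ker (LinearMap.pi fun y : ↥(⨆ N, strings φ v N) =>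
          (⨆ N, strings φ v N).mkQ ∘ₗ LinearMap.applyₗ y.1 ∘ₗ
            (φ : g →ₗ[ℂ] Module.End ℂ V)) := by
      intro x hx
      rw [LinearMap.mem_ker]
      funext y
      exact (Submodule.Quotient.mk_eq_zero _).2 (key x hx y.2)
    refine submodule_eq_top (mem _ fun j n m => ?_) (mem _ fun j n m => ?_)
      (mem _ fun j n m => ?_) (mem _ fun j n m => ?_) (mem _ fun j n m => ?_)
      (mem _ fun j n m => ?_) (mem _ fun j n m => ?_) (mem _ fun j n m => ?_)
    · exact le _ (h.E_pow_mem j n m)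
    · exact le (n + m + 1) (F_mem_strings (pow_top_mem (by omega) j))
    · rw [(h.hw_top n m).H₁_F_pow]
      exact Submodule.smul_mem _ _ (le (n + m + 1) (pow_top_mem (by omega) j))
    · rw [(h.hw_top n m).H₂_F_pow]
      exact Submodule.smul_mem _ _ (le (n + m + 1) (pow_top_mem (by omega) j))
    · exact le _ (h.E₁_pow_mem j n m)
    · exact le _ (h.E₂_pow_mem j n m)
    · exact le _ (h.F₁_pow_mem j n m)
    · exact le _ (h.F₂_pow_mem j n m)
  have hx : x ∈ LinearMap.ker (LinearMap.pi fun y : ↥(⨆ N, strings φ v N) =>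
      (⨆ N, strings φ v N).mkQ ∘ₗ LinearMap.applyₗ y.1 ∘ₗ (φ : g →ₗ[ℂ] Module.End ℂ V)) := by
    rw [htop]; trivial
  exact (Submodule.Quotient.mk_eq_zero _).1 (congrFun (LinearMap.mem_ker.1 hx) ⟨y, hy⟩)

omit h in
-- The restriction `j ≤ d` keeps the leading coefficients nonzero whatever `n` and `m` are; this is
-- why powers of `F` up to `d` may be moved to the right of `E₁ⁿF₂ᵐ`.
lemma one_sub_div_ne_zero {d j : ℕ} (hj : j ≤ d) (n m : ℕ) :
    (1 - j / (d + n + m + 1) : ℂ) ≠ 0 := by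
  have h0 := cast_ne_zero d n m
  rw [sub_ne_zero, ne_comm, Ne, div_eq_one_iff_eq h0]
  norm_cast
  omega

/-- `E₁ⁿ F₂ᵐ Fʲ v` is a nonzero multiple of `Fʲ E₁ⁿ F₂ᵐ v`, up to strings of lower level. -/
lemma exists_sub_smul_mem {j : ℕ} (hj : j ≤ d) (n m : ℕ) : ∃ s : ℂ, s ≠ 0 ∧
    (φ E₁ ^ n) ((φ F₂ ^ m) ((φ F ^ j) v)) - s • (φ F ^ j) (top φ v n m) ∈
      strings φ v (n + m) := by
  induction n with
  | zero =>
    induction m with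
    | zero => exact ⟨1, one_ne_zero, by simp [top]⟩
    | succ m ih =>
      obtain ⟨s, hs, hm⟩ := ih
      refine ⟨s * (1 - j / (d + (0 : ℕ) + m + 1)),
        mul_ne_zero hs (one_sub_div_ne_zero hj 0 m), ?_⟩
      -- The error term from the induction hypothesis has level at most `m - 1`, and `F₂` raises the
      -- level by at most one.
      have h1 : φ F₂ _ ∈ strings φ v (0 + (m + 1)) := apply_mem_of_forall
        (fun j n m' hnm => strings_mono (by omega) (h.F₂_pow_mem j n m')) hm
      have h2 := strings_mono (v := v) (φ := φ) (by omega : 0 + m ≤ 0 + (m + 1))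
        (Submodule.smul_mem _ s (h.F₂_pow_sub_mem j 0 m))
      convert Submodule.add_mem _ h1 h2 using 1
      rw [pow_succ' (φ F₂) m]
      simp only [pow_zero, Module.End.one_apply, map_sub, map_smul, Module.End.mul_apply]
      module
  | succ n ih =>
    obtain ⟨s, hs, hm⟩ := ih
    refine ⟨s * (1 - j / (d + n + m + 1)),
      mul_ne_zero hs (one_sub_div_ne_zero hj n m), ?_⟩
    have h1 : φ E₁ _ ∈ strings φ v (n + 1 + m) := apply_mem_of_forall
      (fun j n' m' hnm => strings_mono (by omega) (h.E₁_pow_mem j n' m')) hm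
    have h2 := strings_mono (v := v) (φ := φ) (by omega : n + m ≤ n + 1 + m)
      (Submodule.smul_mem _ s (h.E₁_pow_sub_mem j n m))
    convert Submodule.add_mem _ h1 h2 using 1
    rw [pow_succ' (φ E₁) n]
    simp only [map_sub, map_smul, Module.End.mul_apply]
    module

omit h in
-- Each step up by `E₁` or `F₂` lengthens the string by at most one: in the commutation formula the
-- extra term contains the power of `F` that already kills the previous vector, because `F` commutes
-- with `E₂` and `F₁`.
lemma F_pow_top_eq_zero (hF : (φ F ^ (d + 1)) v = 0) (n m : ℕ) :
    (φ F ^ (d + n + m + 1)) (top φ v n m) = 0 := by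
  induction n with
  | zero =>
    induction m with
    | zero => exact hF
    | succ m ih =>
      have h1 := F₂_F_pow (φ := φ) (d + 0 + m + 1) (top φ v 0 m)
      rw [← F₁_F_pow, ih, pow_succ', Module.End.mul_apply, ih] at h1
      simp only [map_zero, smul_zero, add_zero] at h1
      rw [← top_zero_succ, ← pow_succ'] at h1
      rw [show d + 0 + (m + 1) + 1 = d + 0 + m + 1 + 1 by omega, add_zero, h1]
  | succ n ih =>
    have h1 := E₁_F_pow (φ := φ) (d + n + m + 1) (top φ v n m)
    rw [← E₂_F_pow, ih, pow_succ', Module.End.mul_apply, ih] at h1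
    simp only [map_zero, smul_zero, sub_zero] at h1
    rw [← top_succ, ← pow_succ'] at h1
    rw [show d + (n + 1) + m + 1 = d + n + m + 1 + 1 by omega, h1]

/-- If `F^(d+1) v = 0`, then the module generated by `v` is spanned by the `E₁ⁿ F₂ᵐ Fʲ v`, `j < d`,
and the `Fʲ E₁ⁿ F₂ᵐ Fᵈ v`, `j ≤ n + m`. -/
lemma iSup_strings_le (hF : (φ F ^ (d + 1)) v = 0) (N : Submodule ℂ V)
    (h₁ : ∀ n m j : ℕ, j < d → (φ E₁ ^ n) ((φ F₂ ^ m) ((φ F ^ j) v)) ∈ N)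
    (h₂ : ∀ n m j : ℕ, j ≤ n + m →
      (φ F ^ j) ((φ E₁ ^ n) ((φ F₂ ^ m) ((φ F ^ d) v))) ∈ N) :
    ⨆ M, strings φ v M ≤ N := by
  refine iSup_le fun M => ?_
  induction M with
  | zero =>
    refine Submodule.span_le.2 ?_
    rintro x ⟨j, n, m, hnm, rfl⟩
    omega
  | succ M ih =>
    refine Submodule.span_le.2 ?_
    rintro x ⟨j, n, m, hnm, rfl⟩
    have hle : strings φ v (n + m) ≤ N := (strings_mono (by omega)).trans ih
    have key : ∀ (s : ℂ) (y z : V), s ≠ 0 → y ∈ N → y - s • z ∈ strings φ v (n + m) → z ∈ N := by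
      intro s y z hs hy hyz
      have := N.sub_mem hy (hle hyz)
      rw [sub_sub_cancel] at this
      exact (N.smul_mem_iff hs).1 this
    -- The string over `E₁ⁿF₂ᵐv` is cut at `d`. Below `d` the vector comes from `E₁ⁿF₂ᵐFʲv`; for `j
    -- = d + i` with `i ≤ n + m` it comes from `Fⁱ` applied to `E₁ⁿF₂ᵐFᵈv`; beyond that it is zero.
    rcases lt_or_ge j d with hj | hj
    · obtain ⟨s, hs, hm⟩ := h.exists_sub_smul_mem hj.le n m
      exact key s _ _ hs (h₁ n m j hj) hm
    · obtain ⟨i, rfl⟩ := Nat.exists_eq_add_of_le hj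
      rcases le_or_gt i (n + m) with hi | hi
      · obtain ⟨s, hs, hm⟩ := h.exists_sub_smul_mem le_rfl n m
        refine key s _ _ hs (h₂ n m i hi) ?_
        have := F_pow_mem_strings hm i
        rwa [map_sub, map_smul, ← Module.End.mul_apply (φ F ^ i) (φ F ^ d), ← pow_add, add_comm i] at this
      · obtain ⟨l, rfl⟩ := Nat.exists_eq_add_of_lt hi
        have : d + (n + m + l + 1) = l + (d + n + m + 1) := by omega
        rw [this, pow_add, Module.End.mul_apply, F_pow_top_eq_zero hF, map_zero]
        exact N.zero_mem

end IsBottom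

end Strings

/-! ### Generators and relations in `𝒜` -/

/-- By the universal property: `ι` factors through `N`, and the induced map into `N` followed by the
inclusion agrees with the identity on generators. -/
lemma Ug_subalgebra_eq_top {N : Subalgebra ℂ Ug} (h : ∀ x : g, u x ∈ N) : N = ⊤ := by
  let f : g →ₗ⁅ℂ⁆ N :=
    { toFun := fun x => ⟨u x, h x⟩
      map_add' := fun x y => Subtype.ext (by simp)
      map_smul' := fun c x => Subtype.ext (by simp)
      map_lie' := fun {x y} => Subtype.ext (by
        change u ⁅x, y⁆ = u x * u y - u y * u x
        rw [u, LieHom.map_lie, LieRing.of_associative_ring_bracket]) }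
  have key : N.val.comp (UniversalEnvelopingAlgebra.lift ℂ f) = AlgHom.id ℂ Ug := by
    apply UniversalEnvelopingAlgebra.hom_ext
    ext x
    change ((UniversalEnvelopingAlgebra.lift ℂ f (UniversalEnvelopingAlgebra.ι ℂ x) : N) : Ug) = _
    rw [UniversalEnvelopingAlgebra.lift_ι_apply]
    rfl
  refine eq_top_iff.2 fun a _ => ?_
  have := DFunLike.congr_fun key a
  rw [AlgHom.id_apply] at this
  rw [← this]
  exact Subtype.property _

/-- The inclusion of `𝔭` in the Clifford algebra. -/
noncomputable abbrev cl (y : p) : Cl := CliffordAlgebra.ι Q y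

lemma A_subalgebra_eq_top {N : Subalgebra ℂ A} (h₁ : ∀ x : g, u x ⊗ₜ[ℂ] (1 : Cl) ∈ N)
    (h₂ : ∀ y : p, (1 : Ug) ⊗ₜ[ℂ] cl y ∈ N) : N = ⊤ := by
  have e₁ : N.comap (Algebra.TensorProduct.includeLeft : Ug →ₐ[ℂ] A) = ⊤ :=
    Ug_subalgebra_eq_top h₁
  have e₂ : N.comap (Algebra.TensorProduct.includeRight : Cl →ₐ[ℂ] A) = ⊤ := by
    rw [eq_top_iff, ← CliffordAlgebra.adjoin_range_ι]
    refine Algebra.adjoin_le ?_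
    rintro _ ⟨y, rfl⟩
    exact h₂ y
  refine eq_top_iff.2 fun a _ => ?_
  induction a using TensorProduct.induction_on with
  | zero => exact N.zero_mem
  | add a b ha hb => exact N.add_mem (ha trivial) (hb trivial)
  | tmul a c =>
    have h1 : a ∈ N.comap (Algebra.TensorProduct.includeLeft : Ug →ₐ[ℂ] A) := by
      rw [e₁]; trivial
    have h2 : c ∈ N.comap (Algebra.TensorProduct.includeRight : Cl →ₐ[ℂ] A) := by
      rw [e₂]; trivial
    have := N.mul_mem ((Subalgebra.mem_comap _ _ _).1 h1) ((Subalgebra.mem_comap _ _ _).1 h2)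
    simpa using this

lemma u_comm (x y : g) : u x * u y = u y * u x + u ⁅x, y⁆ := by
  rw [u, u, u, LieHom.map_lie, LieRing.of_associative_ring_bracket]
  abel

/-! ### Clifford relations and the map `α` -/

section Clifford

lemma cl_mul_add (x y : p) :
    cl x * cl y + cl y * cl x = algebraMap ℂ Cl (-2 * Matrix.trace (x.1.1 * y.1.1)) := by
  rw [cl, cl, CliffordAlgebra.ι_mul_ι_add_swap]
  congr 1
  have h : ∀ z : p, Q z = -Matrix.trace (z.1.1 * z.1.1) := fun z => rfl
  rw [QuadraticMap.polar, h, h, h]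
  change -Matrix.trace ((x.1.1 + y.1.1) * (x.1.1 + y.1.1)) - _ - _ = _
  rw [mul_add, add_mul, add_mul, Matrix.trace_add, Matrix.trace_add, Matrix.trace_add,
    Matrix.trace_mul_comm y.1.1 x.1.1]
  ring

lemma cl_sq (x : p) : cl x * cl x = algebraMap ℂ Cl (-Matrix.trace (x.1.1 * x.1.1)) :=
  CliffordAlgebra.ι_sq_scalar Q x

lemma cE₁_sq : cE₁ * cE₁ = 0 := by
  rw [cE₁, cl_sq, val_E₁]; simp [Matrix.trace, Fin.sum_univ_three]
lemma cE₂_sq : cE₂ * cE₂ = 0 := by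
  rw [cE₂, cl_sq, val_E₂]; simp [Matrix.trace, Fin.sum_univ_three]
lemma cF₁_sq : cF₁ * cF₁ = 0 := by
  rw [cF₁, cl_sq, val_F₁]; simp [Matrix.trace, Fin.sum_univ_three]
lemma cF₂_sq : cF₂ * cF₂ = 0 := by
  rw [cF₂, cl_sq, val_F₂]; simp [Matrix.trace, Fin.sum_univ_three]
lemma cE₂_cE₁ : cE₂ * cE₁ = -(cE₁ * cE₂) := by
  rw [eq_neg_iff_add_eq_zero, cE₂, cE₁, cl_mul_add, val_E₁, val_E₂]
  simp [Matrix.trace, Fin.sum_univ_three]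
lemma cF₂_cF₁ : cF₂ * cF₁ = -(cF₁ * cF₂) := by
  rw [eq_neg_iff_add_eq_zero, cF₂, cF₁, cl_mul_add, val_F₁, val_F₂]
  simp [Matrix.trace, Fin.sum_univ_three]
lemma cF₁_cE₂ : cF₁ * cE₂ = -(cE₂ * cF₁) := by
  rw [eq_neg_iff_add_eq_zero, cF₁, cE₂, cl_mul_add, val_F₁, val_E₂]
  simp [Matrix.trace, Fin.sum_univ_three]
lemma cF₂_cE₁ : cF₂ * cE₁ = -(cE₁ * cF₂) := by
  rw [eq_neg_iff_add_eq_zero, cF₂, cE₁, cl_mul_add, val_F₂, val_E₁]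
  simp [Matrix.trace, Fin.sum_univ_three]
lemma cF₁_cE₁ : cF₁ * cE₁ = -(cE₁ * cF₁) - (2 : ℂ) • 1 := by
  rw [eq_sub_iff_add_eq, eq_neg_iff_add_eq_zero, add_right_comm, cF₁, cE₁, cl_mul_add, val_F₁,
    val_E₁]
  simp [Matrix.trace, Fin.sum_univ_three, Algebra.smul_def]
lemma cF₂_cE₂ : cF₂ * cE₂ = -(cE₂ * cF₂) - (2 : ℂ) • 1 := by
  rw [eq_sub_iff_add_eq, eq_neg_iff_add_eq_zero, add_right_comm, cF₂, cE₂, cl_mul_add, val_F₂,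
    val_E₂]
  simp [Matrix.trace, Fin.sum_univ_three, Algebra.smul_def]

lemma cE₁_sq_mul (z : Cl) : cE₁ * (cE₁ * z) = 0 := by rw [← mul_assoc, cE₁_sq, zero_mul]
lemma cE₂_sq_mul (z : Cl) : cE₂ * (cE₂ * z) = 0 := by rw [← mul_assoc, cE₂_sq, zero_mul]
lemma cE₂_cE₁_mul (z : Cl) : cE₂ * (cE₁ * z) = -(cE₁ * (cE₂ * z)) := by
  rw [← mul_assoc, cE₂_cE₁, neg_mul, mul_assoc]
lemma cF₂_cF₁_mul (z : Cl) : cF₂ * (cF₁ * z) = -(cF₁ * (cF₂ * z)) := by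
  rw [← mul_assoc, cF₂_cF₁, neg_mul, mul_assoc]
lemma cF₁_cE₂_mul (z : Cl) : cF₁ * (cE₂ * z) = -(cE₂ * (cF₁ * z)) := by
  rw [← mul_assoc, cF₁_cE₂, neg_mul, mul_assoc]
lemma cF₂_cE₁_mul (z : Cl) : cF₂ * (cE₁ * z) = -(cE₁ * (cF₂ * z)) := by
  rw [← mul_assoc, cF₂_cE₁, neg_mul, mul_assoc]
lemma cF₁_cE₁_mul (z : Cl) : cF₁ * (cE₁ * z) = -(cE₁ * (cF₁ * z)) - (2 : ℂ) • z := by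
  rw [← mul_assoc, cF₁_cE₁, sub_mul, neg_mul, mul_assoc, smul_one_mul]
lemma cF₂_cE₂_mul (z : Cl) : cF₂ * (cE₂ * z) = -(cE₂ * (cF₂ * z)) - (2 : ℂ) • z := by
  rw [← mul_assoc, cF₂_cE₂, sub_mul, neg_mul, mul_assoc, smul_one_mul]

lemma cAd_eq {x : k} {y z : p} (h : ⁅x.1, y.1⁆ = z.1) : cAd x y = cl z := by
  rw [cAd]; congr 1; exact Subtype.ext h

lemma lie_k (x : k) (y : g) : ⁅x.1, y⁆ = x.1.1 0 1 • ⁅E, y⁆ + x.1.1 1 0 • ⁅F, y⁆ +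
    x.1.1 0 0 • ⁅H₁, y⁆ + x.1.1 1 1 • ⁅H₂, y⁆ := by
  have h := congrArg Subtype.val (k_eq_sum x)
  change x.1 = x.1.1 0 1 • E + x.1.1 1 0 • F + x.1.1 0 0 • H₁ + x.1.1 1 1 • H₂ at h
  conv_lhs => rw [h]
  simp only [add_lie, smul_lie]

lemma cAd_E₁ (x : k) : cAd x ⟨E₁, mem_p_E₁⟩ =
    (2 * x.1.1 0 0 + x.1.1 1 1) • cE₁ + x.1.1 1 0 • cE₂ := by
  rw [cAd_eq (z := (2 * x.1.1 0 0 + x.1.1 1 1) • ⟨E₁, mem_p_E₁⟩ + x.1.1 1 0 • ⟨E₂, mem_p_E₂⟩)]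
  · simp only [cl, map_add, map_smul]; rfl
  · rw [lie_k, lie_E_E₁, lie_F_E₁, lie_H₁_E₁, lie_H₂_E₁]
    change _ = (2 * x.1.1 0 0 + x.1.1 1 1) • E₁ + x.1.1 1 0 • E₂
    module

lemma cAd_E₂ (x : k) : cAd x ⟨E₂, mem_p_E₂⟩ =
    x.1.1 0 1 • cE₁ + (x.1.1 0 0 + 2 * x.1.1 1 1) • cE₂ := by
  rw [cAd_eq (z := x.1.1 0 1 • ⟨E₁, mem_p_E₁⟩ + (x.1.1 0 0 + 2 * x.1.1 1 1) • ⟨E₂, mem_p_E₂⟩)]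
  · simp only [cl, map_add, map_smul]; rfl
  · rw [lie_k, lie_E_E₂, lie_F_E₂, lie_H₁_E₂, lie_H₂_E₂]
    change _ = x.1.1 0 1 • E₁ + (x.1.1 0 0 + 2 * x.1.1 1 1) • E₂
    module

lemma cAd_F₁ (x : k) : cAd x ⟨F₁, mem_p_F₁⟩ =
    -(2 * x.1.1 0 0 + x.1.1 1 1) • cF₁ - x.1.1 0 1 • cF₂ := by
  rw [cAd_eq (z := -(2 * x.1.1 0 0 + x.1.1 1 1) • ⟨F₁, mem_p_F₁⟩ - x.1.1 0 1 • ⟨F₂, mem_p_F₂⟩)]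
  · simp only [cl, map_sub, map_smul]; rfl
  · rw [lie_k, lie_E_F₁, lie_F_F₁, lie_H₁_F₁, lie_H₂_F₁]
    change _ = -(2 * x.1.1 0 0 + x.1.1 1 1) • F₁ - x.1.1 0 1 • F₂
    module

lemma cAd_F₂ (x : k) : cAd x ⟨F₂, mem_p_F₂⟩ =
    -x.1.1 1 0 • cF₁ - (x.1.1 0 0 + 2 * x.1.1 1 1) • cF₂ := by
  rw [cAd_eq (z := -x.1.1 1 0 • ⟨F₁, mem_p_F₁⟩ - (x.1.1 0 0 + 2 * x.1.1 1 1) • ⟨F₂, mem_p_F₂⟩)]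
  · simp only [cl, map_sub, map_smul]; rfl
  · rw [lie_k, lie_E_F₂, lie_F_F₂, lie_H₁_F₂, lie_H₂_F₂]
    change _ = -x.1.1 1 0 • F₁ - (x.1.1 0 0 + 2 * x.1.1 1 1) • F₂
    module

lemma α_eq (x : k) : α x = -((x.1.1 0 0 + x.1.1 1 1 / 2) • (cE₁ * cF₁) +
    (x.1.1 0 0 / 2 + x.1.1 1 1) • (cE₂ * cF₂) + (x.1.1 0 1 / 2) • (cE₁ * cF₂) +
    (x.1.1 1 0 / 2) • (cE₂ * cF₁) + (3 / 2 * (x.1.1 0 0 + x.1.1 1 1)) • 1) := by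
  rw [α, cAd_E₁, cAd_E₂, cAd_F₁, cAd_F₂]
  simp only [add_mul, sub_mul, smul_mul_assoc, cF₁_cE₁, cF₂_cE₂, cF₁_cE₂, cF₂_cE₁]
  module

/-- The defining property of `α`: its Clifford commutator on `𝔭` is the adjoint action. Both sides
are linear in `y`, so the four root vectors suffice. -/
lemma α_mul_cl (x : k) (y : p) : α x * cl y = cl y * α x + cAd x y := by
  have key : ∀ y : p, α x * cl y = cl y * α x + cAd x y ↔
      y ∈ LinearMap.ker (LinearMap.mulLeft ℂ (α x) ∘ₗ CliffordAlgebra.ι Q -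
        LinearMap.mulRight ℂ (α x) ∘ₗ CliffordAlgebra.ι Q - CliffordAlgebra.ι Q ∘ₗ
        LinearMap.codRestrict p ((LieModule.toEnd ℂ g g x.1 : g →ₗ[ℂ] g) ∘ₗ p.subtype)
          (fun y => lie_mem_p x y)) := by
    intro y
    rw [LinearMap.mem_ker, LinearMap.sub_apply, LinearMap.sub_apply, sub_sub, sub_eq_zero]
    rfl
  rw [key, p_eq_sum y]
  refine Submodule.add_mem _ (Submodule.add_mem _ (Submodule.add_mem _ ?_ ?_) ?_) ?_ <;>
    refine Submodule.smul_mem _ _ ((key _).1 ?_)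
  · rw [cAd_E₁, α_eq]
    change _ * cE₁ = cE₁ * _ + _
    simp only [add_mul, mul_add, smul_mul_assoc, mul_smul_comm, neg_mul, mul_neg, mul_assoc,
      one_mul, mul_one, cF₁_cE₁, cF₂_cE₁, cE₂_cE₁_mul, cE₁_sq_mul, mul_sub]
    module
  · rw [cAd_E₂, α_eq]
    change _ * cE₂ = cE₂ * _ + _
    simp only [add_mul, mul_add, smul_mul_assoc, mul_smul_comm, neg_mul, mul_neg, mul_assoc,
      one_mul, mul_one, cF₁_cE₂, cF₂_cE₂, cE₂_cE₁_mul, cE₂_sq_mul, mul_sub]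
    module
  · rw [cAd_F₁, α_eq]
    change _ * cF₁ = cF₁ * _ + _
    simp only [add_mul, mul_add, smul_mul_assoc, mul_smul_comm, neg_mul, mul_neg, mul_assoc,
      one_mul, mul_one, cF₂_cF₁, cF₁_sq, cF₁_cE₁_mul, cF₁_cE₂_mul, mul_zero]
    module
  · rw [cAd_F₂, α_eq]
    change _ * cF₂ = cF₂ * _ + _
    simp only [add_mul, mul_add, smul_mul_assoc, mul_smul_comm, neg_mul, mul_neg, mul_assoc,
      one_mul, mul_one, cF₂_cF₁, cF₂_sq, cF₂_cE₁_mul, cF₂_cE₂_mul, mul_zero]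
    module

end Clifford

lemma Δ_mul_u (x : k) (y : g) : Δ x * (u y ⊗ₜ[ℂ] (1 : Cl)) =
    (u y ⊗ₜ[ℂ] (1 : Cl)) * Δ x + u ⁅x.1, y⁆ ⊗ₜ[ℂ] (1 : Cl) := by
  simp only [Δ, add_mul, mul_add, Algebra.TensorProduct.tmul_mul_tmul, one_mul, mul_one]
  rw [u_comm x.1 y, TensorProduct.add_tmul]
  abel

lemma Δ_mul_cl (x : k) (y : p) : Δ x * ((1 : Ug) ⊗ₜ[ℂ] cl y) =
    ((1 : Ug) ⊗ₜ[ℂ] cl y) * Δ x + (1 : Ug) ⊗ₜ[ℂ] cAd x y := by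
  simp only [Δ, add_mul, mul_add, Algebra.TensorProduct.tmul_mul_tmul, one_mul, mul_one]
  rw [α_mul_cl x y, TensorProduct.tmul_add]
  abel

/-! ### `𝒜^K` commutes with `𝔨_Δ` -/

section Derivative

variable {M M' : Type*} [AddCommGroup M] [Module ℂ M] [AddCommGroup M'] [Module ℂ M']

/-- The curve `f` in the vector space `M` is a finite linear combination of fixed vectors with
differentiable coefficients, and its derivative at `0` is `m`. -/
def HasFinDeriv (f : ℝ → M) (m : M) : Prop :=
  ∃ (ι : Type) (_ : Fintype ι) (c : ι → ℝ → ℂ) (c' : ι → ℂ) (e : ι → M),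
    (∀ t, f t = ∑ i, c i t • e i) ∧ (∀ i, HasDerivAt (c i) (c' i) 0) ∧ m = ∑ i, c' i • e i

namespace HasFinDeriv

lemma smul_const {c : ℝ → ℂ} {c' : ℂ} (h : HasDerivAt c c' 0) (e : M) :
    HasFinDeriv (fun t => c t • e) (c' • e) :=
  ⟨Unit, inferInstance, fun _ => c, fun _ => c', fun _ => e, by simp, fun _ => h, by simp⟩

lemma const (e : M) : HasFinDeriv (fun _ => e) (0 : M) := by
  simpa using smul_const (hasDerivAt_const (0 : ℝ) (1 : ℂ)) e

lemma add {f f' : ℝ → M} {m m' : M} (h : HasFinDeriv f m) (h' : HasFinDeriv f' m') :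
    HasFinDeriv (fun t => f t + f' t) (m + m') := by
  obtain ⟨ι, _, c, c', e, h1, h2, rfl⟩ := h
  obtain ⟨κ, _, d, d', e', h1', h2', rfl⟩ := h'
  refine ⟨ι ⊕ κ, inferInstance, Sum.elim c d, Sum.elim c' d', Sum.elim e e', ?_, ?_, ?_⟩
  · intro t; simp [h1, h1', Fintype.sum_sum_type]
  · rintro (i | i); exacts [h2 i, h2' i]
  · simp [Fintype.sum_sum_type]

lemma map (L : M →ₗ[ℂ] M') {f : ℝ → M} {m : M} (h : HasFinDeriv f m) :
    HasFinDeriv (fun t => L (f t)) (L m) := by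
  obtain ⟨ι, hι, c, c', e, h1, h2, rfl⟩ := h
  exact ⟨ι, hι, c, c', L ∘ e, by simp [h1], h2, by simp⟩

lemma mul {R : Type*} [Ring R] [Algebra ℂ R] {f f' : ℝ → R} {m m' : R} (h : HasFinDeriv f m)
    (h' : HasFinDeriv f' m') :
    HasFinDeriv (fun t => f t * f' t) (m * f' 0 + f 0 * m') := by
  obtain ⟨ι, _, c, c', e, h1, h2, rfl⟩ := h
  obtain ⟨κ, _, d, d', e', h1', h2', rfl⟩ := h'
  refine ⟨ι × κ, inferInstance, fun i t => c i.1 t * d i.2 t,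
    fun i => c' i.1 * d i.2 0 + c i.1 0 * d' i.2, fun i => e i.1 * e' i.2, ?_, ?_, ?_⟩
  · intro t
    simp only [h1, h1', Finset.sum_mul_sum, Fintype.sum_prod_type, smul_mul_smul_comm]
  · intro i; exact (h2 i.1).mul (h2' i.2)
  · rw [h1, h1', Finset.sum_mul_sum, Finset.sum_mul_sum, Fintype.sum_prod_type,
      ← Finset.sum_add_distrib]
    simp only [← Finset.sum_add_distrib, smul_mul_smul_comm, add_smul]

/-- A constant curve has derivative zero. -/
lemma eq_zero {e m : M} (h : HasFinDeriv (fun _ => e) m) : m = 0 := by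
  -- The presentation of a curve by coefficients and vectors is not unique. Linear functionals
  -- separate points and reduce the claim to uniqueness of derivatives of scalar functions, so no
  -- topology on the space is needed.
  obtain ⟨ι, _, c, c', e', h1, h2, rfl⟩ := h
  rw [← Module.forall_dual_apply_eq_zero_iff ℂ]
  intro φ
  have hd : HasDerivAt (fun t : ℝ => ∑ i, c i t * φ (e' i)) (∑ i, c' i * φ (e' i)) 0 :=
    HasDerivAt.fun_sum fun i _ => (h2 i).mul_const _
  have hc : (fun t : ℝ => ∑ i, c i t * φ (e' i)) = fun _ => φ e := by
    funext t
    rw [show e = ∑ i, c i t • e' i from h1 t, map_sum]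
    simp
  rw [hc] at hd
  simpa using hd.unique (hasDerivAt_const (0 : ℝ) (φ e))

end HasFinDeriv

end Derivative

/-- A curve in `K` through `1` with derivative `Y` at `0`. -/
structure IsCurve (γ : ℝ → K) (Y : k) : Prop where
  zero : γ 0 = 1
  deriv : ∀ i j, HasDerivAt
    (fun t => ((γ t : GL (Fin 3) ℂ) : Matrix (Fin 3) (Fin 3) ℂ) i j) (Y.1.1 i j) 0
  deriv_inv : ∀ i j, HasDerivAt
    (fun t => (((γ t : GL (Fin 3) ℂ)⁻¹ : GL (Fin 3) ℂ) : Matrix (Fin 3) (Fin 3) ℂ) i j)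
      (-Y.1.1 i j) 0

/-! ### Differentiating the action of `K` on `𝒜` along a curve -/

namespace IsCurve

variable {γ : ℝ → K} {Y : k} (h : IsCurve γ Y)
include h

lemma hasDerivAt_Ad (x : g) (i j : Fin 3) :
    HasDerivAt (fun t => (Ad (γ t) x).1 i j) ((⁅Y.1, x⁆ : g).1 i j) 0 := by
  have e1 : (fun t => (Ad (γ t) x).1 i j) = fun t =>
      ∑ a, (∑ b, ((γ t : GL (Fin 3) ℂ) : Matrix (Fin 3) (Fin 3) ℂ) i b * x.1 b a) *
        (((γ t : GL (Fin 3) ℂ)⁻¹ : GL (Fin 3) ℂ) : Matrix (Fin 3) (Fin 3) ℂ) a j := by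
    funext t
    change (((γ t : GL (Fin 3) ℂ) : Matrix (Fin 3) (Fin 3) ℂ) * x.1 *
      (((γ t : GL (Fin 3) ℂ)⁻¹ : GL (Fin 3) ℂ) : Matrix (Fin 3) (Fin 3) ℂ)) i j = _
    simp only [Matrix.mul_apply]
  have e2 : (⁅Y.1, x⁆ : g).1 i j = ∑ a, ((∑ b, Y.1.1 i b * x.1 b a) *
      (((γ 0 : GL (Fin 3) ℂ)⁻¹ : GL (Fin 3) ℂ) : Matrix (Fin 3) (Fin 3) ℂ) a j +
      (∑ b, ((γ 0 : GL (Fin 3) ℂ) : Matrix (Fin 3) (Fin 3) ℂ) i b * x.1 b a) *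
        (-Y.1.1 a j)) := by
    rw [LieAlgebra.SpecialLinear.sl_bracket, h.zero]
    simp [Matrix.mul_apply, Matrix.one_apply, Finset.sum_add_distrib, sub_eq_add_neg]
  rw [e1, e2]
  exact HasDerivAt.fun_sum fun a _ =>
    (HasDerivAt.fun_sum fun b _ => (h.deriv i b).mul_const _).mul (h.deriv_inv a j)

lemma hasFinDeriv_Ad (x : g) : HasFinDeriv (fun t => Ad (γ t) x) ⁅Y.1, x⁆ := by
  rw [eq_sum_basis ⁅Y.1, x⁆]
  have e : (fun t => Ad (γ t) x) = _ := funext fun t => eq_sum_basis (Ad (γ t) x)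
  rw [e]
  exact (((((((HasFinDeriv.smul_const (h.hasDerivAt_Ad x _ _) _).add
    (HasFinDeriv.smul_const (h.hasDerivAt_Ad x _ _) _)).add
    (HasFinDeriv.smul_const (h.hasDerivAt_Ad x _ _) _)).add
    (HasFinDeriv.smul_const (h.hasDerivAt_Ad x _ _) _)).add
    (HasFinDeriv.smul_const (h.hasDerivAt_Ad x _ _) _)).add
    (HasFinDeriv.smul_const (h.hasDerivAt_Ad x _ _) _)).add
    (HasFinDeriv.smul_const (h.hasDerivAt_Ad x _ _) _)).add
    (HasFinDeriv.smul_const (h.hasDerivAt_Ad x _ _) _)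

lemma hasFinDeriv_AdP (y : p) :
    HasFinDeriv (fun t => AdP (γ t) y) (⟨⁅Y.1, y.1⁆, lie_mem_p Y y⟩ : p) := by
  rw [p_eq_sum ⟨⁅Y.1, y.1⁆, lie_mem_p Y y⟩]
  have e : (fun t => AdP (γ t) y) = _ := funext fun t => p_eq_sum (AdP (γ t) y)
  rw [e]
  exact (((HasFinDeriv.smul_const (h.hasDerivAt_Ad y.1 _ _) _).add
    (HasFinDeriv.smul_const (h.hasDerivAt_Ad y.1 _ _) _)).add
    (HasFinDeriv.smul_const (h.hasDerivAt_Ad y.1 _ _) _)).add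
    (HasFinDeriv.smul_const (h.hasDerivAt_Ad y.1 _ _) _)

omit h in
lemma AdA_u (a : K) (x : g) : AdA a (u x ⊗ₜ[ℂ] (1 : Cl)) = u (Ad a x) ⊗ₜ[ℂ] (1 : Cl) := by
  rw [AdA, Algebra.TensorProduct.map_tmul, map_one, u, UniversalEnvelopingAlgebra.lift_ι_apply]
  rfl

omit h in
lemma AdA_cl (a : K) (y : p) :
    AdA a ((1 : Ug) ⊗ₜ[ℂ] cl y) = (1 : Ug) ⊗ₜ[ℂ] cl (AdP a y) := by
  rw [AdA, Algebra.TensorProduct.map_tmul, map_one, cl, CliffordAlgebra.map_apply_ι]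

omit h in
lemma Ad_one (x : g) : Ad ((1 : K) : GL (Fin 3) ℂ) x = x := by
  apply Subtype.ext
  change (((1 : K) : GL (Fin 3) ℂ) : Matrix (Fin 3) (Fin 3) ℂ) * x.1 *
    ((((1 : K) : GL (Fin 3) ℂ)⁻¹ : GL (Fin 3) ℂ) : Matrix (Fin 3) (Fin 3) ℂ) = x.1
  simp

/-- The differential of the action of `K` on `𝒜` is the commutator with `𝔨_Δ`. -/
lemma hasFinDeriv_AdA (a : A) :
    HasFinDeriv (fun t => AdA (γ t) a) (Δ Y * a - a * Δ Y) ∧ AdA (γ 0) a = a := by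
  -- Both the derivative of a curve of automorphisms and the commutator with `Δ Y` obey the Leibniz
  -- rule. The elements where they agree thus form a subalgebra, and only the generators `𝔤` and `𝔭`
  -- remain.
  let N : Subalgebra ℂ A :=
    { carrier := {a | HasFinDeriv (fun t => AdA (γ t) a) (Δ Y * a - a * Δ Y) ∧ AdA (γ 0) a = a}
      mul_mem' := by
        rintro a b ⟨ha, ha'⟩ ⟨hb, hb'⟩
        refine ⟨?_, by rw [map_mul, ha', hb']⟩
        have := ha.mul hb
        rw [ha', hb'] at this
        simp only [map_mul]
        have e : Δ Y * (a * b) - a * b * Δ Y =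
            (Δ Y * a - a * Δ Y) * b + a * (Δ Y * b - b * Δ Y) := by noncomm_ring
        rw [e]
        exact this
      add_mem' := by
        rintro a b ⟨ha, ha'⟩ ⟨hb, hb'⟩
        refine ⟨?_, by rw [map_add, ha', hb']⟩
        simp only [map_add]
        have e : Δ Y * (a + b) - (a + b) * Δ Y =
            (Δ Y * a - a * Δ Y) + (Δ Y * b - b * Δ Y) := by noncomm_ring
        rw [e]
        exact ha.add hb
      algebraMap_mem' := by
        intro r
        refine ⟨?_, AlgHom.commutes _ _⟩
        simp only [AlgHom.commutes]
        rw [← Algebra.commutes, sub_self]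
        exact HasFinDeriv.const _ }
  have hN : N = ⊤ := by
    refine A_subalgebra_eq_top (fun x => ⟨?_, ?_⟩) (fun y => ⟨?_, ?_⟩)
    · simp only [AdA_u]
      rw [Δ_mul_u, add_sub_cancel_left]
      exact (h.hasFinDeriv_Ad x).map (((TensorProduct.mk ℂ Ug Cl).flip 1) ∘ₗ
        (UniversalEnvelopingAlgebra.ι ℂ : g →ₗ⁅ℂ⁆ Ug).toLinearMap)
    · rw [AdA_u, h.zero, Ad_one]
    · simp only [AdA_cl]
      rw [Δ_mul_cl, add_sub_cancel_left]
      exact (h.hasFinDeriv_AdP y).map ((TensorProduct.mk ℂ Ug Cl 1) ∘ₗ CliffordAlgebra.ι Q)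
    · rw [AdA_cl, h.zero]
      have : AdP 1 y = y := Subtype.ext (Ad_one y.1)
      rw [this]
  have : a ∈ N := by rw [hN]; trivial
  exact this

lemma commute {a : A} (ha : a ∈ AK) : Δ Y * a = a * Δ Y := by
  have h1 := (h.hasFinDeriv_AdA a).1
  have h2 : (fun t => AdA (γ t) a) = fun _ => a := by
    funext t
    exact (AlgHom.mem_equalizer _ _ _).1 ((Algebra.mem_iInf.1 ha) (γ t))
  rw [h2] at h1
  exact sub_eq_zero.1 h1.eq_zero

end IsCurve

/-- The element of `K` given by a unitary matrix of determinant `1` commuting with `Γ`. -/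
def kOfMatrix (M : Matrix (Fin 3) (Fin 3) ℂ) (h : Mᴴ * M = 1) (hdet : M.det = 1)
    (hΓ : Gam * M = M * Gam) : K :=
  ⟨⟨M, Mᴴ, mul_eq_one_comm.1 h, h⟩, ⟨hdet, by
    change Mᴴ * Gam * M = Gam
    rw [mul_assoc, hΓ, ← mul_assoc, h, one_mul]⟩, by
    change Mᴴᴴ = M
    exact Matrix.conjTranspose_conjTranspose M⟩

/-- For a unitary curve the inverse is the conjugate transpose, so its derivative at `0` is `Yᴴ =
-Y` and no derivative of an inverse has to be computed. -/
lemma commute_of_matrix_curve {M : ℝ → Matrix (Fin 3) (Fin 3) ℂ} {Y : k}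
    (h : ∀ t, (M t)ᴴ * M t = 1) (hdet : ∀ t, (M t).det = 1) (hΓ : ∀ t, Gam * M t = M t * Gam)
    (h0 : M 0 = 1) (hY : Y.1.1ᴴ = -Y.1.1)
    (hM : ∀ i j, HasDerivAt (fun t => M t i j) (Y.1.1 i j) 0) {a : A} (ha : a ∈ AK) :
    Δ Y * a = a * Δ Y := by
  refine IsCurve.commute (γ := fun t => kOfMatrix (M t) (h t) (hdet t) (hΓ t)) ⟨?_, hM, ?_⟩ ha
  · apply Subtype.ext
    apply Units.ext
    exact h0
  · intro i j
    have e : -Y.1.1 i j = star (Y.1.1 j i) := by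
      rw [← Matrix.conjTranspose_apply, hY, Matrix.neg_apply]
    rw [e]
    exact (hM j i).star

lemma Δ_add (x y : k) : Δ (x + y) = Δ x + Δ y := by
  have h : α (x + y) = α x + α y := by
    have e : ∀ i j, (x + y).1.1 i j = x.1.1 i j + y.1.1 i j := fun _ _ => rfl
    simp only [α_eq, e]
    module
  rw [Δ, h, Δ, Δ, Submodule.coe_add, u, map_add, TensorProduct.add_tmul, TensorProduct.tmul_add]
  abel

lemma Δ_smul (c : ℂ) (x : k) : Δ (c • x) = c • Δ x := by
  have h : α (c • x) = c • α x := by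
    have e : ∀ i j, (c • x).1.1 i j = c * x.1.1 i j := fun _ _ => rfl
    simp only [α_eq, e]
    module
  rw [Δ, h, Δ, Submodule.coe_smul, u, map_smul, TensorProduct.tmul_smul, smul_add,
    ← TensorProduct.smul_tmul']

/-! ### Explicit curves in `K` whose tangent vectors span `𝔨` -/

lemma hasDerivAt_cos : HasDerivAt (fun t : ℝ => (Real.cos t : ℂ)) 0 0 := by
  simpa using (Real.hasDerivAt_cos 0).ofReal_comp

lemma hasDerivAt_sin : HasDerivAt (fun t : ℝ => (Real.sin t : ℂ)) 1 0 := by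
  simpa using (Real.hasDerivAt_sin 0).ofReal_comp

lemma cos_sq_add_sin_sq (t : ℝ) : (Real.cos t : ℂ) * Real.cos t + Real.sin t * Real.sin t = 1 := by
  have := Real.cos_sq_add_sin_sq t
  rw [sq, sq] at this
  exact_mod_cast this

lemma commute_rotation {a : A} (ha : a ∈ AK) : Δ (kF - kE) * a = a * Δ (kF - kE) := by
  have hval : (kF - kE).1.1 = !![0, -1, 0; 1, 0, 0; 0, 0, 0] := by
    change F.1 - E.1 = _
    rw [val_E, val_F]
    ext i j; fin_cases i <;> fin_cases j <;> simp
  refine commute_of_matrix_curve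
    (M := fun t => !![(Real.cos t : ℂ), -Real.sin t, 0; Real.sin t, Real.cos t, 0; 0, 0, 1])
    (fun t => ?_) (fun t => ?_) (fun t => ?_) ?_ ?_ ?_ ha
  · have := cos_sq_add_sin_sq t
    ext i j
    fin_cases i <;> fin_cases j <;>
      simp [Matrix.mul_apply, Fin.sum_univ_three, -Complex.ofReal_cos, -Complex.ofReal_sin] <;>
      first | ring1 | linear_combination this
  · have := cos_sq_add_sin_sq t
    rw [Matrix.det_fin_three]
    simp [-Complex.ofReal_cos, -Complex.ofReal_sin]
    linear_combination this
  · ext i j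
    fin_cases i <;> fin_cases j <;> simp [Gam]
  · ext i j
    fin_cases i <;> fin_cases j <;> simp
  · rw [hval]
    ext i j
    fin_cases i <;> fin_cases j <;> simp
  · rw [hval]
    intro i j
    fin_cases i <;> fin_cases j <;>
      simp [-Complex.ofReal_cos, -Complex.ofReal_sin, hasDerivAt_cos, hasDerivAt_sin,
        hasDerivAt_const, hasDerivAt_sin.fun_neg]

lemma commute_rotation' {a : A} (ha : a ∈ AK) :
    Δ (Complex.I • (kE + kF)) * a = a * Δ (Complex.I • (kE + kF)) := by
  have hval : (Complex.I • (kE + kF)).1.1 = !![0, Complex.I, 0; Complex.I, 0, 0; 0, 0, 0] := by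
    change Complex.I • (E.1 + F.1) = _
    rw [val_E, val_F]
    ext i j; fin_cases i <;> fin_cases j <;> simp
  refine commute_of_matrix_curve
    (M := fun t => !![(Real.cos t : ℂ), Complex.I * Real.sin t, 0;
      Complex.I * Real.sin t, Real.cos t, 0; 0, 0, 1])
    (fun t => ?_) (fun t => ?_) (fun t => ?_) ?_ ?_ ?_ ha
  · have := cos_sq_add_sin_sq t
    ext i j
    fin_cases i <;> fin_cases j <;>
      simp [Matrix.mul_apply, Fin.sum_univ_three, -Complex.ofReal_cos, -Complex.ofReal_sin] <;>
      first | ring1 | linear_combination this - Real.sin t * Real.sin t * Complex.I_mul_I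
  · have := cos_sq_add_sin_sq t
    rw [Matrix.det_fin_three]
    simp [-Complex.ofReal_cos, -Complex.ofReal_sin]
    linear_combination this - Real.sin t * Real.sin t * Complex.I_mul_I
  · ext i j
    fin_cases i <;> fin_cases j <;> simp [Gam]
  · ext i j
    fin_cases i <;> fin_cases j <;> simp
  · rw [hval]
    ext i j
    fin_cases i <;> fin_cases j <;> simp
  · have hs : HasDerivAt (fun t : ℝ => Complex.I * (Real.sin t : ℂ)) Complex.I 0 := by
      simpa using hasDerivAt_sin.const_mul Complex.I
    rw [hval]
    intro i j
    fin_cases i <;> fin_cases j <;>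
      simp [-Complex.ofReal_cos, -Complex.ofReal_sin, hasDerivAt_cos, hs, hasDerivAt_const]

lemma commute_H₁ {a : A} (ha : a ∈ AK) :
    Δ (Complex.I • kH₁) * a = a * Δ (Complex.I • kH₁) := by
  have hval : (Complex.I • kH₁).1.1 = !![Complex.I, 0, 0; 0, 0, 0; 0, 0, -Complex.I] := by
    change Complex.I • H₁.1 = _
    rw [val_H₁]
    ext i j; fin_cases i <;> fin_cases j <;> simp
  refine commute_of_matrix_curve
    (M := fun t => !![(Real.cos t : ℂ) + Complex.I * Real.sin t, 0, 0; 0, 1, 0;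
      0, 0, (Real.cos t : ℂ) - Complex.I * Real.sin t])
    (fun t => ?_) (fun t => ?_) (fun t => ?_) ?_ ?_ ?_ ha
  · have := cos_sq_add_sin_sq t
    ext i j
    fin_cases i <;> fin_cases j <;>
      simp [Matrix.mul_apply, Fin.sum_univ_three, -Complex.ofReal_cos, -Complex.ofReal_sin] <;>
      linear_combination this - Real.sin t * Real.sin t * Complex.I_mul_I
  · have := cos_sq_add_sin_sq t
    rw [Matrix.det_fin_three]
    simp [-Complex.ofReal_cos, -Complex.ofReal_sin]
    linear_combination this - Real.sin t * Real.sin t * Complex.I_mul_I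
  · ext i j
    fin_cases i <;> fin_cases j <;> simp [Gam]
  · ext i j
    fin_cases i <;> fin_cases j <;> simp
  · rw [hval]
    ext i j
    fin_cases i <;> fin_cases j <;> simp
  · have hs := hasDerivAt_sin.const_mul Complex.I
    have h1 : HasDerivAt (fun t : ℝ => (Real.cos t : ℂ) + Complex.I * Real.sin t)
        Complex.I 0 := by simpa using hasDerivAt_cos.fun_add hs
    have h2 : HasDerivAt (fun t : ℝ => (Real.cos t : ℂ) - Complex.I * Real.sin t)
        (-Complex.I) 0 := by simpa using hasDerivAt_cos.fun_sub hs
    rw [hval]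
    intro i j
    fin_cases i <;> fin_cases j <;>
      simp [-Complex.ofReal_cos, -Complex.ofReal_sin, h1, h2, hasDerivAt_const]

lemma commute_H₂ {a : A} (ha : a ∈ AK) :
    Δ (Complex.I • kH₂) * a = a * Δ (Complex.I • kH₂) := by
  have hval : (Complex.I • kH₂).1.1 = !![0, 0, 0; 0, Complex.I, 0; 0, 0, -Complex.I] := by
    change Complex.I • H₂.1 = _
    rw [val_H₂]
    ext i j; fin_cases i <;> fin_cases j <;> simp
  refine commute_of_matrix_curve
    (M := fun t => !![1, 0, 0; 0, (Real.cos t : ℂ) + Complex.I * Real.sin t, 0;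
      0, 0, (Real.cos t : ℂ) - Complex.I * Real.sin t])
    (fun t => ?_) (fun t => ?_) (fun t => ?_) ?_ ?_ ?_ ha
  · have := cos_sq_add_sin_sq t
    ext i j
    fin_cases i <;> fin_cases j <;>
      simp [Matrix.mul_apply, Fin.sum_univ_three, -Complex.ofReal_cos, -Complex.ofReal_sin] <;>
      linear_combination this - Real.sin t * Real.sin t * Complex.I_mul_I
  · have := cos_sq_add_sin_sq t
    rw [Matrix.det_fin_three]
    simp [-Complex.ofReal_cos, -Complex.ofReal_sin]
    linear_combination this - Real.sin t * Real.sin t * Complex.I_mul_I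
  · ext i j
    fin_cases i <;> fin_cases j <;> simp [Gam]
  · ext i j
    fin_cases i <;> fin_cases j <;> simp
  · rw [hval]
    ext i j
    fin_cases i <;> fin_cases j <;> simp
  · have hs := hasDerivAt_sin.const_mul Complex.I
    have h1 : HasDerivAt (fun t : ℝ => (Real.cos t : ℂ) + Complex.I * Real.sin t)
        Complex.I 0 := by simpa using hasDerivAt_cos.fun_add hs
    have h2 : HasDerivAt (fun t : ℝ => (Real.cos t : ℂ) - Complex.I * Real.sin t)
        (-Complex.I) 0 := by simpa using hasDerivAt_cos.fun_sub hs
    rw [hval]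
    intro i j
    fin_cases i <;> fin_cases j <;>
      simp [-Complex.ofReal_cos, -Complex.ofReal_sin, h1, h2, hasDerivAt_const]

/-- The `K`-invariants in `𝒜` commute with `𝔨_Δ`. -/
theorem Δ_commute {a : A} (ha : a ∈ AK) (x : k) : Δ x * a = a * Δ x := by
  let N : Submodule ℂ k :=
    { carrier := {x | Δ x * a = a * Δ x}
      zero_mem' := by
        change Δ 0 * a = a * Δ 0
        rw [show (0 : k) = (0 : ℂ) • 0 by simp, Δ_smul, zero_smul, zero_mul, mul_zero]
      add_mem' := by
        intro x y hx hy
        change Δ (x + y) * a = a * Δ (x + y)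
        rw [Δ_add, add_mul, mul_add, show Δ x * a = a * Δ x from hx,
          show Δ y * a = a * Δ y from hy]
      smul_mem' := by
        intro c x hx
        change Δ (c • x) * a = a * Δ (c • x)
        rw [Δ_smul, smul_mul_assoc, mul_smul_comm, show Δ x * a = a * Δ x from hx] }
  -- The curves have tangents in the real form of `𝔨`; commutation is complex linear in `x`, so the
  -- factor `i` is removed and `E`, `F` are recovered from `F - E` and `E + F`.
  have h1 : kF - kE ∈ N := commute_rotation ha
  have h2 : kE + kF ∈ N := (N.smul_mem_iff Complex.I_ne_zero).1 (commute_rotation' ha)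
  have h3 : kH₁ ∈ N := (N.smul_mem_iff Complex.I_ne_zero).1 (commute_H₁ ha)
  have h4 : kH₂ ∈ N := (N.smul_mem_iff Complex.I_ne_zero).1 (commute_H₂ ha)
  have hF : kF ∈ N := by
    rw [← N.smul_mem_iff (two_ne_zero : (2 : ℂ) ≠ 0)]
    convert N.add_mem h1 h2 using 1
    module
  have hE : kE ∈ N := by
    convert N.sub_mem h2 hF using 1
    abel
  have hx : x ∈ N := by
    rw [k_eq_sum x]
    exact N.add_mem (N.add_mem (N.add_mem (N.smul_mem _ hE) (N.smul_mem _ hF))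
      (N.smul_mem _ h3)) (N.smul_mem _ h4)
  exact hx

/-! ### Some elements of `𝒜^K` -/

section Invariants

/-- The matrix of an element of `K`. -/
abbrev KMat (a : K) : Matrix (Fin 3) (Fin 3) ℂ := (a : GL (Fin 3) ℂ)

/-- The matrix of the inverse of an element of `K`. -/
abbrev KInv (a : K) : Matrix (Fin 3) (Fin 3) ℂ := ((a : GL (Fin 3) ℂ)⁻¹ : GL (Fin 3) ℂ)

variable (a : K)

lemma K_apply : KMat a 0 2 = 0 ∧ KMat a 1 2 = 0 ∧ KMat a 2 0 = 0 ∧ KMat a 2 1 = 0 := by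
  have h : ∀ i j, (Gam * KMat a) i j = (KMat a * Gam) i j := fun i j => by rw [Gam_comm a]
  have h1 := h 0 2
  have h2 := h 1 2
  have h3 := h 2 0
  have h4 := h 2 1
  simp [Gam] at h1 h2 h3 h4
  have z : ∀ c : ℂ, c = -c → c = 0 := fun c hc => self_eq_neg.mp hc
  exact ⟨z _ h1, z _ h2, z _ h3.symm, z _ h4.symm⟩

lemma K_inv_apply : KInv a 0 2 = 0 ∧ KInv a 1 2 = 0 ∧ KInv a 2 0 = 0 ∧ KInv a 2 1 = 0 := by
  have h := K_apply a⁻¹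
  rwa [KMat, InvMemClass.coe_inv] at h

lemma Ad_apply (x : g) (i j : Fin 3) : (Ad a x).1 i j = ∑ l, (∑ b, KMat a i b * x.1 b l) * KInv a l j := by
  change (KMat a * x.1 * KInv a) i j = _
  simp only [Matrix.mul_apply]

lemma Ad_E₁ : Ad a E₁ = (KMat a 0 0 * KInv a 2 2) • E₁ + (KMat a 1 0 * KInv a 2 2) • E₂ := by
  obtain ⟨h1, h2, h3, h4⟩ := K_apply a
  obtain ⟨k1, k2, k3, k4⟩ := K_inv_apply a
  rw [eq_sum_basis (Ad a E₁)]
  simp only [Ad_apply, Fin.sum_univ_three, h1, h2, h3, h4, k1, k2, k3, k4, val_E₁]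
  simp

lemma Ad_E₂ : Ad a E₂ = (KMat a 0 1 * KInv a 2 2) • E₁ + (KMat a 1 1 * KInv a 2 2) • E₂ := by
  obtain ⟨h1, h2, h3, h4⟩ := K_apply a
  obtain ⟨k1, k2, k3, k4⟩ := K_inv_apply a
  rw [eq_sum_basis (Ad a E₂)]
  simp only [Ad_apply, Fin.sum_univ_three, h1, h2, h3, h4, k1, k2, k3, k4, val_E₂]
  simp

lemma Ad_F₁ : Ad a F₁ = (KMat a 2 2 * KInv a 0 0) • F₁ + (KMat a 2 2 * KInv a 0 1) • F₂ := by
  obtain ⟨h1, h2, h3, h4⟩ := K_apply a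
  obtain ⟨k1, k2, k3, k4⟩ := K_inv_apply a
  rw [eq_sum_basis (Ad a F₁)]
  simp only [Ad_apply, Fin.sum_univ_three, h1, h2, h3, h4, k1, k2, k3, k4, val_F₁]
  simp

lemma Ad_F₂ : Ad a F₂ = (KMat a 2 2 * KInv a 1 0) • F₁ + (KMat a 2 2 * KInv a 1 1) • F₂ := by
  obtain ⟨h1, h2, h3, h4⟩ := K_apply a
  obtain ⟨k1, k2, k3, k4⟩ := K_inv_apply a
  rw [eq_sum_basis (Ad a F₂)]
  simp only [Ad_apply, Fin.sum_univ_three, h1, h2, h3, h4, k1, k2, k3, k4, val_F₂]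
  simp

lemma AdA_u_E₁ : AdA a (u E₁ ⊗ₜ[ℂ] 1) =
    (KMat a 0 0 * KInv a 2 2) • u E₁ ⊗ₜ[ℂ] 1 + (KMat a 1 0 * KInv a 2 2) • u E₂ ⊗ₜ[ℂ] 1 := by
  rw [IsCurve.AdA_u, Ad_E₁, u, map_add, map_smul, map_smul, TensorProduct.add_tmul]; rfl

lemma AdA_u_E₂ : AdA a (u E₂ ⊗ₜ[ℂ] 1) =
    (KMat a 0 1 * KInv a 2 2) • u E₁ ⊗ₜ[ℂ] 1 + (KMat a 1 1 * KInv a 2 2) • u E₂ ⊗ₜ[ℂ] 1 := by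
  rw [IsCurve.AdA_u, Ad_E₂, u, map_add, map_smul, map_smul, TensorProduct.add_tmul]; rfl

lemma AdA_u_F₁ : AdA a (u F₁ ⊗ₜ[ℂ] 1) =
    (KMat a 2 2 * KInv a 0 0) • u F₁ ⊗ₜ[ℂ] 1 + (KMat a 2 2 * KInv a 0 1) • u F₂ ⊗ₜ[ℂ] 1 := by
  rw [IsCurve.AdA_u, Ad_F₁, u, map_add, map_smul, map_smul, TensorProduct.add_tmul]; rfl

lemma AdA_u_F₂ : AdA a (u F₂ ⊗ₜ[ℂ] 1) =
    (KMat a 2 2 * KInv a 1 0) • u F₁ ⊗ₜ[ℂ] 1 + (KMat a 2 2 * KInv a 1 1) • u F₂ ⊗ₜ[ℂ] 1 := by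
  rw [IsCurve.AdA_u, Ad_F₂, u, map_add, map_smul, map_smul, TensorProduct.add_tmul]; rfl

lemma AdA_cE₁ : AdA a (1 ⊗ₜ[ℂ] cE₁) =
    (KMat a 0 0 * KInv a 2 2) • 1 ⊗ₜ[ℂ] cE₁ + (KMat a 1 0 * KInv a 2 2) • 1 ⊗ₜ[ℂ] cE₂ := by
  have h : AdP a ⟨E₁, mem_p_E₁⟩ = (KMat a 0 0 * KInv a 2 2) • (⟨E₁, mem_p_E₁⟩ : p) +
      (KMat a 1 0 * KInv a 2 2) • (⟨E₂, mem_p_E₂⟩ : p) := Subtype.ext (Ad_E₁ a)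
  rw [cE₁, IsCurve.AdA_cl, h, cl, map_add, map_smul, map_smul, TensorProduct.tmul_add,
    TensorProduct.tmul_smul, TensorProduct.tmul_smul]
  rfl

lemma AdA_cE₂ : AdA a (1 ⊗ₜ[ℂ] cE₂) =
    (KMat a 0 1 * KInv a 2 2) • 1 ⊗ₜ[ℂ] cE₁ + (KMat a 1 1 * KInv a 2 2) • 1 ⊗ₜ[ℂ] cE₂ := by
  have h : AdP a ⟨E₂, mem_p_E₂⟩ = (KMat a 0 1 * KInv a 2 2) • (⟨E₁, mem_p_E₁⟩ : p) +
      (KMat a 1 1 * KInv a 2 2) • (⟨E₂, mem_p_E₂⟩ : p) := Subtype.ext (Ad_E₂ a)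
  rw [cE₂, IsCurve.AdA_cl, h, cl, map_add, map_smul, map_smul, TensorProduct.tmul_add,
    TensorProduct.tmul_smul, TensorProduct.tmul_smul]
  rfl

lemma AdA_cF₁ : AdA a (1 ⊗ₜ[ℂ] cF₁) =
    (KMat a 2 2 * KInv a 0 0) • 1 ⊗ₜ[ℂ] cF₁ + (KMat a 2 2 * KInv a 0 1) • 1 ⊗ₜ[ℂ] cF₂ := by
  have h : AdP a ⟨F₁, mem_p_F₁⟩ = (KMat a 2 2 * KInv a 0 0) • (⟨F₁, mem_p_F₁⟩ : p) +
      (KMat a 2 2 * KInv a 0 1) • (⟨F₂, mem_p_F₂⟩ : p) := Subtype.ext (Ad_F₁ a)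
  rw [cF₁, IsCurve.AdA_cl, h, cl, map_add, map_smul, map_smul, TensorProduct.tmul_add,
    TensorProduct.tmul_smul, TensorProduct.tmul_smul]
  rfl

lemma AdA_cF₂ : AdA a (1 ⊗ₜ[ℂ] cF₂) =
    (KMat a 2 2 * KInv a 1 0) • 1 ⊗ₜ[ℂ] cF₁ + (KMat a 2 2 * KInv a 1 1) • 1 ⊗ₜ[ℂ] cF₂ := by
  have h : AdP a ⟨F₂, mem_p_F₂⟩ = (KMat a 2 2 * KInv a 1 0) • (⟨F₁, mem_p_F₁⟩ : p) +
      (KMat a 2 2 * KInv a 1 1) • (⟨F₂, mem_p_F₂⟩ : p) := Subtype.ext (Ad_F₂ a)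
  rw [cF₂, IsCurve.AdA_cl, h, cl, map_add, map_smul, map_smul, TensorProduct.tmul_add,
    TensorProduct.tmul_smul, TensorProduct.tmul_smul]
  rfl

/-- `K` acts on `E₁, E₂` and on `F₁, F₂` by mutually contragredient matrices, so the canonical
tensor `∑ eᵢ ⊗ fᵢ` is fixed. Stated for an arbitrary bilinear map, this yields the invariance of
`D`, `invT` and `invN` at once. -/
lemma dual_bases_sum {R M : Type*} [AddCommGroup R] [Module ℂ R] [AddCommGroup M] [Module ℂ M]
    (f : M →ₗ[ℂ] M →ₗ[ℂ] R) (e₁ e₂ f₁ f₂ : M) :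
    f ((KMat a 0 0 * KInv a 2 2) • e₁ + (KMat a 1 0 * KInv a 2 2) • e₂)
        ((KMat a 2 2 * KInv a 0 0) • f₁ + (KMat a 2 2 * KInv a 0 1) • f₂) +
      f ((KMat a 0 1 * KInv a 2 2) • e₁ + (KMat a 1 1 * KInv a 2 2) • e₂)
        ((KMat a 2 2 * KInv a 1 0) • f₁ + (KMat a 2 2 * KInv a 1 1) • f₂) = f e₁ f₁ + f e₂ f₂ := by
  obtain ⟨h1, h2, h3, h4⟩ := K_apply a
  obtain ⟨k1, k2, k3, k4⟩ := K_inv_apply a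
  have h : KMat a * KInv a = 1 := by rw [← Units.val_mul, mul_inv_cancel, Units.val_one]
  have e : ∀ i j, (KMat a * KInv a) i j = (1 : Matrix (Fin 3) (Fin 3) ℂ) i j := fun i j => by rw [h]
  simp only [Matrix.mul_apply, Fin.sum_univ_three] at e
  have e22 := e 2 2
  have e00 := e 0 0
  have e01 := e 0 1
  have e10 := e 1 0
  have e11 := e 1 1
  simp only [h1, h2, h3, h4, zero_mul, add_zero, zero_add, Matrix.one_apply_eq] at e22 e00 e01 e10 e11
  rw [Matrix.one_apply_ne (by decide)] at e01 e10
  simp only [map_add, map_smul, LinearMap.add_apply, LinearMap.smul_apply]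
  have s : KInv a 2 2 * KMat a 2 2 = 1 := by rw [mul_comm, e22]
  calc _ = (KInv a 2 2 * KMat a 2 2) • (
        (KMat a 0 0 * KInv a 0 0 + KMat a 0 1 * KInv a 1 0) • f e₁ f₁ +
        (KMat a 0 0 * KInv a 0 1 + KMat a 0 1 * KInv a 1 1) • f e₁ f₂ +
        (KMat a 1 0 * KInv a 0 0 + KMat a 1 1 * KInv a 1 0) • f e₂ f₁ +
        (KMat a 1 0 * KInv a 0 1 + KMat a 1 1 * KInv a 1 1) • f e₂ f₂) := by module
    _ = _ := by rw [s, e00, e01, e10, e11]; module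

end Invariants

lemma mem_AK_iff {x : A} : x ∈ AK ↔ ∀ a : K, AdA a x = x := by
  rw [AK, Algebra.mem_iInf]
  exact forall_congr' fun a => AlgHom.mem_equalizer _ _ _

lemma D_mem_AK : D ∈ AK := by
  refine mem_AK_iff.2 fun a => ?_
  have h1 := dual_bases_sum a (LinearMap.mul ℂ A) (u E₁ ⊗ₜ 1) (u E₂ ⊗ₜ 1) (1 ⊗ₜ cF₁) (1 ⊗ₜ cF₂)
  have h2 := dual_bases_sum a (LinearMap.mul ℂ A) (1 ⊗ₜ cE₁) (1 ⊗ₜ cE₂) (u F₁ ⊗ₜ 1) (u F₂ ⊗ₜ 1)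
  rw [← AdA_u_E₁, ← AdA_u_E₂, ← AdA_cF₁, ← AdA_cF₂] at h1
  rw [← AdA_u_F₁, ← AdA_u_F₂, ← AdA_cE₁, ← AdA_cE₂] at h2
  simp only [LinearMap.mul_apply', ← map_mul, ← map_add, Algebra.TensorProduct.tmul_mul_tmul,
    one_mul, mul_one] at h1 h2
  rw [D, add_assoc, map_add, h1, h2]

/-- The invariant `(F₁ E₁ + F₂ E₂) ⊗ 1`. -/
noncomputable def invT : A := (u F₁ * u E₁ + u F₂ * u E₂) ⊗ₜ[ℂ] 1

/-- The invariant `1 ⊗ (E₁ F₁ + E₂ F₂)`. -/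
noncomputable def invN : A := 1 ⊗ₜ[ℂ] (cE₁ * cF₁ + cE₂ * cF₂)

lemma invT_mem_AK : invT ∈ AK := by
  refine mem_AK_iff.2 fun a => ?_
  rw [invT]
  -- The factors of `invT` stand in the order `Fᵢ Eᵢ`, hence the flipped multiplication.
  have h := dual_bases_sum a (LinearMap.mul ℂ A).flip (u E₁ ⊗ₜ 1) (u E₂ ⊗ₜ 1) (u F₁ ⊗ₜ 1)
    (u F₂ ⊗ₜ 1)
  rw [← AdA_u_E₁, ← AdA_u_E₂, ← AdA_u_F₁, ← AdA_u_F₂] at h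
  simpa only [LinearMap.flip_apply, LinearMap.mul_apply', ← map_mul, ← map_add,
    Algebra.TensorProduct.tmul_mul_tmul, one_mul, mul_one, ← TensorProduct.add_tmul] using h

lemma invN_mem_AK : invN ∈ AK := by
  refine mem_AK_iff.2 fun a => ?_
  rw [invN]
  have h := dual_bases_sum a (LinearMap.mul ℂ A) (1 ⊗ₜ cE₁) (1 ⊗ₜ cE₂) (1 ⊗ₜ cF₁) (1 ⊗ₜ cF₂)
  rw [← AdA_cE₁, ← AdA_cE₂, ← AdA_cF₁, ← AdA_cF₂] at h
  simpa only [LinearMap.mul_apply', ← map_mul, ← map_add,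
    Algebra.TensorProduct.tmul_mul_tmul, one_mul, mul_one, ← TensorProduct.tmul_add] using h

/-! ### The action of `𝒜` on `X ⊗ S` -/

section Spin

/-- The vector `E₁ ∧ E₂` of `S`. -/
noncomputable def sE₁₂ : S := sE₁ * sE₂

lemma spin_cl (y : p) (s : S) : spin (cl y) s = ExteriorAlgebra.ι ℂ (plus y) * s -
    (2 : ℂ) • CliffordAlgebra.contractLeft (Q := (0 : QuadraticForm ℂ (Fin 2 → ℂ)))
      (minus y) s := by
  rw [spin, cl, CliffordAlgebra.lift_ι_apply]
  rfl

lemma plus_E₁ : plus ⟨E₁, mem_p_E₁⟩ = Pi.single 0 1 := by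
  change ![E₁.1 0 2, E₁.1 1 2] = _
  rw [val_E₁]; ext i; fin_cases i <;> simp
lemma plus_E₂ : plus ⟨E₂, mem_p_E₂⟩ = Pi.single 1 1 := by
  change ![E₂.1 0 2, E₂.1 1 2] = _
  rw [val_E₂]; ext i; fin_cases i <;> simp
lemma plus_F₁ : plus ⟨F₁, mem_p_F₁⟩ = 0 := by
  change ![F₁.1 0 2, F₁.1 1 2] = _
  rw [val_F₁]; ext i; fin_cases i <;> simp
lemma plus_F₂ : plus ⟨F₂, mem_p_F₂⟩ = 0 := by
  change ![F₂.1 0 2, F₂.1 1 2] = _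
  rw [val_F₂]; ext i; fin_cases i <;> simp
lemma minus_E₁ : minus ⟨E₁, mem_p_E₁⟩ = 0 := by
  change (E₁.1 2 0 • LinearMap.proj 0 + E₁.1 2 1 • LinearMap.proj 1 :
    Module.Dual ℂ (Fin 2 → ℂ)) = _
  rw [val_E₁]; simp
lemma minus_E₂ : minus ⟨E₂, mem_p_E₂⟩ = 0 := by
  change (E₂.1 2 0 • LinearMap.proj 0 + E₂.1 2 1 • LinearMap.proj 1 :
    Module.Dual ℂ (Fin 2 → ℂ)) = _
  rw [val_E₂]; simp
lemma minus_F₁ : minus ⟨F₁, mem_p_F₁⟩ = LinearMap.proj 0 := by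
  change (F₁.1 2 0 • LinearMap.proj 0 + F₁.1 2 1 • LinearMap.proj 1 :
    Module.Dual ℂ (Fin 2 → ℂ)) = _
  rw [val_F₁]; simp
lemma minus_F₂ : minus ⟨F₂, mem_p_F₂⟩ = LinearMap.proj 1 := by
  change (F₂.1 2 0 • LinearMap.proj 0 + F₂.1 2 1 • LinearMap.proj 1 :
    Module.Dual ℂ (Fin 2 → ℂ)) = _
  rw [val_F₂]; simp

lemma spin_cE₁ (s : S) : spin cE₁ s = sE₁ * s := by
  rw [cE₁, spin_cl, plus_E₁, minus_E₁, sE₁]; simp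
lemma spin_cE₂ (s : S) : spin cE₂ s = sE₂ * s := by
  rw [cE₂, spin_cl, plus_E₂, minus_E₂, sE₂]; simp
lemma spin_cF₁ (s : S) : spin cF₁ s = -((2 : ℂ) • CliffordAlgebra.contractLeft
    (Q := (0 : QuadraticForm ℂ (Fin 2 → ℂ))) (LinearMap.proj 0) s) := by
  rw [cF₁, spin_cl, plus_F₁, minus_F₁]; simp
lemma spin_cF₂ (s : S) : spin cF₂ s = -((2 : ℂ) • CliffordAlgebra.contractLeft
    (Q := (0 : QuadraticForm ℂ (Fin 2 → ℂ))) (LinearMap.proj 1) s) := by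
  rw [cF₂, spin_cl, plus_F₂, minus_F₂]; simp

lemma contract_one (d : Module.Dual ℂ (Fin 2 → ℂ)) : CliffordAlgebra.contractLeft
    (Q := (0 : QuadraticForm ℂ (Fin 2 → ℂ))) d (1 : S) = 0 :=
  CliffordAlgebra.contractLeft_one _ d
lemma contract_sE₁ (d : Module.Dual ℂ (Fin 2 → ℂ)) : CliffordAlgebra.contractLeft
    (Q := (0 : QuadraticForm ℂ (Fin 2 → ℂ))) d sE₁ = d (Pi.single 0 1) • (1 : S) :=
  (CliffordAlgebra.contractLeft_ι _ d _).trans (Algebra.algebraMap_eq_smul_one _)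
lemma contract_sE₂ (d : Module.Dual ℂ (Fin 2 → ℂ)) : CliffordAlgebra.contractLeft
    (Q := (0 : QuadraticForm ℂ (Fin 2 → ℂ))) d sE₂ = d (Pi.single 1 1) • (1 : S) :=
  (CliffordAlgebra.contractLeft_ι _ d _).trans (Algebra.algebraMap_eq_smul_one _)
lemma contract_sE₁₂ (d : Module.Dual ℂ (Fin 2 → ℂ)) : CliffordAlgebra.contractLeft
    (Q := (0 : QuadraticForm ℂ (Fin 2 → ℂ))) d sE₁₂ =
      d (Pi.single 0 1) • sE₂ - d (Pi.single 1 1) • sE₁ := by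
  have h := CliffordAlgebra.contractLeft_ι_mul (Q := (0 : QuadraticForm ℂ (Fin 2 → ℂ)))
    (d := d) (Pi.single 0 1) sE₂
  rw [contract_sE₂] at h
  refine h.trans ?_
  rw [mul_smul_comm]
  congr 2
  exact mul_one _

lemma sE₁_sq : sE₁ * sE₁ = 0 := ExteriorAlgebra.ι_sq_zero _
lemma sE₂_sq : sE₂ * sE₂ = 0 := ExteriorAlgebra.ι_sq_zero _
lemma sE₂_sE₁ : sE₂ * sE₁ = -sE₁₂ := by
  have h := ExteriorAlgebra.ι_add_mul_swap (R := ℂ) (Pi.single 1 1 : Fin 2 → ℂ)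
    (Pi.single 0 1 : Fin 2 → ℂ)
  exact eq_neg_of_add_eq_zero_left h
lemma sE₁_sE₂ : sE₁ * sE₂ = sE₁₂ := rfl
lemma sE₁_sE₁₂ : sE₁ * sE₁₂ = 0 := by rw [sE₁₂, ← mul_assoc, sE₁_sq, zero_mul]
lemma sE₂_sE₁₂ : sE₂ * sE₁₂ = 0 := by
  rw [sE₁₂, ← mul_assoc, sE₂_sE₁, sE₁₂, neg_mul, mul_assoc, sE₂_sq, mul_zero, neg_zero]

/-- The span of the four vectors contains `1` and is stable under left multiplication by the
generators `sE₁`, `sE₂`. -/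
lemma S_span {N : Submodule ℂ S} (h₀ : 1 ∈ N) (h₁ : sE₁ ∈ N) (h₂ : sE₂ ∈ N) (h₃ : sE₁₂ ∈ N) :
    N = ⊤ := by
  set W : Submodule ℂ S := Submodule.span ℂ {1, sE₁, sE₂, sE₁₂} with hW
  have m : ∀ s ∈ ({1, sE₁, sE₂, sE₁₂} : Set S), s ∈ W := fun s hs => Submodule.subset_span hs
  have hmul : ∀ a : S, (∀ s ∈ ({1, sE₁, sE₂, sE₁₂} : Set S), a * s ∈ W) → ∀ s ∈ W, a * s ∈ W := by
    intro a ha s hs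
    have hle : W ≤ W.comap (LinearMap.mulLeft ℂ a) := Submodule.span_le.2 ha
    exact hle hs
  have hmul₁ : ∀ s ∈ W, sE₁ * s ∈ W := by
    refine hmul _ ?_
    rintro _ (rfl | rfl | rfl | rfl)
    · rw [mul_one]; exact m _ (by simp)
    · rw [sE₁_sq]; exact W.zero_mem
    · exact m sE₁₂ (by simp)
    · rw [sE₁_sE₁₂]; exact W.zero_mem
  have hmul₂ : ∀ s ∈ W, sE₂ * s ∈ W := by
    refine hmul _ ?_
    rintro _ (rfl | rfl | rfl | rfl)
    · rw [mul_one]; exact m _ (by simp)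
    · rw [sE₂_sE₁]; exact W.neg_mem (m _ (by simp))
    · rw [sE₂_sq]; exact W.zero_mem
    · rw [sE₂_sE₁₂]; exact W.zero_mem
  have key : W = ⊤ := by
    refine eq_top_iff.2 fun s _ => ?_
    induction s using CliffordAlgebra.left_induction with
    | algebraMap r =>
      rw [Algebra.algebraMap_eq_smul_one]
      exact Submodule.smul_mem _ _ (Submodule.subset_span (by simp))
    | add x y hx hy => exact Submodule.add_mem _ (hx trivial) (hy trivial)
    | ι_mul x y hx =>
      have e : y = y 0 • Pi.single 0 1 + y 1 • Pi.single 1 1 := by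
        ext i; fin_cases i <;> simp
      rw [e, map_add, map_smul, map_smul, add_mul, smul_mul_assoc, smul_mul_assoc]
      exact W.add_mem (W.smul_mem _ (hmul₁ _ (hx trivial)))
        (W.smul_mem _ (hmul₂ _ (hx trivial)))
  rw [eq_top_iff, ← key, Submodule.span_le]
  rintro _ (rfl | rfl | rfl | rfl) <;> assumption

end Spin

/-! ### Action of `D` and of the invariants on `X ⊗ S` -/

section Act

variable {X : Type*} [AddCommGroup X] [Module ℂ X] [LieRingModule g X] [LieModule ℂ g X]

variable (X) in
/-- The action of `𝔤` on `X`. -/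
abbrev rep : g →ₗ⁅ℂ⁆ Module.End ℂ X := LieModule.toEnd ℂ g X

lemma act_u_tmul (y : g) (c : Cl) (x : X) (s : S) :
    act X (u y ⊗ₜ[ℂ] c) (x ⊗ₜ[ℂ] s) = rep X y x ⊗ₜ[ℂ] spin c s := by
  change Module.endTensorEndAlgHom (R := ℂ) (S := ℂ) (A := ℂ) (M := X) (N := S)
    (Algebra.TensorProduct.map
      (UniversalEnvelopingAlgebra.lift ℂ (LieModule.toEnd ℂ g X)) spin (u y ⊗ₜ[ℂ] c))
    (x ⊗ₜ[ℂ] s) = _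
  rw [Algebra.TensorProduct.map_tmul, u, UniversalEnvelopingAlgebra.lift_ι_apply]
  rfl

lemma act_one_tmul (c : Cl) (x : X) (s : S) :
    act X ((1 : Ug) ⊗ₜ[ℂ] c) (x ⊗ₜ[ℂ] s) = x ⊗ₜ[ℂ] spin c s := by
  change Module.endTensorEndAlgHom (R := ℂ) (S := ℂ) (A := ℂ) (M := X) (N := S)
    (Algebra.TensorProduct.map
      (UniversalEnvelopingAlgebra.lift ℂ (LieModule.toEnd ℂ g X)) spin ((1 : Ug) ⊗ₜ[ℂ] c))
    (x ⊗ₜ[ℂ] s) = _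
  rw [Algebra.TensorProduct.map_tmul, map_one]
  rfl

lemma act_invT (x : X) (s : S) : act X invT (x ⊗ₜ[ℂ] s) = opT (rep X) x ⊗ₜ[ℂ] s := by
  change Module.endTensorEndAlgHom (R := ℂ) (S := ℂ) (A := ℂ) (M := X) (N := S)
    (Algebra.TensorProduct.map
      (UniversalEnvelopingAlgebra.lift ℂ (LieModule.toEnd ℂ g X)) spin invT) (x ⊗ₜ[ℂ] s) = _
  rw [invT, Algebra.TensorProduct.map_tmul, map_add, map_mul, map_mul, u, u, u, u]
  simp only [UniversalEnvelopingAlgebra.lift_ι_apply, map_one]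
  rfl

lemma spin_mul (c c' : Cl) (s : S) : spin (c * c') s = spin c (spin c' s) := by
  rw [map_mul]; rfl

lemma act_D_one (x : X) : act X D (x ⊗ₜ[ℂ] 1) =
    rep X F₁ x ⊗ₜ[ℂ] sE₁ + rep X F₂ x ⊗ₜ[ℂ] sE₂ := by
  simp only [D, map_add, LinearMap.add_apply, act_u_tmul, spin_cE₁, spin_cE₂, spin_cF₁, spin_cF₂,
    contract_one, mul_one]
  simp

lemma act_D_sE₁ (x : X) : act X D (x ⊗ₜ[ℂ] sE₁) =
    (-2 : ℂ) • rep X E₁ x ⊗ₜ[ℂ] (1 : S) - rep X F₂ x ⊗ₜ[ℂ] sE₁₂ := by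
  simp only [D, map_add, LinearMap.add_apply, act_u_tmul, spin_cE₁, spin_cE₂, spin_cF₁, spin_cF₂,
    contract_sE₁, sE₁_sq, sE₂_sE₁, TensorProduct.tmul_neg, TensorProduct.tmul_smul,
    LinearMap.proj_apply, TensorProduct.tmul_zero]
  simp [sub_eq_add_neg]

lemma act_D_sE₂ (x : X) : act X D (x ⊗ₜ[ℂ] sE₂) =
    (-2 : ℂ) • rep X E₂ x ⊗ₜ[ℂ] (1 : S) + rep X F₁ x ⊗ₜ[ℂ] sE₁₂ := by
  simp only [D, map_add, LinearMap.add_apply, act_u_tmul, spin_cE₁, spin_cE₂, spin_cF₁, spin_cF₂,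
    contract_sE₂, sE₂_sq, sE₁_sE₂, TensorProduct.tmul_neg, TensorProduct.tmul_smul,
    LinearMap.proj_apply, TensorProduct.tmul_zero]
  simp

lemma act_D_sE₁₂ (x : X) : act X D (x ⊗ₜ[ℂ] sE₁₂) =
    (-2 : ℂ) • rep X E₁ x ⊗ₜ[ℂ] sE₂ + (2 : ℂ) • rep X E₂ x ⊗ₜ[ℂ] sE₁ := by
  simp only [D, map_add, LinearMap.add_apply, act_u_tmul, spin_cE₁, spin_cE₂, spin_cF₁, spin_cF₂,
    contract_sE₁₂, sE₁_sE₁₂, sE₂_sE₁₂, TensorProduct.tmul_neg, TensorProduct.tmul_smul,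
    LinearMap.proj_apply, TensorProduct.tmul_zero]
  simp [TensorProduct.tmul_neg]

end Act

/-! ### The square of the Dirac operator -/

section DiracSquare

variable {X : Type*} [AddCommGroup X] [Module ℂ X] [LieRingModule g X] [LieModule ℂ g X]

/-- `𝔨` acts on `S` through `α` as on `⋀ 𝔭⁺` twisted by minus half the sum of the weights of `𝔭⁺`.
That half sum takes the value `3/2` on both `H₁` and `H₂`. -/
lemma spin_α_one (y : k) : spin (α y) 1 = (-(3 / 2) * (y.1.1 0 0 + y.1.1 1 1)) • (1 : S) := by
  rw [α_eq]
  simp only [map_neg, map_add, map_smul, LinearMap.neg_apply, LinearMap.add_apply,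
    LinearMap.smul_apply, spin_mul, spin_cF₁, spin_cF₂, contract_one, map_one, smul_zero, neg_zero,
    map_zero, Module.End.one_apply]
  module

lemma spin_α_sE₁ (y : k) : spin (α y) sE₁ =
    ((y.1.1 0 0 - y.1.1 1 1) / 2) • sE₁ + y.1.1 1 0 • sE₂ := by
  rw [α_eq]
  simp only [map_neg, map_add, map_smul, LinearMap.neg_apply, LinearMap.add_apply,
    LinearMap.smul_apply, spin_mul, spin_cF₁, spin_cF₂, contract_sE₁, map_one,
    Module.End.one_apply, LinearMap.proj_apply, Pi.single_eq_same, spin_cE₁, spin_cE₂, mul_one,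
    Pi.single_eq_of_ne (one_ne_zero : (1 : Fin 2) ≠ 0), zero_smul, smul_zero, neg_zero, mul_zero]
  module

lemma spin_α_sE₂ (y : k) : spin (α y) sE₂ =
    ((y.1.1 1 1 - y.1.1 0 0) / 2) • sE₂ + y.1.1 0 1 • sE₁ := by
  rw [α_eq]
  simp only [map_neg, map_add, map_smul, LinearMap.neg_apply, LinearMap.add_apply,
    LinearMap.smul_apply, spin_mul, spin_cF₁, spin_cF₂, contract_sE₂, map_one,
    Module.End.one_apply, LinearMap.proj_apply, Pi.single_eq_same, spin_cE₁, spin_cE₂, mul_one,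
    Pi.single_eq_of_ne (zero_ne_one : (0 : Fin 2) ≠ 1), zero_smul, smul_zero, neg_zero, mul_zero]
  module

lemma spin_α_sE₁₂ (y : k) : spin (α y) sE₁₂ =
    (3 / 2 * (y.1.1 0 0 + y.1.1 1 1)) • sE₁₂ := by
  rw [α_eq]
  simp only [map_neg, map_add, map_smul, map_sub, LinearMap.neg_apply, LinearMap.add_apply,
    LinearMap.smul_apply, spin_mul, spin_cF₁, spin_cF₂, contract_sE₁₂, map_one,
    Module.End.one_apply, LinearMap.proj_apply, Pi.single_eq_same, spin_cE₁, spin_cE₂,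
    Pi.single_eq_of_ne (zero_ne_one : (0 : Fin 2) ≠ 1), zero_smul, smul_zero, mul_zero,
    Pi.single_eq_of_ne (one_ne_zero : (1 : Fin 2) ≠ 0), sE₁_sE₂, sE₂_sE₁, sE₁_sq, sE₂_sq]
  module

lemma act_Δ (y : k) (x : X) (s : S) :
    act X (Δ y) (x ⊗ₜ[ℂ] s) = rep X y.1 x ⊗ₜ[ℂ] s + x ⊗ₜ[ℂ] spin (α y) s := by
  rw [Δ, map_add, LinearMap.add_apply, act_u_tmul, act_one_tmul, map_one]
  rfl

lemma kE_apply : kE.1.1 = !![0, 1, 0; 0, 0, 0; 0, 0, 0] := val_E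
lemma kF_apply : kF.1.1 = !![0, 0, 0; 1, 0, 0; 0, 0, 0] := val_F
lemma kH₁_apply : kH₁.1.1 = !![1, 0, 0; 0, 0, 0; 0, 0, -1] := val_H₁
lemma kH₂_apply : kH₂.1.1 = !![0, 0, 0; 0, 1, 0; 0, 0, -1] := val_H₂

variable (x : X)

lemma act_E_one : act X (Δ kE) (x ⊗ₜ[ℂ] 1) = rep X E x ⊗ₜ[ℂ] 1 := by
  rw [act_Δ, spin_α_one, kE_apply]; simp [kE]
lemma act_E_sE₁ : act X (Δ kE) (x ⊗ₜ[ℂ] sE₁) = rep X E x ⊗ₜ[ℂ] sE₁ := by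
  rw [act_Δ, spin_α_sE₁, kE_apply]; simp [kE]
lemma act_E_sE₂ : act X (Δ kE) (x ⊗ₜ[ℂ] sE₂) = rep X E x ⊗ₜ[ℂ] sE₂ + x ⊗ₜ[ℂ] sE₁ := by
  rw [act_Δ, spin_α_sE₂, kE_apply]; simp [kE]
lemma act_E_sE₁₂ : act X (Δ kE) (x ⊗ₜ[ℂ] sE₁₂) = rep X E x ⊗ₜ[ℂ] sE₁₂ := by
  rw [act_Δ, spin_α_sE₁₂, kE_apply]; simp [kE]
lemma act_F_one : act X (Δ kF) (x ⊗ₜ[ℂ] 1) = rep X F x ⊗ₜ[ℂ] 1 := by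
  rw [act_Δ, spin_α_one, kF_apply]; simp [kF]
lemma act_F_sE₁ : act X (Δ kF) (x ⊗ₜ[ℂ] sE₁) = rep X F x ⊗ₜ[ℂ] sE₁ + x ⊗ₜ[ℂ] sE₂ := by
  rw [act_Δ, spin_α_sE₁, kF_apply]; simp [kF]
lemma act_F_sE₂ : act X (Δ kF) (x ⊗ₜ[ℂ] sE₂) = rep X F x ⊗ₜ[ℂ] sE₂ := by
  rw [act_Δ, spin_α_sE₂, kF_apply]; simp [kF]
lemma act_F_sE₁₂ : act X (Δ kF) (x ⊗ₜ[ℂ] sE₁₂) = rep X F x ⊗ₜ[ℂ] sE₁₂ := by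
  rw [act_Δ, spin_α_sE₁₂, kF_apply]; simp [kF]
lemma act_H₁_one : act X (Δ kH₁) (x ⊗ₜ[ℂ] 1) =
    rep X H₁ x ⊗ₜ[ℂ] 1 - (3 / 2 : ℂ) • x ⊗ₜ[ℂ] 1 := by
  rw [act_Δ, spin_α_one, kH₁_apply]; simp [kH₁, sub_eq_add_neg, TensorProduct.tmul_neg]
lemma act_H₁_sE₁ : act X (Δ kH₁) (x ⊗ₜ[ℂ] sE₁) =
    rep X H₁ x ⊗ₜ[ℂ] sE₁ + (1 / 2 : ℂ) • x ⊗ₜ[ℂ] sE₁ := by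
  rw [act_Δ, spin_α_sE₁, kH₁_apply]; simp [kH₁]
lemma act_H₁_sE₂ : act X (Δ kH₁) (x ⊗ₜ[ℂ] sE₂) =
    rep X H₁ x ⊗ₜ[ℂ] sE₂ - (1 / 2 : ℂ) • x ⊗ₜ[ℂ] sE₂ := by
  rw [act_Δ, spin_α_sE₂, kH₁_apply]; simp [kH₁, sub_eq_add_neg, neg_div, TensorProduct.tmul_neg]
lemma act_H₁_sE₁₂ : act X (Δ kH₁) (x ⊗ₜ[ℂ] sE₁₂) =
    rep X H₁ x ⊗ₜ[ℂ] sE₁₂ + (3 / 2 : ℂ) • x ⊗ₜ[ℂ] sE₁₂ := by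
  rw [act_Δ, spin_α_sE₁₂, kH₁_apply]; simp [kH₁]
lemma act_H₂_one : act X (Δ kH₂) (x ⊗ₜ[ℂ] 1) =
    rep X H₂ x ⊗ₜ[ℂ] 1 - (3 / 2 : ℂ) • x ⊗ₜ[ℂ] 1 := by
  rw [act_Δ, spin_α_one, kH₂_apply]; simp [kH₂, sub_eq_add_neg, TensorProduct.tmul_neg]
lemma act_H₂_sE₁ : act X (Δ kH₂) (x ⊗ₜ[ℂ] sE₁) =
    rep X H₂ x ⊗ₜ[ℂ] sE₁ - (1 / 2 : ℂ) • x ⊗ₜ[ℂ] sE₁ := by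
  rw [act_Δ, spin_α_sE₁, kH₂_apply]; simp [kH₂, sub_eq_add_neg, neg_div, TensorProduct.tmul_neg]
lemma act_H₂_sE₂ : act X (Δ kH₂) (x ⊗ₜ[ℂ] sE₂) =
    rep X H₂ x ⊗ₜ[ℂ] sE₂ + (1 / 2 : ℂ) • x ⊗ₜ[ℂ] sE₂ := by
  rw [act_Δ, spin_α_sE₂, kH₂_apply]; simp [kH₂]
lemma act_H₂_sE₁₂ : act X (Δ kH₂) (x ⊗ₜ[ℂ] sE₁₂) =
    rep X H₂ x ⊗ₜ[ℂ] sE₁₂ + (3 / 2 : ℂ) • x ⊗ₜ[ℂ] sE₁₂ := by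
  rw [act_Δ, spin_α_sE₁₂, kH₂_apply]; simp [kH₂]

/-- `D²` preserves the exterior degree, and the only second order term in `𝔭` that survives is
`opT`; this holds in each of the four cases. -/
lemma act_D_sq_one : act X D (act X D (x ⊗ₜ[ℂ] 1)) =
    (-2 : ℂ) • (opT (rep X) x + rep X H₁ x + rep X H₂ x) ⊗ₜ[ℂ] (1 : S) := by
  have h1 := apply_apply (rep X) E₁ F₁ x
  have h2 := apply_apply (rep X) E₂ F₂ x
  have h3 := apply_apply (rep X) F₁ F₂ x
  rw [lie_E₁_F₁] at h1
  rw [lie_E₂_F₂] at h2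
  rw [lie_F₁_F₂, map_zero, LinearMap.zero_apply, add_zero] at h3
  rw [act_D_one, map_add, act_D_sE₁, act_D_sE₂, h1, h2, h3, opT_apply]
  simp only [TensorProduct.add_tmul]
  module

lemma act_D_sq_sE₁ : act X D (act X D (x ⊗ₜ[ℂ] sE₁)) =
    (-2 : ℂ) • (opT (rep X) x + rep X H₂ x) ⊗ₜ[ℂ] sE₁ + (2 : ℂ) • rep X E x ⊗ₜ[ℂ] sE₂ := by
  have h1 := apply_apply (rep X) E₁ F₂ x
  have h2 := apply_apply (rep X) E₂ F₂ x
  rw [lie_E₁_F₂] at h1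
  rw [lie_E₂_F₂] at h2
  rw [act_D_sE₁, map_sub, map_smul, act_D_one, act_D_sE₁₂, h1, h2, opT_apply]
  simp only [TensorProduct.add_tmul]
  module

lemma act_D_sq_sE₂ : act X D (act X D (x ⊗ₜ[ℂ] sE₂)) =
    (-2 : ℂ) • (opT (rep X) x + rep X H₁ x) ⊗ₜ[ℂ] sE₂ + (2 : ℂ) • rep X F x ⊗ₜ[ℂ] sE₁ := by
  have h1 := apply_apply (rep X) E₁ F₁ x
  have h2 := apply_apply (rep X) E₂ F₁ x
  rw [lie_E₁_F₁] at h1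
  rw [lie_E₂_F₁] at h2
  rw [act_D_sE₂, map_add, map_smul, act_D_one, act_D_sE₁₂, h1, h2, opT_apply]
  simp only [TensorProduct.add_tmul]
  module

lemma act_D_sq_sE₁₂ : act X D (act X D (x ⊗ₜ[ℂ] sE₁₂)) =
    (-2 : ℂ) • opT (rep X) x ⊗ₜ[ℂ] sE₁₂ := by
  have h1 := apply_apply (rep X) E₁ E₂ x
  rw [lie_E₁_E₂, map_zero, LinearMap.zero_apply, add_zero] at h1
  rw [act_D_sE₁₂, map_add, map_smul, map_smul, act_D_sE₁, act_D_sE₂, h1, opT_apply]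
  simp only [TensorProduct.add_tmul]
  module

omit [LieRingModule g X] [LieModule ℂ g X] in
lemma linearMap_ext {M : Type*} [AddCommGroup M] [Module ℂ M] {f f' : X ⊗[ℂ] S →ₗ[ℂ] M}
    (h₀ : ∀ x : X, f (x ⊗ₜ 1) = f' (x ⊗ₜ 1)) (h₁ : ∀ x : X, f (x ⊗ₜ sE₁) = f' (x ⊗ₜ sE₁))
    (h₂ : ∀ x : X, f (x ⊗ₜ sE₂) = f' (x ⊗ₜ sE₂))
    (h₃ : ∀ x : X, f (x ⊗ₜ sE₁₂) = f' (x ⊗ₜ sE₁₂)) : f = f' := by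
  refine TensorProduct.ext' fun x s => ?_
  have : LinearMap.eqLocus (f ∘ₗ TensorProduct.mk ℂ X S x) (f' ∘ₗ TensorProduct.mk ℂ X S x) = ⊤ :=
    S_span (h₀ x) (h₁ x) (h₂ x) (h₃ x)
  have hs : s ∈ LinearMap.eqLocus (f ∘ₗ TensorProduct.mk ℂ X S x)
    (f' ∘ₗ TensorProduct.mk ℂ X S x) := by rw [this]; trivial
  exact hs

/-- Twice the Casimir element of `𝔨_Δ`. -/
noncomputable def casΔ : A := (2 : ℂ) • (Δ kF * Δ kE) + (Δ kH₁ - Δ kH₂) +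
  (2 / 3 : ℂ) • (Δ kH₁ * Δ kH₁ + Δ kH₂ * Δ kH₂ - Δ kH₁ * Δ kH₂)

/-- The action of half the Casimir element of `𝔨`. -/
noncomputable def casK (x : X) : X := rep X F (rep X E x) + (1 / 2 : ℂ) • (rep X H₁ x - rep X H₂ x) +
  (1 / 3 : ℂ) • (rep X H₁ (rep X H₁ x) + rep X H₂ (rep X H₂ x) - rep X H₁ (rep X H₂ x))

/-- If the Casimir element of `𝔤` acts by a scalar, then `D²` is the Casimir element of `𝔨_Δ` up to
a scalar. -/
lemma act_D_sq {ω : ℂ}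
    (h : ∀ x : X, opT (rep X) x = ω • x - casK x - (1 / 2 : ℂ) • (rep X H₁ x + rep X H₂ x)) :
    act X D * act X D = act X casΔ - (2 * ω + 3 / 2) • 1 := by
  have e : act X casΔ = (2 : ℂ) • (act X (Δ kF) * act X (Δ kE)) +
      (act X (Δ kH₁) - act X (Δ kH₂)) + (2 / 3 : ℂ) • (act X (Δ kH₁) * act X (Δ kH₁) +
        act X (Δ kH₂) * act X (Δ kH₂) - act X (Δ kH₁) * act X (Δ kH₂)) := by
    simp only [casΔ, map_add, map_sub, map_smul, map_mul]
  rw [e]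
  apply linearMap_ext
  all_goals
    intro x
    simp only [Module.End.mul_apply, LinearMap.add_apply, LinearMap.sub_apply,
      LinearMap.smul_apply, Module.End.one_apply]
  · rw [act_D_sq_one, h]
    simp only [casK, act_E_one, act_F_one, act_H₁_one, act_H₂_one, map_sub, map_smul,
      TensorProduct.add_tmul, TensorProduct.sub_tmul, ← TensorProduct.smul_tmul']
    module
  · rw [act_D_sq_sE₁, h]
    simp only [casK, act_E_sE₁, act_F_sE₁, act_H₁_sE₁, act_H₂_sE₁, map_sub, map_add, map_smul,
      TensorProduct.add_tmul, TensorProduct.sub_tmul, ← TensorProduct.smul_tmul']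
    module
  · rw [act_D_sq_sE₂, h]
    simp only [casK, act_E_sE₂, act_F_sE₂, act_F_sE₁, act_H₁_sE₂, act_H₂_sE₂, map_sub, map_add,
      map_smul, TensorProduct.add_tmul, TensorProduct.sub_tmul, ← TensorProduct.smul_tmul']
    module
  · rw [act_D_sq_sE₁₂, h]
    simp only [casK, act_E_sE₁₂, act_F_sE₁₂, act_H₁_sE₁₂, act_H₂_sE₁₂, map_add, map_smul,
      TensorProduct.add_tmul, TensorProduct.sub_tmul, ← TensorProduct.smul_tmul']
    module

/-- An invariant need not commute with `D`. It does commute with `casΔ`, hence on `X ⊗ S` with `D²`,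
and this suffices for the stability of `ker D²`. -/
lemma casΔ_commute {b : A} (hb : b ∈ AK) : casΔ * b = b * casΔ := by
  have key : ∀ x y : k, Δ x * Δ y * b = b * (Δ x * Δ y) := fun x y => by
    rw [mul_assoc, Δ_commute hb, ← mul_assoc, Δ_commute hb, mul_assoc]
  simp only [casΔ, add_mul, sub_mul, mul_add, mul_sub, smul_mul_assoc, mul_smul_comm, key,
    Δ_commute hb]

end DiracSquare

/-! ### The kernel of `D²` and the space `H^D(X)` -/

section Kernel

variable {X : Type*} [AddCommGroup X] [Module ℂ X] [LieRingModule g X] [LieModule ℂ g X]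
variable {v : X} {a b : ℂ} {d : ℕ}

/-- `F₁E₁ + F₂E₂` is `𝔨`-invariant, so its scalar on a highest weight vector is valid on the whole
string. -/
lemma opT_F (x : X) : opT (rep X) (rep X F x) = rep X F (opT (rep X) x) := by
  have h1 := apply_apply (rep X) F F₁ (rep X E₁ x)
  have h2 := apply_apply (rep X) F F₂ (rep X E₂ x)
  have h3 := apply_apply (rep X) F E₁ x
  have h4 := apply_apply (rep X) F E₂ x
  rw [lie_F_F₁, h3, lie_F_E₁] at h1
  rw [lie_F_F₂, h4, lie_F_E₂] at h2
  rw [opT_apply, opT_apply, map_add, h1, h2]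
  simp only [map_neg, map_zero, map_add, LinearMap.neg_apply, LinearMap.zero_apply]
  module

lemma opT_F_pow (j : ℕ) (x : X) :
    opT (rep X) ((rep X F ^ j) x) = (rep X F ^ j) (opT (rep X) x) := by
  induction j with
  | zero => simp
  | succ j ih => rw [pow_succ', Module.End.mul_apply, opT_F, ih, Module.End.mul_apply]

/-- The Casimir element of `𝔤` acts on `X` by a scalar. -/
lemma IsBottom.opT_eq (h : IsBottom (rep X) v a b d) (htop : ⨆ N, strings (rep X) v N = ⊤) (x : X) :
    opT (rep X) x = (-1 + (a ^ 2 + b ^ 2 - a * b) / 3) • x - casK x -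
      (1 / 2 : ℂ) • (rep X H₁ x + rep X H₂ x) := by
  have hx : x ∈ ⨆ N, strings (rep X) v N := by rw [htop]; trivial
  induction hx using Submodule.iSup_induction' with
  | zero => simp [casK]
  | add x y _ _ hx hy =>
    simp only [casK, map_add] at hx hy ⊢
    rw [hx, hy]
    module
  | mem N x hx =>
    induction hx using Submodule.span_induction with
    | zero => simp [casK]
    | add x y _ _ hx hy =>
      simp only [casK, map_add] at hx hy ⊢
      rw [hx, hy]
      module
    | smul c x _ hx =>
      simp only [casK, map_smul] at hx ⊢
      rw [hx]
      module
    -- On `FʲE₁ⁿF₂ᵐv` both sides are explicit scalars and the claim is a polynomial identity; the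
    -- constant is its value at `v`.
    | mem x hx =>
      obtain ⟨j, n, m, -, rfl⟩ := hx
      have hw := h.hw_top n m
      rw [opT_F_pow, h.opT_top, map_smul, casK, hw.H₁_F_pow, hw.H₂_F_pow, map_smul, map_smul,
        map_smul, hw.H₁_F_pow, hw.H₂_F_pow]
      cases j with
      | zero =>
        rw [pow_zero, Module.End.one_apply, hw.map_E, map_zero]
        match_scalars
        ring
      | succ j =>
        rw [hw.E_F_pow, map_smul, ← Module.End.mul_apply, ← pow_succ']
        match_scalars
        ring

/-- The components of `D w₁` in degrees 0 and 2 are multiples of the two lower components of `v`. -/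
lemma act_D_w_one (h : IsBottom (rep X) v a b d) : act X D (w v d 1) = 0 := by
  have h1 := apply_apply (rep X) F E₁ v
  have h2 := apply_apply (rep X) F F₂ v
  have h3 := h.lower₁_eq
  have h4 := h.lower₂_eq
  rw [lie_F_E₁] at h1
  rw [lie_F_F₂, map_neg, LinearMap.neg_apply] at h2
  rw [lower₁_apply, sub_eq_zero, h1] at h3
  rw [lower₂_apply, h2] at h4
  have e1 : rep X E₁ (rep X F v) = (d : ℂ) • rep X E₂ v := by
    rw [← add_left_inj (rep X E₂ v), h3]; module
  have e2 : rep X F₂ (rep X F v) = -(d : ℂ) • rep X F₁ v := by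
    rw [← sub_eq_zero, ← h4]; module
  rw [w, map_sub, map_smul]
  simp only [pow_one, Nat.sub_self, pow_zero, Module.End.one_apply]
  rw [act_D_sE₁, act_D_sE₂, e1, e2]
  simp only [← TensorProduct.smul_tmul']
  push_cast
  module

lemma act_F_w (s : ℕ) (hs : 1 ≤ s) : act X (Δ kF) (w v d s) = w v d (s + 1) := by
  obtain ⟨s, rfl⟩ := Nat.exists_eq_add_of_le' hs
  rw [w, w, map_sub, map_smul, act_F_sE₁, act_F_sE₂]
  simp only [Nat.add_sub_cancel]
  rw [← Module.End.mul_apply (rep X F), ← Module.End.mul_apply (rep X F), ← pow_succ', ← pow_succ']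
  push_cast
  module

/-- The `w_s` form the `F_Δ`-string of `w₁`, and `D` commutes with `𝔨_Δ`. -/
lemma act_D_w (h : IsBottom (rep X) v a b d) (s : ℕ) (hs : 1 ≤ s) : act X D (w v d s) = 0 := by
  induction s, hs using Nat.le_induction with
  | base => exact act_D_w_one h
  | succ s hs ih =>
    rw [← act_F_w s hs, ← Module.End.mul_apply, ← map_mul, ← Δ_commute D_mem_AK, map_mul,
      Module.End.mul_apply, ih, map_zero]

/-- Here `s = d + 1` makes the coefficient `d - (s - 1)` of the second term zero, while the first
contains `F^(d+1) v`. -/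
lemma w_last (hF : (rep X F ^ (d + 1)) v = 0) : w v d (d + 1) = 0 := by
  rw [w, hF]
  simp

/-- The span of the vectors `w_s`. -/
def wSpan (v : X) (d : ℕ) : Submodule ℂ (X ⊗[ℂ] S) :=
  Submodule.span ℂ {z | ∃ s, 1 ≤ s ∧ s ≤ d ∧ z = w v d s}

/-- The span of the eigenvectors of `D²` with nonzero eigenvalue. -/
def nonzeroEigen (X : Type*) [AddCommGroup X] [Module ℂ X] [LieRingModule g X] [LieModule ℂ g X] :
    Submodule ℂ (X ⊗[ℂ] S) :=
  ⨆ (μ : ℂ) (_ : μ ≠ 0), Module.End.eigenspace (act X D * act X D) μ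

lemma mem_nonzeroEigen {μ : ℂ} (hμ : μ ≠ 0) {z : X ⊗[ℂ] S} (hz : act X D (act X D z) = μ • z) :
    z ∈ nonzeroEigen X := by
  have : Module.End.eigenspace (act X D * act X D) μ ≤ nonzeroEigen X :=
    le_iSup₂_of_le μ hμ le_rfl
  exact this (Module.End.mem_eigenspace_iff.2 hz)

lemma F_mem_nonzeroEigen {z : X ⊗[ℂ] S} (hz : z ∈ nonzeroEigen X) :
    act X (Δ kF) z ∈ nonzeroEigen X := by
  have : nonzeroEigen X ≤ (nonzeroEigen X).comap (act X (Δ kF)) := by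
    refine iSup₂_le fun μ hμ y hy => ?_
    refine mem_nonzeroEigen hμ ?_
    rw [Module.End.mem_eigenspace_iff] at hy
    have e : D * D * Δ kF = Δ kF * (D * D) := by
      rw [mul_assoc, ← Δ_commute D_mem_AK, ← mul_assoc, ← Δ_commute D_mem_AK, mul_assoc]
    rw [← Module.End.mul_apply, ← Module.End.mul_apply, ← map_mul, ← map_mul, e, map_mul,
      Module.End.mul_apply, map_mul, hy, map_smul]
  exact this hz

lemma F_mem_wSpan (hF : (rep X F ^ (d + 1)) v = 0) {z : X ⊗[ℂ] S} (hz : z ∈ wSpan v d) :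
    act X (Δ kF) z ∈ wSpan v d := by
  have : wSpan v d ≤ (wSpan v d).comap (act X (Δ kF)) := by
    refine Submodule.span_le.2 ?_
    rintro _ ⟨s, h1, h2, rfl⟩
    change act X (Δ kF) (w v d s) ∈ wSpan v d
    rw [act_F_w s h1]
    rcases h2.eq_or_lt with rfl | h3
    · rw [w_last hF]; exact Submodule.zero_mem _
    · exact Submodule.subset_span ⟨s + 1, by omega, h3, rfl⟩
  exact this hz

/-- Eigenspaces of `D²` for different eigenvalues are independent. -/
lemma disjoint_nonzeroEigen {z : X ⊗[ℂ] S} (hz : z ∈ nonzeroEigen X)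
    (h : act X D (act X D z) = 0) : z = 0 := by
  have := Module.End.eigenspaces_iSupIndep (act X D * act X D) 0
  refine Submodule.disjoint_def.1 this z ?_ hz
  rw [Module.End.mem_eigenspace_iff, zero_smul]
  exact h

lemma act_F_pow_sE₁ (y : X) (j : ℕ) : (act X (Δ kF) ^ (j + 1)) (y ⊗ₜ sE₁) =
    (rep X F ^ (j + 1)) y ⊗ₜ sE₁ + (j + 1 : ℂ) • (rep X F ^ j) y ⊗ₜ sE₂ := by
  induction j with
  | zero => simp [act_F_sE₁]
  | succ j ih =>
    rw [pow_succ', Module.End.mul_apply, ih, map_add, map_smul, act_F_sE₁, act_F_sE₂,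
      ← Module.End.mul_apply (rep X F), ← pow_succ', ← Module.End.mul_apply (rep X F), ← pow_succ']
    push_cast
    module

lemma act_F_pow_lower (y : X) (c : ℂ) (j : ℕ) :
    (act X (Δ kF) ^ j) (rep X F y ⊗ₜ sE₁ - c • y ⊗ₜ sE₂) =
      (rep X F ^ (j + 1)) y ⊗ₜ sE₁ - (c - j) • (rep X F ^ j) y ⊗ₜ sE₂ := by
  induction j with
  | zero => simp
  | succ j ih =>
    rw [pow_succ', Module.End.mul_apply, ih, map_sub, map_smul, act_F_sE₁, act_F_sE₂,
      ← Module.End.mul_apply (rep X F), ← pow_succ', ← Module.End.mul_apply (rep X F), ← pow_succ']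
    push_cast
    module

/-- If an `F_Δ`-stable subspace of `X ⊗ S` contains the highest weight vectors attached to the
`E₁ⁿ F₂ᵐ v`, it is everything. -/
lemma eq_top_of_hw_mem (htop : ⨆ N, strings (rep X) v N = ⊤)
    {N : Submodule ℂ (X ⊗[ℂ] S)} (hF : ∀ z ∈ N, act X (Δ kF) z ∈ N)
    (h₀ : ∀ n m, top (rep X) v n m ⊗ₜ[ℂ] (1 : S) ∈ N)
    (h₁ : ∀ n m, top (rep X) v n m ⊗ₜ[ℂ] sE₁ ∈ N)
    (h₂ : ∀ n m, rep X F (top (rep X) v n m) ⊗ₜ[ℂ] sE₁ -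
      (d + n + m : ℂ) • top (rep X) v n m ⊗ₜ[ℂ] sE₂ ∈ N)
    (h₃ : ∀ n m, top (rep X) v n m ⊗ₜ[ℂ] sE₁₂ ∈ N) : N = ⊤ := by
  have hFp : ∀ (j : ℕ), ∀ z ∈ N, (act X (Δ kF) ^ j) z ∈ N := by
    intro j
    induction j with
    | zero => simp
    | succ j ih =>
      intro z hz
      rw [pow_succ', Module.End.mul_apply]
      exact hF _ (ih z hz)
  have key : ∀ s : S, (∀ j n m, (rep X F ^ j) (top (rep X) v n m) ⊗ₜ[ℂ] s ∈ N) →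
      ∀ x : X, x ⊗ₜ[ℂ] s ∈ N := by
    intro s hs x
    have : ⨆ M, strings (rep X) v M ≤ N.comap ((TensorProduct.mk ℂ X S).flip s) := by
      refine iSup_le fun M => Submodule.span_le.2 ?_
      rintro _ ⟨j, n, m, -, rfl⟩
      exact hs j n m
    rw [htop] at this
    exact this (Submodule.mem_top (x := x))
  have hE₂ : ∀ j n m, (rep X F ^ j) (top (rep X) v n m) ⊗ₜ[ℂ] sE₂ ∈ N := by
    intro j n m
    have e1 := hFp (j + 1) _ (h₁ n m)
    have e2 := hFp j _ (h₂ n m)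
    rw [act_F_pow_sE₁] at e1
    rw [act_F_pow_lower] at e2
    -- The strings of `top ⊗ E₁` and of the lower vector have the same first term. Their second
    -- coefficients are `j + 1` and `j - (d + n + m)`, so the difference is `d + n + m + 1` times
    -- the required vector.
    rw [← N.smul_mem_iff (IsBottom.cast_ne_zero d n m)]
    convert N.sub_mem e1 e2 using 1
    module
  have hE₁ : ∀ j n m, (rep X F ^ j) (top (rep X) v n m) ⊗ₜ[ℂ] sE₁ ∈ N := by
    intro j n m
    cases j with
    | zero => exact h₁ n m
    | succ j =>
      have e1 := hFp (j + 1) _ (h₁ n m)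
      rw [act_F_pow_sE₁] at e1
      convert N.sub_mem e1 (N.smul_mem (j + 1 : ℂ) (hE₂ j n m)) using 1
      abel
  have hone : ∀ j n m, (rep X F ^ j) (top (rep X) v n m) ⊗ₜ[ℂ] (1 : S) ∈ N := by
    intro j n m
    induction j with
    | zero => exact h₀ n m
    | succ j ih =>
      rw [pow_succ', Module.End.mul_apply, ← act_F_one]
      exact hF _ ih
  have hE₁₂ : ∀ j n m, (rep X F ^ j) (top (rep X) v n m) ⊗ₜ[ℂ] sE₁₂ ∈ N := by
    intro j n m
    induction j with
    | zero => exact h₃ n m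
    | succ j ih =>
      rw [pow_succ', Module.End.mul_apply, ← act_F_sE₁₂]
      exact hF _ ih
  refine eq_top_iff.2 fun z _ => ?_
  induction z using TensorProduct.induction_on with
  | zero => exact N.zero_mem
  | add x y hx hy => exact N.add_mem (hx trivial) (hy trivial)
  | tmul x s =>
    have : N.comap (TensorProduct.mk ℂ X S x) = ⊤ :=
      S_span (key 1 hone x) (key _ hE₁ x) (key _ hE₂ x) (key _ hE₁₂ x)
    have hs : s ∈ N.comap (TensorProduct.mk ℂ X S x) := by rw [this]; trivial
    exact hs

lemma ofReal_ne_zero_of_neg {z : ℂ} {r : ℝ} (h : z = r) (hr : r < 0) : z ≠ 0 := by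
  rw [h]; exact_mod_cast hr.ne

/-- `X ⊗ S` is spanned by the `w_s` and the eigenvectors of `D²` with nonzero eigenvalue. -/
lemma nonzeroEigen_sup_wSpan {α β : ℝ} (h : IsBottom (rep X) v α β d) (hα : 1 ≤ α) (hβ : β ≤ -1)
    (htop : ⨆ N, strings (rep X) v N = ⊤) (hF : (rep X F ^ (d + 1)) v = 0) :
    nonzeroEigen X ⊔ wSpan v d = ⊤ := by
  have two : (-2 : ℂ) ≠ 0 := by norm_num
  refine eq_top_of_hw_mem (d := d) htop ?_ ?_ ?_ ?_ ?_
  · intro z hz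
    obtain ⟨x, hx, y, hy, rfl⟩ := Submodule.mem_sup.1 hz
    rw [map_add]
    exact Submodule.add_mem_sup (F_mem_nonzeroEigen hx) (F_mem_wSpan hF hy)
  · intro n m
    refine Submodule.mem_sup_left (mem_nonzeroEigen
      (μ := -2 * (-(α + 1) + m * β - m ^ 2 + m - n * α + n * m - n ^ 2 - 2 * n +
        (α + 2 * n - m) + (β + n - 2 * m))) ?_ ?_)
    · refine mul_ne_zero two (ofReal_ne_zero_of_neg (r := -(α + 1) + m * β - m ^ 2 + m - n * α +
        n * m - n ^ 2 - 2 * n + (α + 2 * n - m) + (β + n - 2 * m)) (by push_cast; ring) ?_)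
      -- The eigenvalue is `-2r` with `r < 0`: the terms `mβ` and `-nα` are at most `-m` and `-n`,
      -- and the form `-n² + nm - m²` is nonpositive.
      nlinarith [mul_nonneg (Nat.cast_nonneg (α := ℝ) m) (by linarith : 0 ≤ -1 - β),
        mul_nonneg (Nat.cast_nonneg (α := ℝ) n) (by linarith : 0 ≤ α - 1),
        sq_nonneg ((n : ℝ) - m), sq_nonneg (n : ℝ), sq_nonneg (m : ℝ),
        Nat.cast_nonneg (α := ℝ) m]
    · rw [act_D_sq_one, h.opT_top, (h.hw_top n m).map_H₁, (h.hw_top n m).map_H₂, ← add_smul,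
        ← add_smul, ← TensorProduct.smul_tmul', smul_smul]
  · intro n m
    refine Submodule.mem_sup_left (mem_nonzeroEigen
      (μ := -2 * (-(α + 1) + m * β - m ^ 2 + m - n * α + n * m - n ^ 2 - 2 * n +
        (β + n - 2 * m))) ?_ ?_)
    · refine mul_ne_zero two (ofReal_ne_zero_of_neg (r := -(α + 1) + m * β - m ^ 2 + m - n * α +
        n * m - n ^ 2 - 2 * n + (β + n - 2 * m)) (by push_cast; ring) ?_)
      nlinarith [mul_nonneg (Nat.cast_nonneg (α := ℝ) m) (by linarith : 0 ≤ -1 - β),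
        mul_nonneg (Nat.cast_nonneg (α := ℝ) n) (by linarith : 0 ≤ α - 1),
        sq_nonneg ((n : ℝ) - m), sq_nonneg (n : ℝ), sq_nonneg (m : ℝ),
        Nat.cast_nonneg (α := ℝ) m, Nat.cast_nonneg (α := ℝ) n]
    · rw [act_D_sq_sE₁, h.opT_top, (h.hw_top n m).map_H₂, (h.hw_top n m).map_E, ← add_smul,
        ← TensorProduct.smul_tmul', smul_smul, TensorProduct.zero_tmul, smul_zero, add_zero]
  · intro n m
    -- In this family the eigenvalue has no constant term, so it vanishes at `n = m = 0`, where the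
    -- vector is `w₁`, and is nonzero as soon as `n + m ≥ 1`.
    by_cases hnm : n = 0 ∧ m = 0
    · obtain ⟨rfl, rfl⟩ := hnm
      refine Submodule.mem_sup_right (Submodule.subset_span ⟨1, le_rfl, h.pos, ?_⟩)
      simp [w, top_zero_zero]
    · refine Submodule.mem_sup_left (mem_nonzeroEigen
        (μ := -2 * (m * β - m ^ 2 - n * α + n * m - n ^ 2)) ?_ ?_)
      · refine mul_ne_zero two (ofReal_ne_zero_of_neg
          (r := m * β - m ^ 2 - n * α + n * m - n ^ 2) (by push_cast; ring) ?_)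
        have : (1 : ℝ) ≤ n + m := by
          have : 1 ≤ n + m := by omega
          exact_mod_cast this
        nlinarith [mul_nonneg (Nat.cast_nonneg (α := ℝ) m) (by linarith : 0 ≤ -1 - β),
          mul_nonneg (Nat.cast_nonneg (α := ℝ) n) (by linarith : 0 ≤ α - 1),
          sq_nonneg ((n : ℝ) - m), sq_nonneg (n : ℝ), sq_nonneg (m : ℝ)]
      · have hw := h.hw_top n m
        have hsub := h.sub_eq
        have e1 := hw.E_F_pow 0
        have e2 := hw.H₂_F_pow 1
        rw [zero_add, pow_one, pow_zero, Module.End.one_apply] at e1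
        rw [pow_one] at e2
        rw [map_sub, map_sub, map_smul, map_smul, act_D_sq_sE₁, act_D_sq_sE₂, opT_F, h.opT_top,
          e1, e2, hw.map_H₁, map_smul]
        simp only [TensorProduct.add_tmul, ← TensorProduct.smul_tmul', ← hsub]
        push_cast
        match_scalars <;> ring
  · intro n m
    refine Submodule.mem_sup_left (mem_nonzeroEigen
      (μ := -2 * (-(α + 1) + m * β - m ^ 2 + m - n * α + n * m - n ^ 2 - 2 * n)) ?_ ?_)
    · refine mul_ne_zero two (ofReal_ne_zero_of_neg (r := -(α + 1) + m * β - m ^ 2 + m - n * α +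
        n * m - n ^ 2 - 2 * n) (by push_cast; ring) ?_)
      nlinarith [mul_nonneg (Nat.cast_nonneg (α := ℝ) m) (by linarith : 0 ≤ -1 - β),
        mul_nonneg (Nat.cast_nonneg (α := ℝ) n) (by linarith : 0 ≤ α - 1),
        sq_nonneg ((n : ℝ) - m), sq_nonneg (n : ℝ), sq_nonneg (m : ℝ),
        Nat.cast_nonneg (α := ℝ) m, Nat.cast_nonneg (α := ℝ) n]
    · rw [act_D_sq_sE₁₂, h.opT_top, ← TensorProduct.smul_tmul', smul_smul]

lemma act_D_of_mem_wSpan (h : IsBottom (rep X) v a b d) {z : X ⊗[ℂ] S} (hz : z ∈ wSpan v d) :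
    act X D z = 0 := by
  have : wSpan v d ≤ LinearMap.ker (act X D) := by
    refine Submodule.span_le.2 ?_
    rintro _ ⟨s, h1, -, rfl⟩
    exact act_D_w h s h1
  exact this hz

lemma D_mem_I : D ∈ I :=
  Submodule.subset_span ⟨1, AK.one_mem, 1, AK.one_mem, by rw [one_mul, mul_one]⟩

/-- The Dirac cohomology is the span of the `w_s`. -/
theorem HD_eq_wSpan {α β : ℝ} (h : IsBottom (rep X) v α β d) (hα : 1 ≤ α) (hβ : β ≤ -1)
    (htop : ⨆ N, strings (rep X) v N = ⊤) (hF : (rep X F ^ (d + 1)) v = 0) :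
    HD X = wSpan v d := by
  have hker : ∀ z, act X D (act X D z) = 0 → z ∈ wSpan v d := by
    intro z hz
    have hz' : z ∈ nonzeroEigen X ⊔ wSpan v d := by
      rw [nonzeroEigen_sup_wSpan h hα hβ htop hF]; trivial
    obtain ⟨x, hx, y, hy, rfl⟩ := Submodule.mem_sup.1 hz'
    rw [map_add, map_add, act_D_of_mem_wSpan h hy, map_zero, add_zero] at hz
    rw [disjoint_nonzeroEigen hx hz, zero_add]
    exact hy
  apply le_antisymm
  · intro z hz
    refine hker z ?_
    rw [show act X D z = 0 from hz D D_mem_I, map_zero]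
  · intro z hz r hr
    have : I ≤ LinearMap.ker (LinearMap.applyₗ z ∘ₗ (act X).toLinearMap) := by
      refine Submodule.span_le.2 ?_
      rintro _ ⟨r, hr, s, hs, rfl⟩
      change act X (r * D * s) z = 0
      -- The invariant `s` moves `z` within `ker D²`, by the Casimir formula for `D²`. Since `ker
      -- D²` is the span of the `w_s`, one further `D` kills the result.
      have h1 : act X D (act X D (act X s z)) = 0 := by
        have e := act_D_sq (h.opT_eq htop)
        have e1 : ∀ y, act X D (act X D y) = _ := fun y => LinearMap.congr_fun e y
        have e2 := e1 z
        rw [act_D_of_mem_wSpan h hz, map_zero] at e2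
        rw [e1]
        simp only [LinearMap.sub_apply, LinearMap.smul_apply, Module.End.one_apply] at e2 ⊢
        rw [← Module.End.mul_apply, ← map_mul, casΔ_commute hs, map_mul, Module.End.mul_apply,
          ← map_smul, ← map_sub, ← e2, map_zero]
      rw [map_mul, map_mul, Module.End.mul_apply, Module.End.mul_apply,
        act_D_of_mem_wSpan h (hker _ h1), map_zero]
    exact this hr

lemma mul_mem_I {r b : A} (hr : r ∈ I) (hb : b ∈ AK) : r * b ∈ I := by
  have : I ≤ I.comap (LinearMap.mulRight ℂ b) := by
    refine Submodule.span_le.2 ?_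
    rintro _ ⟨r, hr, s, hs, rfl⟩
    exact Submodule.subset_span ⟨r, hr, s * b, AK.mul_mem hs hb, by
      rw [LinearMap.mulRight_apply, mul_assoc]⟩
  exact this hr

lemma I_le_AK : I ≤ Subalgebra.toSubmodule AK := by
  refine Submodule.span_le.2 ?_
  rintro _ ⟨r, hr, s, hs, rfl⟩
  exact AK.mul_mem (AK.mul_mem hr D_mem_AK) hs

/-- The Dirac cohomology is stable under `ℬ`. -/
theorem act_mem_HD {b : A} (hb : b ∈ BB) {y : X ⊗[ℂ] S} (hy : y ∈ HD X) : act X b y ∈ HD X := by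
  induction hb using Algebra.adjoin_induction generalizing y with
  | mem b hb =>
    rcases hb with ⟨x, rfl⟩ | hb
    · intro r hr
      rw [← Module.End.mul_apply, ← map_mul, ← Δ_commute (I_le_AK hr), map_mul,
        Module.End.mul_apply, hy r hr, map_zero]
    · intro r hr
      rw [← Module.End.mul_apply, ← map_mul]
      exact hy _ (mul_mem_I hr hb)
  | algebraMap c =>
    rw [AlgHom.commutes]
    exact (HD X).smul_mem c hy
  | add b c _ _ hb hc =>
    rw [map_add]
    exact (HD X).add_mem (hb hy) (hc hy)
  | mul b c _ _ hb hc =>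
    rw [map_mul]
    exact hb (hc hy)

end Kernel

/-! ### Nonholomorphic discrete series -/

section LowerHW

variable {V : Type*} [AddCommGroup V] [Module ℂ V] {φ : g →ₗ⁅ℂ⁆ Module.End ℂ V} {a b : ℂ} {y : V}

/-- The constant `a - b + 1` is exactly what makes `E` kill the vector: `E F E₁ y` and `E E₂ y` are
both multiples of `E₁ y`. -/
lemma IsHW.lower₁ (h : IsHW φ a b y) : IsHW φ (a + 1) (b + 2) (lower₁ φ (a - b) y) where
  map_E := by
    have h1 := apply_apply φ E F (φ E₁ y)
    have h2 := apply_apply φ E E₁ y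
    have h3 := apply_apply φ E E₂ y
    have h4 := h.apply_E₁.map_H₁
    have h5 := h.apply_E₁.map_H₂
    rw [lie_E_E₁, h.map_E] at h2
    rw [lie_E_E₂, h.map_E] at h3
    rw [lie_E_F, map_sub, LinearMap.sub_apply, h4, h5] at h1
    simp only [map_zero, LinearMap.zero_apply, add_zero, zero_add] at h2 h3
    rw [h2, map_zero, zero_add] at h1
    rw [lower₁_apply, map_sub, map_smul, h1, h3]
    module
  map_H₁ := by
    have h1 := apply_apply φ H₁ F (φ E₁ y)
    have h3 := apply_apply φ H₁ E₂ y
    rw [lie_H₁_F, h.apply_E₁.map_H₁, map_neg, LinearMap.neg_apply, map_smul] at h1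
    rw [lie_H₁_E₂, h.map_H₁, map_smul] at h3
    rw [lower₁_apply, map_sub, map_smul, h1, h3]
    module
  map_H₂ := by
    have h1 := apply_apply φ H₂ F (φ E₁ y)
    have h3 := apply_apply φ H₂ E₂ y
    rw [lie_H₂_F, h.apply_E₁.map_H₂, map_smul] at h1
    rw [lie_H₂_E₂, h.map_H₂, map_smul, map_smul, LinearMap.smul_apply] at h3
    rw [lower₁_apply, map_sub, map_smul, h1, h3]
    module

lemma IsHW.lower₂ (h : IsHW φ a b y) : IsHW φ (a - 2) (b - 1) (lower₂ φ (a - b) y) where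
  map_E := by
    have h1 := apply_apply φ E F (φ F₂ y)
    have h2 := apply_apply φ E F₂ y
    have h3 := apply_apply φ E F₁ y
    have h4 := h.apply_F₂.map_H₁
    have h5 := h.apply_F₂.map_H₂
    rw [lie_E_F₂, h.map_E] at h2
    rw [lie_E_F₁, h.map_E] at h3
    rw [lie_E_F, map_sub, LinearMap.sub_apply, h4, h5] at h1
    simp only [map_zero, LinearMap.zero_apply, add_zero, zero_add, map_neg,
      LinearMap.neg_apply] at h2 h3
    rw [h2, map_zero, zero_add] at h1
    rw [lower₂_apply, map_add, map_smul, h1, h3]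
    module
  map_H₁ := by
    have h1 := apply_apply φ H₁ F (φ F₂ y)
    have h3 := apply_apply φ H₁ F₁ y
    rw [lie_H₁_F, h.apply_F₂.map_H₁, map_neg, LinearMap.neg_apply, map_smul] at h1
    rw [lie_H₁_F₁, h.map_H₁, map_smul, map_smul, LinearMap.smul_apply] at h3
    rw [lower₂_apply, map_add, map_smul, h1, h3]
    module
  map_H₂ := by
    have h1 := apply_apply φ H₂ F (φ F₂ y)
    have h3 := apply_apply φ H₂ F₁ y
    rw [lie_H₂_F, h.apply_F₂.map_H₂, map_smul] at h1
    rw [lie_H₂_F₁, h.map_H₂, map_smul, map_neg, LinearMap.neg_apply] at h3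
    rw [lower₂_apply, map_add, map_smul, h1, h3]
    module

end LowerHW

/-! ### Minimality, unitarity and irreducibility put to use -/

section DiscreteSeries

variable {X : Type*} [AddCommGroup X] [Module ℂ X] [LieRingModule g X] [LieModule ℂ g X]
variable {ρ : Representation ℂ K X} {q : Fin 3 → ℝ} {v : X} {d : ℕ}

lemma H₁_eq : H₁ = (2 : ℂ) • h₁ + h₂ := by
  rw [h₁, h₂]; module

lemma H₂_eq : H₂ = h₁ + (2 : ℂ) • h₂ := by
  rw [h₁, h₂]; module

lemma IsHighestWeightVector.isHW (hv : IsHighestWeightVector q v)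
    (hq : q 0 + q 1 + q 2 = 0) :
    IsHW (rep X) ((q 0 - q 2 : ℝ) : ℂ) ((q 1 - q 2 : ℝ) : ℂ) v where
  map_E := hv.2.1
  map_H₁ := by
    change ⁅H₁, v⁆ = _
    rw [H₁_eq, add_lie, smul_lie, hv.2.2.1, hv.2.2.2, show q 0 - q 2 = 2 * q 0 + q 1 by linarith]
    push_cast
    module
  map_H₂ := by
    change ⁅H₂, v⁆ = _
    rw [H₂_eq, add_lie, smul_lie, hv.2.2.1, hv.2.2.2, show q 1 - q 2 = q 0 + 2 * q 1 by linarith]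
    push_cast
    module

lemma isHighestWeightVector_of_isHW {y : X} {a b : ℂ} (h : IsHW (rep X) a b y) (hy : y ≠ 0)
    (h0 : 3 * (q 0 : ℂ) = 2 * a - b) (h1 : 3 * (q 1 : ℂ) = 2 * b - a) :
    IsHighestWeightVector q y := by
  have e1 : ⁅H₁, y⁆ = a • y := h.map_H₁
  have e2 : ⁅H₂, y⁆ = b • y := h.map_H₂
  refine ⟨hy, h.map_E, ?_, ?_⟩
  · rw [h₁, smul_lie, sub_lie, smul_lie, e1, e2, smul_smul, ← sub_smul, smul_smul, ← h0]
    congr 1; ring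
  · rw [h₂, smul_lie, sub_lie, smul_lie, e1, e2, smul_smul, ← sub_smul, smul_smul, ← h1]
    congr 1; ring

/-- In a unitary module `F` is adjoint to `E`. -/
lemma exists_form (hX : IsUnitary (X := X) ρ) : ∃ φ : X →ₗ⋆[ℂ] X →ₗ[ℂ] ℂ,
    (∀ x, φ x x = 0 → x = 0) ∧ ∀ x y, φ (rep X F x) y = φ x (rep X E y) := by
  obtain ⟨φ, -, hpos, -, hskew⟩ := hX
  refine ⟨φ, fun x hx => ?_, fun x y => ?_⟩
  · by_contra h
    have := hpos x h
    rw [hx] at this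
    exact lt_irrefl _ this
  -- `E - F` and `i(E + F)` belong to `𝔰𝔲(2,1)`; combining their skew-Hermitian relations isolates
  -- the adjoint of `F`.
  · have m1 : InG0 (E - F) := by
      rw [InG0, AddSubgroupClass.coe_sub, val_E, val_F]
      ext i j
      fin_cases i <;> fin_cases j <;> simp [Gam, Matrix.mul_apply, Matrix.diagonal]
    have m2 : InG0 (Complex.I • (E + F)) := by
      rw [InG0, SetLike.val_smul, AddMemClass.coe_add, val_E, val_F]
      ext i j
      fin_cases i <;> fin_cases j <;> simp [Gam, Matrix.mul_apply, Matrix.diagonal]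
    have e1 := hskew _ m1 x y
    have e2 := hskew _ m2 x y
    simp only [sub_lie, smul_lie, add_lie, map_sub, map_add, LinearMap.map_smulₛₗ, LinearMap.sub_apply,
      LinearMap.add_apply, LinearMap.smul_apply, Complex.conj_I, smul_eq_mul, RingHom.id_apply] at e1 e2
    change φ ⁅F, x⁆ y = φ x ⁅E, y⁆
    have e3 : φ ⁅E, x⁆ y + φ ⁅F, x⁆ y = φ x ⁅E, y⁆ + φ x ⁅F, y⁆ := by
      refine mul_left_cancel₀ Complex.I_ne_zero ?_
      linear_combination -e2
    linear_combination (e3 - e1) / 2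

namespace IsNonholomorphicDiscreteSeries

variable (hX : IsNonholomorphicDiscreteSeries (X := X) ρ q)
include hX

omit [LieModule ℂ g X] in
-- Here `ρ_K` and `ρ_P` coincide, so the chamber condition bears on `q` itself.
lemma gt_and_gt : q 0 > q 2 ∧ q 2 > q 1 := by
  have h := hX.chamber
  have e : rhoK = rhoP := by
    ext i
    fin_cases i <;> norm_num [rhoK, rhoP]
  rw [e, add_sub_cancel_right] at h
  exact h.2

/-- The differences are integers: `q₀ - q₂ = 3q₀ - (q₀ - q₁)`, and similarly for `q₁ - q₂`. Strict
inequalities therefore improve by one. -/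
lemma one_le : 1 ≤ q 0 - q 2 ∧ q 1 - q 2 ≤ -1 := by
  obtain ⟨h1, h2⟩ := hX.gt_and_gt
  obtain ⟨hs, ⟨A, hA⟩, -, n, hn⟩ := hX.minimalKType.1.1
  have e0 : q 0 - q 2 = ((A - n : ℤ) : ℝ) := by push_cast; linarith
  have e1 : q 1 - q 2 = ((A - 2 * n : ℤ) : ℝ) := by push_cast; linarith
  rw [e0, e1]
  have g0 : (0 : ℝ) < ((A - n : ℤ) : ℝ) := by rw [← e0]; linarith
  have g1 : ((A - 2 * n : ℤ) : ℝ) < 0 := by rw [← e1]; linarith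
  rw [Int.cast_pos] at g0
  rw [Int.cast_lt_zero] at g1
  exact ⟨by exact_mod_cast g0, by exact_mod_cast Int.le_sub_one_of_lt g1⟩

/-- A nonzero lower component would be a highest weight vector of a `K`-type with smaller `‖· +
2ρ_K‖`. The square of this norm would change by `2(q₁ - q₂) < 0` for `lower₁` and by `2(q₂ - q₀) <
0` for `lower₂`. -/
lemma lower_eq (hd : (d : ℝ) = q 0 - q 1) (hv : IsHighestWeightVector q v) :
    lower₁ (rep X) d v = 0 ∧ lower₂ (rep X) d v = 0 := by
  obtain ⟨h1, h2⟩ := hX.one_le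
  obtain ⟨hs, ⟨A, hA⟩, ⟨B, hB⟩, n, hn⟩ := hX.minimalKType.1.1
  have hw := hv.isHW hs
  have hdc : (d : ℂ) = ((q 0 - q 2 : ℝ) : ℂ) - ((q 1 - q 2 : ℝ) : ℂ) := by
    rw [← Complex.ofReal_sub, sub_sub_sub_cancel_right, ← hd, Complex.ofReal_natCast]
  have hd1 : 1 ≤ d := by
    have : (1 : ℝ) ≤ d := by linarith
    exact_mod_cast this
  -- Writing `d = e + 1` makes the lowered type dominant, with difference `e ≥ 0`.
  obtain ⟨e, rfl⟩ := Nat.exists_eq_add_of_le' hd1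
  rw [hdc]
  have hq2 : (q 2 : ℂ) = -q 0 - q 1 := by
    have : q 2 = -q 0 - q 1 := by linarith
    exact_mod_cast this
  push_cast at hd
  constructor
  · by_contra hne
    have key := hX.minimalKType.2 ![q 0, q 1 + 1, q 2 - 1] ⟨⟨?_, ⟨A, hA⟩, ⟨B + 3, ?_⟩, e, ?_⟩, _,
      isHighestWeightVector_of_isHW hw.lower₁ hne ?_ ?_⟩
    · simp [Fin.sum_univ_three, rhoK] at key
      nlinarith
    · change q 0 + (q 1 + 1) + (q 2 - 1) = 0
      linarith
    · change q 1 + 1 = _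
      push_cast; linarith
    · change q 0 - (q 1 + 1) = _
      linarith
    · change 3 * (q 0 : ℂ) = _
      push_cast; rw [hq2]; ring
    · change 3 * ((q 1 + 1 : ℝ) : ℂ) = _
      push_cast; rw [hq2]; ring
  · by_contra hne
    have key := hX.minimalKType.2 ![q 0 - 1, q 1, q 2 + 1] ⟨⟨?_, ⟨A - 3, ?_⟩, ⟨B, hB⟩, e, ?_⟩, _,
      isHighestWeightVector_of_isHW hw.lower₂ hne ?_ ?_⟩
    · simp [Fin.sum_univ_three, rhoK] at key
      nlinarith
    · change q 0 - 1 + q 1 + (q 2 + 1) = 0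
      linarith
    · change q 0 - 1 = _
      push_cast; linarith
    · change q 0 - 1 - q 1 = _
      linarith
    · change 3 * ((q 0 - 1 : ℝ) : ℂ) = _
      push_cast; rw [hq2]; ring
    · change 3 * (q 1 : ℂ) = _
      push_cast; rw [hq2]; ring

lemma isBottom (hd : (d : ℝ) = q 0 - q 1) (hv : IsHighestWeightVector q v) :
    IsBottom (rep X) v ((q 0 - q 2 : ℝ) : ℂ) ((q 1 - q 2 : ℝ) : ℂ) d where
  hw := hv.isHW hX.minimalKType.1.1.1
  sub_eq := by
    rw [← Complex.ofReal_sub, sub_sub_sub_cancel_right, ← hd, Complex.ofReal_natCast]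
  pos := by
    obtain ⟨h1, h2⟩ := hX.one_le
    have : (0 : ℝ) < d := by linarith
    exact_mod_cast this
  lower₁_eq := (hX.lower_eq hd hv).1
  lower₂_eq := (hX.lower_eq hd hv).2

/-- Since `F` is adjoint to `E`, the squared norm of `F^(d+1) v` is the pairing of `Fᵈ v` with `E
F^(d+1) v`, and the latter is zero by the string formula. -/
lemma F_pow_eq_zero (hd : (d : ℝ) = q 0 - q 1) (hv : IsHighestWeightVector q v) :
    (rep X F ^ (d + 1)) v = 0 := by
  obtain ⟨φ, h0, hφ⟩ := exists_form hX.unitary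
  have hb := hX.isBottom hd hv
  have hE := hb.hw.E_F_pow d
  rw [hb.sub_eq, sub_self, mul_zero, zero_smul] at hE
  refine h0 _ ?_
  nth_rewrite 1 [pow_succ']
  rw [Module.End.mul_apply, hφ, hE, map_zero]

lemma iSup_strings_eq_top (hd : (d : ℝ) = q 0 - q 1) (hv : IsHighestWeightVector q v) :
    ⨆ N, strings (rep X) v N = ⊤ := by
  have hb := hX.isBottom hd hv
  let N : LieSubmodule ℂ g X :=
    { (⨆ N, strings (rep X) v N : Submodule ℂ X) with
      lie_mem := fun {x y} hy => hb.apply_mem_iSup x hy }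
  have hvN : v ∈ N := Submodule.mem_iSup_of_mem (p := fun N => strings (rep X) v N) 1
    (top_mem (n := 0) (m := 0) (by omega))
  have := hX.irreducible
  have hN : N = ⊤ := by
    rcases eq_bot_or_eq_top N with h | h
    · rw [h] at hvN
      exact absurd ((LieSubmodule.mem_bot v).1 hvN) hv.1
    · exact h
  have : (N : Submodule ℂ X) = ⊤ := by rw [hN, LieSubmodule.top_toSubmodule]
  exact this

lemma HD_eq (hd : (d : ℝ) = q 0 - q 1) (hv : IsHighestWeightVector q v) : HD X = wSpan v d :=
  HD_eq_wSpan (hX.isBottom hd hv) hX.one_le.1 hX.one_le.2 (hX.iSup_strings_eq_top hd hv)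
    (hX.F_pow_eq_zero hd hv)

end IsNonholomorphicDiscreteSeries

end DiscreteSeries

/-! ### Modules over `𝒜` -/

section AModule

variable {V : Type*} [AddCommGroup V] [Module ℂ V] (L : A →ₐ[ℂ] Module.End ℂ V)

/-- The action of `U(𝔤)` on an `𝒜`-module. -/
noncomputable def envAct : Ug →ₐ[ℂ] Module.End ℂ V := L.comp Algebra.TensorProduct.includeLeft

/-- The action of `𝔤` on an `𝒜`-module. -/
noncomputable def lieAct : g →ₗ⁅ℂ⁆ Module.End ℂ V :=
  (envAct L).toLieHom.comp (UniversalEnvelopingAlgebra.ι ℂ)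

/-- The action of `C(𝔭)` on an `𝒜`-module. -/
noncomputable def clAct : Cl →ₐ[ℂ] Module.End ℂ V := L.comp Algebra.TensorProduct.includeRight

lemma envAct_u (x : g) : envAct L (u x) = lieAct L x := rfl

lemma apply_tmul (a : Ug) (c : Cl) (y : V) : L (a ⊗ₜ[ℂ] c) y = clAct L c (envAct L a y) := by
  change _ = L (1 ⊗ₜ c) (L (a ⊗ₜ 1) y)
  rw [← Module.End.mul_apply, ← map_mul, Algebra.TensorProduct.tmul_mul_tmul, one_mul, mul_one]

lemma apply_u_tmul_one (x : g) (y : V) : L (u x ⊗ₜ[ℂ] 1) y = lieAct L x y := rfl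

lemma envAct_clAct (a : Ug) (c : Cl) (y : V) :
    envAct L a (clAct L c y) = clAct L c (envAct L a y) := by
  rw [← apply_tmul]
  change L (a ⊗ₜ 1) (L (1 ⊗ₜ c) y) = _
  rw [← Module.End.mul_apply, ← map_mul, Algebra.TensorProduct.tmul_mul_tmul, one_mul, mul_one]

lemma lieAct_clAct (x : g) (c : Cl) (y : V) :
    lieAct L x (clAct L c y) = clAct L c (lieAct L x y) := envAct_clAct L (u x) c y

lemma clAct_mul (c c' : Cl) (y : V) : clAct L (c * c') y = clAct L c (clAct L c' y) := by
  rw [map_mul, Module.End.mul_apply]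

lemma lieAct_pow_clAct (x : g) (n : ℕ) (c : Cl) (y : V) :
    (lieAct L x ^ n) (clAct L c y) = clAct L c ((lieAct L x ^ n) y) := by
  rw [← envAct_u, ← map_pow, envAct_clAct]

lemma apply_Δ (x : k) (y : V) : L (Δ x) y = lieAct L x.1 y + clAct L (α x) y := by
  rw [Δ, map_add]; rfl

lemma Δ_clAct (x : k) (y : p) (z : V) :
    L (Δ x) (clAct L (cl y) z) = clAct L (cl y) (L (Δ x) z) + clAct L (cAd x y) z := by
  change L (Δ x) (L (1 ⊗ₜ cl y) z) = L (1 ⊗ₜ cl y) (L (Δ x) z) + L (1 ⊗ₜ cAd x y) z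
  rw [← Module.End.mul_apply, ← map_mul, Δ_mul_cl, map_add, map_mul]
  rfl

/-- The subspace of an `𝒜`-module generated from `U` by the action of `E₁, E₂ ∈ C(𝔭)`. -/
noncomputable def spinSpan (U : Submodule ℂ V) : Submodule ℂ V :=
  U ⊔ U.map (clAct L cE₁) ⊔ U.map (clAct L cE₂) ⊔ U.map (clAct L (cE₁ * cE₂))

variable {L}
variable {U N : Submodule ℂ V}

lemma mem_spinSpan {y : V} (hy : y ∈ U) : y ∈ spinSpan L U ∧ clAct L cE₁ y ∈ spinSpan L U ∧
    clAct L cE₂ y ∈ spinSpan L U ∧ clAct L (cE₁ * cE₂) y ∈ spinSpan L U :=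
  ⟨Submodule.mem_sup_left (Submodule.mem_sup_left (Submodule.mem_sup_left hy)),
    Submodule.mem_sup_left (Submodule.mem_sup_left (Submodule.mem_sup_right ⟨y, hy, rfl⟩)),
    Submodule.mem_sup_left (Submodule.mem_sup_right ⟨y, hy, rfl⟩),
    Submodule.mem_sup_right ⟨y, hy, rfl⟩⟩

lemma spinSpan_le (h : ∀ y ∈ U, y ∈ N ∧ clAct L cE₁ y ∈ N ∧ clAct L cE₂ y ∈ N ∧
    clAct L (cE₁ * cE₂) y ∈ N) : spinSpan L U ≤ N := by
  refine sup_le (sup_le (sup_le (fun y hy => (h y hy).1) ?_) ?_) ?_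
  · exact Submodule.map_le_iff_le_comap.2 fun y hy => (h y hy).2.1
  · exact Submodule.map_le_iff_le_comap.2 fun y hy => (h y hy).2.2.1
  · exact Submodule.map_le_iff_le_comap.2 fun y hy => (h y hy).2.2.2

/-- If `U` is `𝔤`-stable and killed by `F₁, F₂ ∈ C(𝔭)`, then `spinSpan L U` is `𝒜`-stable. -/
lemma apply_mem_spinSpan (hU : ∀ (x : g), ∀ y ∈ U, lieAct L x y ∈ U)
    (hF₁ : ∀ y ∈ U, clAct L cF₁ y = 0) (hF₂ : ∀ y ∈ U, clAct L cF₂ y = 0)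
    (r : A) {y : V} (hy : y ∈ spinSpan L U) : L r y ∈ spinSpan L U := by
  let R : Subalgebra ℂ A :=
    { carrier := {r | ∀ y ∈ spinSpan L U, L r y ∈ spinSpan L U}
      mul_mem' := fun {r s} hr hs y hy => by
        rw [map_mul]
        exact hr _ (hs _ hy)
      add_mem' := fun {r s} hr hs y hy => by
        rw [map_add]
        exact Submodule.add_mem _ (hr _ hy) (hs _ hy)
      algebraMap_mem' := fun c y hy => by
        rw [AlgHom.commutes]
        exact Submodule.smul_mem _ c hy }
  have hg : ∀ x : g, u x ⊗ₜ[ℂ] (1 : Cl) ∈ R := by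
    intro x
    refine spinSpan_le (N := (spinSpan L U).comap (L (u x ⊗ₜ 1))) fun y hy => ?_
    simp only [Submodule.mem_comap, apply_u_tmul_one, lieAct_clAct]
    exact mem_spinSpan (hU x y hy)
  -- Clifford elements commute with `𝔤`, so stability under `c` is a matter of reordering its
  -- products with `1, E₁, E₂, E₁E₂`.
  have hc : ∀ c : Cl, (∀ y ∈ U, clAct L c y ∈ spinSpan L U ∧ clAct L (c * cE₁) y ∈ spinSpan L U ∧
      clAct L (c * cE₂) y ∈ spinSpan L U ∧ clAct L (c * (cE₁ * cE₂)) y ∈ spinSpan L U) →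
      (1 : Ug) ⊗ₜ[ℂ] c ∈ R := by
    intro c h
    refine spinSpan_le (N := (spinSpan L U).comap (clAct L c)) fun y hy => ?_
    simp only [Submodule.mem_comap, ← clAct_mul]
    exact h y hy
  have hcE₁ : (1 : Ug) ⊗ₜ[ℂ] cE₁ ∈ R := by
    refine hc _ fun y hy => ?_
    obtain ⟨m0, m1, m2, m3⟩ := mem_spinSpan (L := L) hy
    rw [cE₁_sq, cE₁_sq_mul, map_zero]
    exact ⟨m1, Submodule.zero_mem _, m3, Submodule.zero_mem _⟩
  have hcE₂ : (1 : Ug) ⊗ₜ[ℂ] cE₂ ∈ R := by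
    refine hc _ fun y hy => ?_
    obtain ⟨m0, m1, m2, m3⟩ := mem_spinSpan (L := L) hy
    rw [cE₂_cE₁_mul, cE₂_cE₁, cE₂_sq, mul_zero, neg_zero, map_zero, map_neg]
    exact ⟨m2, Submodule.neg_mem _ m3, Submodule.zero_mem _, Submodule.zero_mem _⟩
  have hcF₁ : (1 : Ug) ⊗ₜ[ℂ] cF₁ ∈ R := by
    refine hc _ fun y hy => ?_
    obtain ⟨m0, m1, m2, m3⟩ := mem_spinSpan (L := L) hy
    rw [cF₁_cE₁_mul, cF₁_cE₁, cF₁_cE₂, mul_neg]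
    simp only [map_sub, map_neg, map_smul, LinearMap.sub_apply, LinearMap.neg_apply,
      LinearMap.smul_apply, clAct_mul, hF₁ y hy, map_zero, map_one, Module.End.one_apply, neg_zero,
      zero_sub]
    exact ⟨Submodule.zero_mem _, Submodule.neg_mem _ (Submodule.smul_mem _ _ m0),
      Submodule.zero_mem _, Submodule.neg_mem _ (Submodule.smul_mem _ _ m2)⟩
  have hcF₂ : (1 : Ug) ⊗ₜ[ℂ] cF₂ ∈ R := by
    refine hc _ fun y hy => ?_
    obtain ⟨m0, m1, m2, m3⟩ := mem_spinSpan (L := L) hy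
    rw [cF₂_cE₁_mul, cF₂_cE₁, cF₂_cE₂, mul_sub, mul_neg, mul_smul_comm, mul_one]
    simp only [map_sub, map_neg, map_smul, LinearMap.sub_apply, LinearMap.neg_apply,
      LinearMap.smul_apply, clAct_mul, hF₂ y hy, map_zero, map_one, Module.End.one_apply, neg_zero,
      zero_sub, neg_neg]
    exact ⟨Submodule.zero_mem _, Submodule.zero_mem _,
      Submodule.neg_mem _ (Submodule.smul_mem _ _ m0), Submodule.smul_mem _ _ m1⟩
  have htop : R = ⊤ := by
    refine A_subalgebra_eq_top hg fun y => ?_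
    rw [p_eq_sum y]
    simp only [cl, map_add, map_smul, TensorProduct.tmul_add, TensorProduct.tmul_smul]
    exact R.add_mem (R.add_mem (R.add_mem (R.smul_mem hcE₁ _) (R.smul_mem hcE₂ _))
      (R.smul_mem hcF₁ _)) (R.smul_mem hcF₂ _)
  have hr : r ∈ R := by rw [htop]; trivial
  exact hr y hy

variable (L) in
/-- Relations satisfied by the vectors `w_s` of the Dirac cohomology, viewed in an `𝒜`-module. -/
structure IsDiracString (j : ℕ → V) (a b : ℂ) (d : ℕ) : Prop where
  sub_eq : a - b = d
  pos : 0 < d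
  map_D : ∀ s, 1 ≤ s → L D (j s) = 0
  map_invN : ∀ s, 1 ≤ s → L invN (j s) = (-2 : ℂ) • j s
  map_invT : ∀ s, 1 ≤ s → L invT (j s) = (-(a + 1)) • j s
  map_F : ∀ s, 1 ≤ s → L (Δ kF) (j s) = j (s + 1)
  last : j (d + 1) = 0
  map_E : L (Δ kE) (j 1) = 0
  map_H₁ : L (Δ kH₁) (j 1) = (a - 1 / 2) • j 1
  map_H₂ : ∀ s, 1 ≤ s → L (Δ kH₂) (j s) = (b + s - 1 / 2) • j s

/-! ### From the relations of the Dirac cohomology to a bottom vector -/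

namespace IsDiracString

variable {j : ℕ → V} {a b : ℂ} {d : ℕ} (h : IsDiracString L j a b d)
include h

lemma eq_sum {s : ℕ} (hs : 1 ≤ s) : clAct L cE₁ (clAct L cF₁ (j s)) +
    clAct L cE₂ (clAct L cF₂ (j s)) = (-2 : ℂ) • j s := by
  rw [← h.map_invN s hs, ← clAct_mul, ← clAct_mul, ← LinearMap.add_apply, ← map_add]
  rfl

lemma cE₁_cE₂_cF₂ {s : ℕ} (hs : 1 ≤ s) :
    clAct L cE₁ (clAct L cE₂ (clAct L cF₂ (j s))) = (-2 : ℂ) • clAct L cE₁ (j s) := by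
  rw [← map_smul, ← h.eq_sum hs, map_add, ← clAct_mul L cE₁ cE₁, cE₁_sq, map_zero,
    LinearMap.zero_apply, zero_add]

lemma cE₁_cE₂_cF₁ {s : ℕ} (hs : 1 ≤ s) :
    clAct L cE₁ (clAct L cE₂ (clAct L cF₁ (j s))) = (2 : ℂ) • clAct L cE₂ (j s) := by
  have h1 : clAct L cE₂ (clAct L cE₁ (clAct L cF₁ (j s))) = (-2 : ℂ) • clAct L cE₂ (j s) := by
    rw [← map_smul, ← h.eq_sum hs, map_add, ← clAct_mul L cE₂ cE₂, cE₂_sq, map_zero,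
      LinearMap.zero_apply, add_zero]
  rw [← clAct_mul L cE₂ cE₁, cE₂_cE₁, map_neg, LinearMap.neg_apply, clAct_mul] at h1
  rw [eq_comm, ← neg_neg ((2 : ℂ) • _), ← neg_smul, ← h1, neg_neg]

/-- `E₁F₁ + E₂F₂` acts on spinors as `-2` times the exterior degree, so the eigenvalue `-2` says
that `j s` has degree 1 and two contractions kill it. Algebraically, contract the eigenvalue
equation with `F₁` and then with `F₂`. -/
lemma cF₁_cF₂ {s : ℕ} (hs : 1 ≤ s) : clAct L cF₁ (clAct L cF₂ (j s)) = 0 := by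
  have e := h.eq_sum hs
  have e1 := congrArg (clAct L cF₁) e
  rw [map_add, map_smul] at e1
  simp only [← clAct_mul] at e1
  rw [cF₁_cE₁_mul, cF₁_cE₂_mul, cF₁_sq] at e1
  simp only [mul_zero, neg_zero, zero_sub, map_neg, map_smul, LinearMap.neg_apply,
    LinearMap.smul_apply, neg_smul] at e1
  have e2 := congrArg (clAct L cF₂) (add_eq_left.1 e1)
  rw [map_neg, map_zero, neg_eq_zero, ← clAct_mul, cF₂_cE₂_mul, cF₂_cF₁_mul, cF₂_sq] at e2
  simp only [mul_zero, neg_zero, zero_sub, map_neg, map_smul, LinearMap.neg_apply,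
    LinearMap.smul_apply, neg_eq_zero] at e2
  rw [← clAct_mul]
  exact (smul_eq_zero.1 e2).resolve_left two_ne_zero

lemma cF₂_cF₁ {s : ℕ} (hs : 1 ≤ s) : clAct L cF₂ (clAct L cF₁ (j s)) = 0 := by
  rw [← clAct_mul, SU21.cF₂_cF₁, map_neg, LinearMap.neg_apply, clAct_mul, h.cF₁_cF₂ hs, neg_zero]

omit h in
lemma sq_zero {c : Cl} (hc : c * c = 0) (y : V) : clAct L c (clAct L c y) = 0 := by
  rw [← clAct_mul, hc, map_zero, LinearMap.zero_apply]

omit h in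
lemma apply_D (y : V) : L D y = clAct L cF₁ (lieAct L E₁ y) + clAct L cF₂ (lieAct L E₂ y) +
    clAct L cE₁ (lieAct L F₁ y) + clAct L cE₂ (lieAct L F₂ y) := by
  simp only [D, map_add, LinearMap.add_apply, apply_tmul, envAct_u]

omit h in
lemma apply_invT (y : V) : L invT y = opT (lieAct L) y := by
  rw [invT, apply_tmul, map_one, map_add, map_mul, map_mul]
  rfl

/-- Apply `F₂F₁ ∈ C(𝔭)` to `D j_s = 0`. The terms with `Fᵢ ∈ C(𝔭)` drop out, and the terms with `Eᵢ`
are contracted to the claim. -/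
lemma F₁_cF₂ {s : ℕ} (hs : 1 ≤ s) :
    lieAct L F₁ (clAct L cF₂ (j s)) = lieAct L F₂ (clAct L cF₁ (j s)) := by
  have e := congrArg (clAct L (cF₂ * cF₁)) (h.map_D s hs)
  have c1 : cF₂ * cF₁ * cF₁ = 0 := by rw [mul_assoc, cF₁_sq, mul_zero]
  have c2 : cF₂ * cF₁ * cF₂ = 0 := by rw [SU21.cF₂_cF₁, neg_mul, mul_assoc, cF₂_sq, mul_zero, neg_zero]
  have c3 : cF₂ * cF₁ * cE₁ = cE₁ * (cF₂ * cF₁) - (2 : ℂ) • cF₂ := by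
    rw [mul_assoc, SU21.cF₁_cE₁, mul_sub, mul_neg, cF₂_cE₁_mul, neg_neg, mul_smul_comm, mul_one]
  have c4 : cF₂ * cF₁ * cE₂ = cE₂ * (cF₂ * cF₁) + (2 : ℂ) • cF₁ := by
    rw [mul_assoc, SU21.cF₁_cE₂, mul_neg, cF₂_cE₂_mul, neg_sub, sub_neg_eq_add, add_comm]
  have c5 : ∀ x, clAct L (cF₂ * cF₁) (lieAct L x (j s)) = 0 := fun x => by
    rw [← lieAct_clAct, clAct_mul, h.cF₂_cF₁ hs, map_zero]
  rw [map_zero, apply_D] at e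
  simp only [map_add, ← clAct_mul L (cF₂ * cF₁)] at e
  rw [c1, c2, c3, c4] at e
  simp only [map_add, map_sub, map_smul, map_zero, LinearMap.zero_apply, LinearMap.add_apply,
    LinearMap.sub_apply, LinearMap.smul_apply, clAct_mul L _ (cF₂ * cF₁), c5, ← lieAct_clAct,
    zero_add, zero_sub] at e
  exact smul_right_injective V (two_ne_zero (α := ℂ)) (neg_add_eq_zero.1 e)

lemma cE₁_eq {s : ℕ} (hs : 1 ≤ s) :
    clAct L cE₁ (j s) = (-1 / 2 : ℂ) • clAct L cE₁ (clAct L cE₂ (clAct L cF₂ (j s))) := by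
  rw [h.cE₁_cE₂_cF₂ hs, smul_smul]
  norm_num

lemma cE₂_eq {s : ℕ} (hs : 1 ≤ s) :
    clAct L cE₂ (j s) = (1 / 2 : ℂ) • clAct L cE₁ (clAct L cE₂ (clAct L cF₁ (j s))) := by
  rw [h.cE₁_cE₂_cF₁ hs, smul_smul]
  norm_num

/-- With `cE₁ j` and `cE₂ j` rewritten through `cE₁ cE₂`, the raising half of `D j_s` is a multiple
of `cE₁ cE₂ (F₂ cF₁ j - F₁ cF₂ j) = 0`, so the other half vanishes as well. -/
lemma E₁_cF₁ {s : ℕ} (hs : 1 ≤ s) :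
    lieAct L E₁ (clAct L cF₁ (j s)) = -lieAct L E₂ (clAct L cF₂ (j s)) := by
  have e := h.map_D s hs
  rw [apply_D] at e
  simp only [← lieAct_clAct] at e
  rw [h.cE₁_eq hs, h.cE₂_eq hs, map_smul, map_smul] at e
  simp only [lieAct_clAct L _ cE₁, lieAct_clAct L _ cE₂] at e
  rw [h.F₁_cF₂ hs] at e
  rw [eq_neg_iff_add_eq_zero, ← e]
  module

omit h in
/-- On vectors killed by `F₁, F₂ ∈ C(𝔭)`, `α(x)` acts by a scalar. -/
lemma α_apply (x : k) {y : V} (h₁ : clAct L cF₁ y = 0) (h₂ : clAct L cF₂ y = 0) :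
    clAct L (α x) y = (-(3 / 2) * (x.1.1 0 0 + x.1.1 1 1)) • y := by
  rw [α_eq]
  simp only [map_neg, map_add, map_smul, LinearMap.neg_apply, LinearMap.add_apply,
    LinearMap.smul_apply, clAct_mul, h₁, h₂, map_zero, map_one, Module.End.one_apply]
  module

/-- `cF₁ (j s)` is killed by both contractions, so `α(x)` acts on it by a scalar, and the action of
`𝔨` is read off from that of `𝔨_Δ`. -/
lemma k_cF₁ {s : ℕ} (hs : 1 ≤ s) (x : k) : lieAct L x.1 (clAct L cF₁ (j s)) =
    clAct L cF₁ (L (Δ x) (j s)) - x.1.1 0 1 • clAct L cF₂ (j s) +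
      ((x.1.1 1 1 - x.1.1 0 0) / 2 ) • clAct L cF₁ (j s) := by
  have e := Δ_clAct L x ⟨F₁, mem_p_F₁⟩ (j s)
  rw [cAd_F₁] at e
  change L (Δ x) (clAct L cF₁ (j s)) = clAct L cF₁ _ + _ at e
  rw [apply_Δ, α_apply x (sq_zero cF₁_sq _) (h.cF₂_cF₁ hs)] at e
  rw [eq_sub_of_add_eq e]
  simp only [map_sub, map_smul, LinearMap.sub_apply, LinearMap.smul_apply]
  module

lemma k_cF₂ {s : ℕ} (hs : 1 ≤ s) (x : k) : lieAct L x.1 (clAct L cF₂ (j s)) =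
    clAct L cF₂ (L (Δ x) (j s)) - x.1.1 1 0 • clAct L cF₁ (j s) +
      ((x.1.1 0 0 - x.1.1 1 1) / 2 ) • clAct L cF₂ (j s) := by
  have e := Δ_clAct L x ⟨F₂, mem_p_F₂⟩ (j s)
  rw [cAd_F₂] at e
  change L (Δ x) (clAct L cF₂ (j s)) = clAct L cF₂ _ + _ at e
  rw [apply_Δ, α_apply x (h.cF₁_cF₂ hs) (sq_zero cF₂_sq _)] at e
  rw [eq_sub_of_add_eq e]
  simp only [map_sub, map_smul, LinearMap.sub_apply, LinearMap.smul_apply]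
  module

lemma F_cF₁ {s : ℕ} (hs : 1 ≤ s) :
    lieAct L F (clAct L cF₁ (j s)) = clAct L cF₁ (j (s + 1)) := by
  have e := h.k_cF₁ hs kF
  rw [h.map_F s hs] at e
  simpa [kF, val_F] using e

lemma F_cF₂ {s : ℕ} (hs : 1 ≤ s) :
    lieAct L F (clAct L cF₂ (j s)) = clAct L cF₂ (j (s + 1)) - clAct L cF₁ (j s) := by
  have e := h.k_cF₂ hs kF
  rw [h.map_F s hs] at e
  simpa [kF, val_F] using e

lemma H₂_cF₁ {s : ℕ} (hs : 1 ≤ s) :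
    lieAct L H₂ (clAct L cF₁ (j s)) = (b + s) • clAct L cF₁ (j s) := by
  have e := h.k_cF₁ hs kH₂
  rw [h.map_H₂ s hs, map_smul] at e
  simp [kH₂, val_H₂] at e
  rw [e]
  module

lemma isHW : IsHW (lieAct L) a b (clAct L cF₂ (j 1)) where
  map_E := by
    have e := h.k_cF₂ le_rfl kE
    rw [h.map_E, map_zero] at e
    simpa [kE, val_E] using e
  map_H₁ := by
    have e := h.k_cF₂ le_rfl kH₁
    rw [h.map_H₁, map_smul] at e
    simp [kH₁, val_H₁] at e
    rw [e]
    module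
  map_H₂ := by
    have e := h.k_cF₂ le_rfl kH₂
    rw [h.map_H₂ 1 le_rfl, map_smul] at e
    simp [kH₂, val_H₂] at e
    rw [e]
    module

lemma opT_cF₁ {s : ℕ} (hs : 1 ≤ s) :
    opT (lieAct L) (clAct L cF₁ (j s)) = (-(a + 1)) • clAct L cF₁ (j s) := by
  have e : ∀ x y, lieAct L x (lieAct L y (clAct L cF₁ (j s))) =
      clAct L cF₁ (lieAct L x (lieAct L y (j s))) := fun x y => by
    rw [lieAct_clAct, lieAct_clAct]
  rw [opT_apply, e, e, ← map_add, ← opT_apply, ← apply_invT, h.map_invT s hs, map_smul]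

/-- Commute `E₂` with both sides of `F₁ cF₂ j = F₂ cF₁ j`: the brackets give `F` and `H₂`, and the
remainder is `opT (cF₁ j)`, a known scalar. Combined with `F_cF₂` this makes `cF₂ (j (s+1))`
proportional to `cF₁ (j s)`. -/
lemma F_cF₂_eq {s : ℕ} (hs : 1 ≤ s) :
    lieAct L F (clAct L cF₂ (j s)) = (b + s - (a + 1)) • clAct L cF₁ (j s) := by
  have e := h.opT_cF₁ hs
  have e1 := apply_apply (lieAct L) E₂ F₁ (clAct L cF₂ (j s))
  have e2 := apply_apply (lieAct L) E₂ F₂ (clAct L cF₁ (j s))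
  rw [lie_E₂_F₁, h.F₁_cF₂ hs] at e1
  rw [lie_E₂_F₂, h.H₂_cF₁ hs] at e2
  rw [opT_apply, h.E₁_cF₁ hs, map_neg] at e
  linear_combination (norm := module) e + e2 - e1

lemma isBottom : IsBottom (lieAct L) (clAct L cF₂ (j 1)) a b d where
  hw := h.isHW
  sub_eq := h.sub_eq
  pos := h.pos
  lower₁_eq := by
    have e := apply_apply (lieAct L) F E₁ (clAct L cF₂ (j 1))
    have e1 := h.F_cF₂_eq le_rfl
    rw [e1, map_smul, h.E₁_cF₁ le_rfl, lie_F_E₁] at e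
    rw [lower₁_apply, e, ← h.sub_eq]
    push_cast
    module
  lower₂_eq := by
    have e := apply_apply (lieAct L) F F₂ (clAct L cF₂ (j 1))
    have e1 := h.F_cF₂_eq le_rfl
    rw [e1, map_smul, ← h.F₁_cF₂ le_rfl, lie_F_F₂, map_neg, LinearMap.neg_apply] at e
    rw [lower₂_apply, e, ← h.sub_eq]
    push_cast
    module

lemma exists_pow_eq {s : ℕ} (hs : s < d) : ∃ c : ℂ, c ≠ 0 ∧
    (lieAct L F ^ s) (clAct L cF₂ (j 1)) = c • clAct L cF₂ (j (s + 1)) := by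
  induction s with
  | zero => exact ⟨1, one_ne_zero, by simp⟩
  | succ s ih =>
    obtain ⟨c, hc, e⟩ := ih (by omega)
    have h1 := h.F_cF₂_eq (s := s + 1) (by omega)
    have h2 := h.F_cF₂ (s := s + 1) (by omega)
    -- Since `b - a = -d`, the factor is `s + 1 - d`, which is nonzero as long as `s + 1 < d`.
    have h3 : clAct L cF₂ (j (s + 1 + 1)) = (b + (s + 1 : ℕ) - a) • clAct L cF₁ (j (s + 1)) := by
      rw [← sub_add_cancel (clAct L cF₂ (j (s + 1 + 1))) (clAct L cF₁ (j (s + 1))), ← h2, h1]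
      module
    have n1 : (b + (s + 1 : ℕ) - a : ℂ) ≠ 0 := by
      have : (b + (s + 1 : ℕ) - a : ℂ) = ((s + 1 : ℕ) : ℂ) - d := by rw [← h.sub_eq]; ring
      rw [this, sub_ne_zero]
      exact_mod_cast hs.ne
    have n2 : (b + (s + 1 : ℕ) - (a + 1) : ℂ) ≠ 0 := by
      have : (b + (s + 1 : ℕ) - (a + 1) : ℂ) = (s : ℂ) - d := by rw [← h.sub_eq]; push_cast; ring
      rw [this, sub_ne_zero]
      exact_mod_cast (by omega : s ≠ d)
    refine ⟨c * (b + (s + 1 : ℕ) - (a + 1)) * (b + (s + 1 : ℕ) - a)⁻¹,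
      mul_ne_zero (mul_ne_zero hc n2) (inv_ne_zero n1), ?_⟩
    rw [pow_succ', Module.End.mul_apply, e, map_smul, h1, h3, smul_smul, smul_smul, mul_assoc,
      inv_mul_cancel₀ n1, mul_one]

/-- At the end of the string the factor relating `cF₂ (j (d+1))` to `cF₁ (j d)` is zero, and `F`
leads from `cF₂ (j d)` to `-cF₁ (j d)`, which is why a second type of generator appears. -/
lemma exists_pow_last : ∃ c : ℂ, c ≠ 0 ∧
    (lieAct L F ^ d) (clAct L cF₂ (j 1)) = c • clAct L cF₁ (j d) := by
  obtain ⟨s, rfl⟩ := Nat.exists_eq_add_of_le' h.pos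
  obtain ⟨c, hc, e⟩ := h.exists_pow_eq (s := s) (by omega)
  have h1 := h.F_cF₂_eq (s := s + 1) (by omega)
  have n : (b + (s + 1 : ℕ) - (a + 1) : ℂ) = -1 := by
    rw [← h.sub_eq]; ring
  refine ⟨-c, neg_ne_zero.2 hc, ?_⟩
  rw [pow_succ', Module.End.mul_apply, e, map_smul, h1, n]
  module

lemma F_cF₁_last : lieAct L F (clAct L cF₁ (j d)) = 0 := by
  rw [h.F_cF₁ h.pos, h.last, map_zero]

lemma pow_succ_eq_zero : (lieAct L F ^ (d + 1)) (clAct L cF₂ (j 1)) = 0 := by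
  obtain ⟨c, -, e⟩ := h.exists_pow_last
  rw [pow_succ', Module.End.mul_apply, e, map_smul, h.F_cF₁_last, smul_zero]

end IsDiracString

end AModule

/-! ### Spanning the `𝒜`-module generated by the `j s` -/

section Generated

variable {V : Type*} [AddCommGroup V] [Module ℂ V] {L : A →ₐ[ℂ] Module.End ℂ V}

/-- On a vector killed by `F` the second term of the commutator disappears. It is applied to `cF₁ (j
d)`. -/
lemma envAct_adF {y : V} (hy : lieAct L F y = 0) (a : Ug) :
    envAct L (adF a) y = lieAct L F (envAct L a y) := by
  rw [adF, map_sub, map_mul, map_mul, LinearMap.sub_apply, Module.End.mul_apply,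
    Module.End.mul_apply, envAct_u, hy, map_zero, sub_zero]

lemma envAct_adF_iterate {y : V} (hy : lieAct L F y = 0) (i : ℕ) (a : Ug) :
    envAct L (adF^[i] a) y = (lieAct L F ^ i) (envAct L a y) := by
  induction i with
  | zero => rfl
  | succ i ih =>
    rw [Function.iterate_succ_apply', envAct_adF hy, ih, pow_succ', Module.End.mul_apply]

lemma envAct_pow_mul_pow (x x' : g) (n m : ℕ) (y : V) :
    envAct L (u x ^ n * u x' ^ m) y = (lieAct L x ^ n) ((lieAct L x' ^ m) y) := by
  rw [map_mul, map_pow, map_pow]; rfl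

lemma killed_of_mem_strings {v : V} {c : Cl} (hv : clAct L c v = 0) {y : V}
    (hy : y ∈ ⨆ N, strings (lieAct L) v N) : clAct L c y = 0 := by
  have : ⨆ N, strings (lieAct L) v N ≤ LinearMap.ker (clAct L c) := by
    refine iSup_le fun N => Submodule.span_le.2 ?_
    rintro _ ⟨i, n, m, -, rfl⟩
    change clAct L c _ = 0
    rw [top, ← lieAct_pow_clAct, ← lieAct_pow_clAct, ← lieAct_pow_clAct, hv]
    simp
  exact this hy

namespace IsDiracString

variable {j : ℕ → V} {a b : ℂ} {d : ℕ} (h : IsDiracString L j a b d)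
include h

lemma mem_strings {s : ℕ} (h1 : 1 ≤ s) (h2 : s ≤ d) :
    clAct L cF₁ (j s) ∈ ⨆ N, strings (lieAct L) (clAct L cF₂ (j 1)) N ∧
      clAct L cF₂ (j s) ∈ ⨆ N, strings (lieAct L) (clAct L cF₂ (j 1)) N := by
  have hmem : ∀ i, (lieAct L F ^ i) (clAct L cF₂ (j 1)) ∈
      ⨆ N, strings (lieAct L) (clAct L cF₂ (j 1)) N := fun i =>
    Submodule.mem_iSup_of_mem 1 (pow_top_mem (n := 0) (m := 0) (by omega) i)
  obtain ⟨s, rfl⟩ := Nat.exists_eq_add_of_le' h1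
  obtain ⟨c, hc, e⟩ := h.exists_pow_eq h2
  have hF₂ : clAct L cF₂ (j (s + 1)) ∈ ⨆ N, strings (lieAct L) (clAct L cF₂ (j 1)) N := by
    rw [← Submodule.smul_mem_iff _ hc, ← e]
    exact hmem s
  refine ⟨?_, hF₂⟩
  have n : (b + (s + 1 : ℕ) - (a + 1) : ℂ) ≠ 0 := by
    have : (b + (s + 1 : ℕ) - (a + 1) : ℂ) = (s : ℂ) - d := by rw [← h.sub_eq]; push_cast; ring
    rw [this, sub_ne_zero]
    exact_mod_cast (by omega : s ≠ d)
  rw [← Submodule.smul_mem_iff _ n, ← h.F_cF₂_eq h1]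
  exact h.isBottom.apply_mem_iSup F hF₂

/-- The `𝒜`-module generated by the vectors `j s`. -/
lemma apply_mem_spinSpan (r : A) {s : ℕ} (h1 : 1 ≤ s) (h2 : s ≤ d) :
    L r (j s) ∈ spinSpan L (⨆ N, strings (lieAct L) (clAct L cF₂ (j 1)) N) := by
  refine SU21.apply_mem_spinSpan (fun x y hy => h.isBottom.apply_mem_iSup x hy)
    (fun y hy => killed_of_mem_strings (h.cF₁_cF₂ le_rfl) hy)
    (fun y hy => killed_of_mem_strings (sq_zero cF₂_sq _) hy) r ?_
  obtain ⟨m1, m2⟩ := h.mem_strings h1 h2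
  -- The degree relation recovers `j s` from its contractions: `-2 j_s` is `cE₁ cF₁ j_s + cE₂ cF₂
  -- j_s`.
  rw [← Submodule.smul_mem_iff _ (neg_ne_zero.2 two_ne_zero : (-2 : ℂ) ≠ 0), ← h.eq_sum h1]
  exact Submodule.add_mem _ (mem_spinSpan m1).2.1 (mem_spinSpan m2).2.2.1

/-- A spanning set of the `𝒜`-module generated by the vectors `j s`. -/
theorem apply_mem (P : Submodule ℂ V)
    (h₁ : ∀ n m s, 1 ≤ s → s ≤ d →
      ∀ y ∈ ({cF₂, cE₁ * cF₂, cE₂ * cF₂, cE₁} : Set Cl),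
        L ((u E₁ ^ n * u F₂ ^ m) ⊗ₜ[ℂ] y) (j s) ∈ P)
    (h₂ : ∀ n m i, i ≤ n + m →
      ∀ y ∈ ({cF₁, cE₁ * cF₁, cE₂ * cF₁, cE₂} : Set Cl),
        L ((adF^[i] (u E₁ ^ n * u F₂ ^ m)) ⊗ₜ[ℂ] y) (j d) ∈ P)
    (r : A) {s : ℕ} (hs1 : 1 ≤ s) (hs2 : s ≤ d) : L r (j s) ∈ P := by
  -- For a fixed Clifford factor `z`, the spanning set of the `𝔤`-module over `cF₂ (j 1)` is carried
  -- to elements `x ⊗ z cF₂` on `j (i+1)` and `(ad F)ⁱ x ⊗ z cF₁` on `j d`, up to scalars.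
  have key : ∀ z : Cl,
      (∀ n m s, 1 ≤ s → s ≤ d → L ((u E₁ ^ n * u F₂ ^ m) ⊗ₜ[ℂ] (z * cF₂)) (j s) ∈ P) →
      (∀ n m i, i ≤ n + m →
        L ((adF^[i] (u E₁ ^ n * u F₂ ^ m)) ⊗ₜ[ℂ] (z * cF₁)) (j d) ∈ P) →
      ⨆ N, strings (lieAct L) (clAct L cF₂ (j 1)) N ≤ P.comap (clAct L z) := by
    intro z hz₁ hz₂
    refine h.isBottom.iSup_strings_le h.pow_succ_eq_zero _ (fun n m i hi => ?_)
      (fun n m i hi => ?_)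
    · obtain ⟨c, -, e⟩ := h.exists_pow_eq hi
      have := hz₁ n m (i + 1) (by omega) hi
      rw [e]
      simp only [map_smul]
      refine Submodule.smul_mem _ _ ?_
      rw [apply_tmul, clAct_mul, ← envAct_clAct, envAct_pow_mul_pow] at this
      exact this
    · obtain ⟨c, -, e⟩ := h.exists_pow_last
      have := hz₂ n m i hi
      rw [e]
      simp only [map_smul]
      refine Submodule.smul_mem _ _ ?_
      rw [apply_tmul, clAct_mul, ← envAct_clAct, envAct_adF_iterate h.F_cF₁_last,
        envAct_pow_mul_pow] at this
      exact this
  have k0 := key 1 (fun n m s a b => by rw [one_mul]; exact h₁ n m s a b _ (by simp))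
    (fun n m i hi => by rw [one_mul]; exact h₂ n m i hi _ (by simp))
  have k1 := key cE₁ (fun n m s a b => h₁ n m s a b _ (by simp))
    (fun n m i hi => h₂ n m i hi _ (by simp))
  have k2 := key cE₂ (fun n m s a b => h₁ n m s a b _ (by simp))
    (fun n m i hi => h₂ n m i hi _ (by simp))
  -- On `j s` the products `cE₁ cE₂ cF₂` and `cE₁ cE₂ cF₁` reduce to `-2 cE₁` and `2 cE₂`, the
  -- fourth entries of the two lists.
  have k3 := key (cE₁ * cE₂)
    (fun n m s a b => by
      have := h₁ n m s a b cE₁ (by simp)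
      rw [apply_tmul, ← envAct_clAct] at this ⊢
      rw [clAct_mul, clAct_mul, h.cE₁_cE₂_cF₂ a, map_smul]
      exact P.smul_mem _ this)
    (fun n m i hi => by
      have := h₂ n m i hi cE₂ (by simp)
      rw [apply_tmul, ← envAct_clAct] at this ⊢
      rw [clAct_mul, clAct_mul, h.cE₁_cE₂_cF₁ h.pos, map_smul]
      exact P.smul_mem _ this)
  refine spinSpan_le (N := P) (fun y hy => ⟨?_, k1 hy, k2 hy, k3 hy⟩) (h.apply_mem_spinSpan r hs1 hs2)
  have := k0 hy
  rwa [Submodule.mem_comap, map_one, Module.End.one_apply] at this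

end IsDiracString

end Generated

/-! ### The induced module -/

section Induced

variable {X : Type*} [AddCommGroup X] [Module ℂ X] [LieRingModule g X] [LieModule ℂ g X]
variable {W : Submodule ℂ (X ⊗[ℂ] S)}

/-- The relations only involve right multiplication on `𝒜`, so left multiplication descends to the
quotient. -/
lemma Z_le_comap (a : A) : Z W ≤ (Z W).comap ((LinearMap.mulLeft ℂ a).rTensor W) := by
  refine Submodule.span_le.2 ?_
  rintro _ ⟨c, b, w, w', hb, hw, rfl⟩
  refine Submodule.subset_span ⟨a * c, b, w, w', hb, hw, ?_⟩
  rw [map_sub, LinearMap.rTensor_tmul, LinearMap.rTensor_tmul, LinearMap.mulLeft_apply,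
    LinearMap.mulLeft_apply, mul_assoc]

/-- The linear map `w ↦ a ⊗ w`. -/
noncomputable def indMap (a : A) : W →ₗ[ℂ] Ind W := (Z W).mkQ ∘ₗ TensorProduct.mk ℂ A W a

lemma indMap_apply (a : A) (w : W) : indMap a w = ind a w := rfl

lemma ind_add_left (a a' : A) (w : W) : ind (a + a') w = ind a w + ind a' w := by
  rw [ind, TensorProduct.add_tmul, map_add]; rfl

lemma ind_smul_left (r : ℂ) (a : A) (w : W) : ind (r • a) w = r • ind a w := by
  rw [ind, ← TensorProduct.smul_tmul', map_smul]; rfl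

/-- A subspace of `𝒜 ⊗_ℬ W` containing all `a ⊗ w` is everything. -/
lemma Ind_eq_top_of_ind_mem {P : Submodule ℂ (Ind W)} (h : ∀ a w, ind a w ∈ P) : P = ⊤ := by
  refine eq_top_iff.2 fun z _ => ?_
  obtain ⟨z, rfl⟩ := (Z W).mkQ_surjective z
  induction z using TensorProduct.induction_on with
  | zero => rw [map_zero]; exact P.zero_mem
  | add x y hx hy => rw [map_add]; exact P.add_mem (hx trivial) (hy trivial)
  | tmul r y => exact h r y

lemma Ind_hom_ext {f f' : Module.End ℂ (Ind W)} (h : ∀ a w, f (ind a w) = f' (ind a w)) :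
    f = f' :=
  LinearMap.eqLocus_eq_top.1 (Ind_eq_top_of_ind_mem h)

/-- Left multiplication by an element of `𝒜` on `𝒜 ⊗_ℬ W`. -/
noncomputable def indMulLeft (a : A) : Module.End ℂ (Ind W) :=
  (Z W).mapQ (Z W) ((LinearMap.mulLeft ℂ a).rTensor W) (Z_le_comap a)

lemma indMulLeft_ind (a c : A) (w : W) : indMulLeft a (ind c w) = ind (a * c) w := rfl

lemma indMulLeft_one : (indMulLeft 1 : Module.End ℂ (Ind W)) = 1 :=
  Ind_hom_ext fun c w => by rw [indMulLeft_ind, one_mul, Module.End.one_apply]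

lemma indMulLeft_mul (a a' : A) :
    (indMulLeft (a * a') : Module.End ℂ (Ind W)) = indMulLeft a * indMulLeft a' :=
  Ind_hom_ext fun c w => by
    rw [Module.End.mul_apply, indMulLeft_ind, indMulLeft_ind, indMulLeft_ind, mul_assoc]

variable (W) in
/-- The linear map `a ↦ indMulLeft a`. -/
noncomputable def indMulLeftHom : A →ₗ[ℂ] Module.End ℂ (Ind W) where
  toFun := indMulLeft
  map_add' a a' := Ind_hom_ext fun c w => by
    rw [LinearMap.add_apply, indMulLeft_ind, indMulLeft_ind, indMulLeft_ind, add_mul, ind_add_left]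
  map_smul' r a := Ind_hom_ext fun c w => by
    rw [RingHom.id_apply, LinearMap.smul_apply, indMulLeft_ind, indMulLeft_ind, smul_mul_assoc,
      ind_smul_left]

variable (W) in
/-- The action of `𝒜` on `𝒜 ⊗_ℬ W` by left multiplication. -/
noncomputable def indAct : A →ₐ[ℂ] Module.End ℂ (Ind W) :=
  AlgHom.ofLinearMap (indMulLeftHom W) indMulLeft_one indMulLeft_mul

lemma indAct_ind (a c : A) (w : W) : indAct W a (ind c w) = ind (a * c) w := rfl

lemma indAct_one (a : A) (w : W) : indAct W a (ind 1 w) = ind a w := by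
  rw [indAct_ind, mul_one]

lemma ind_mul {a b : A} (hb : b ∈ BB) {w w' : W} (h : (w' : X ⊗[ℂ] S) = act X b w) :
    ind (a * b) w = ind a w' := by
  rw [ind, ind, ← sub_eq_zero, ← map_sub]
  exact (Submodule.Quotient.mk_eq_zero _).2 (Submodule.subset_span ⟨a, b, w, w', hb, h, rfl⟩)

lemma indAct_BB {b : A} (hb : b ∈ BB) {w w' : W} (h : (w' : X ⊗[ℂ] S) = act X b w) :
    indAct W b (ind 1 w) = indMap 1 w' := by
  rw [indAct_one, ← one_mul b, ind_mul hb h, indMap_apply]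

lemma Δ_mem_BB (x : k) : Δ x ∈ BB := Algebra.subset_adjoin (Or.inl ⟨x, rfl⟩)

lemma AK_le_BB : AK ≤ BB := fun _ hx => Algebra.subset_adjoin (Or.inr hx)

variable {v : X} {d : ℕ} {a b : ℂ}

lemma opT_eq_of_F_pow (h : IsBottom (rep X) v a b d) (i : ℕ) :
    opT (rep X) ((rep X F ^ i) v) = (-(a + 1)) • (rep X F ^ i) v := by
  rw [opT_F_pow, h.opT_bottom, map_smul]

lemma act_invT_w (h : IsBottom (rep X) v a b d) (s : ℕ) :
    act X invT (w v d s) = (-(a + 1)) • w v d s := by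
  rw [w, map_sub, map_smul, act_invT, act_invT, opT_eq_of_F_pow h, opT_eq_of_F_pow h]
  simp only [← TensorProduct.smul_tmul']
  module

lemma act_invN_w (s : ℕ) : act X invN (w v d s) = (-2 : ℂ) • w v d s := by
  have e1 : spin (cE₁ * cF₁ + cE₂ * cF₂) sE₁ = (-2 : ℂ) • sE₁ := by
    rw [map_add, LinearMap.add_apply, spin_mul, spin_mul, spin_cF₁, spin_cF₂, contract_sE₁,
      contract_sE₁]
    simp [spin_cE₁]
  have e2 : spin (cE₁ * cF₁ + cE₂ * cF₂) sE₂ = (-2 : ℂ) • sE₂ := by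
    rw [map_add, LinearMap.add_apply, spin_mul, spin_mul, spin_cF₁, spin_cF₂, contract_sE₂,
      contract_sE₂]
    simp [spin_cE₂]
  rw [w, map_sub, map_smul, invN, act_one_tmul, act_one_tmul, e1, e2, TensorProduct.tmul_smul,
    TensorProduct.tmul_smul]
  module

lemma act_E_w_one (h : IsBottom (rep X) v a b d) : act X (Δ kE) (w v d 1) = 0 := by
  have e := h.hw.E_F_pow 0
  have e' := h.hw.map_E
  rw [w, map_sub, map_smul, act_E_sE₁, act_E_sE₂]
  simp only [zero_add, pow_one, pow_zero, Module.End.one_apply, Nat.sub_self] at e ⊢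
  rw [e, e', h.sub_eq]
  simp [← TensorProduct.smul_tmul']

lemma act_H₁_w_one (h : IsBottom (rep X) v a b d) :
    act X (Δ kH₁) (w v d 1) = (a - 1 / 2) • w v d 1 := by
  rw [w, map_sub, map_smul, act_H₁_sE₁, act_H₁_sE₂, h.hw.H₁_F_pow, h.hw.H₁_F_pow]
  simp only [← TensorProduct.smul_tmul', Nat.sub_self]
  push_cast
  module

lemma act_H₂_w (h : IsBottom (rep X) v a b d) (s : ℕ) (hs : 1 ≤ s) :
    act X (Δ kH₂) (w v d s) = (b + s - 1 / 2) • w v d s := by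
  obtain ⟨s, rfl⟩ := Nat.exists_eq_add_of_le' hs
  rw [w, map_sub, map_smul, act_H₂_sE₁, act_H₂_sE₂, h.hw.H₂_F_pow, h.hw.H₂_F_pow]
  simp only [← TensorProduct.smul_tmul', Nat.add_sub_cancel]
  push_cast
  module

lemma w_eq_zero (hF : (rep X F ^ (d + 1)) v = 0) {s : ℕ} (hs : d + 1 ≤ s) : w v d s = 0 := by
  induction s, hs using Nat.le_induction with
  | base => exact w_last hF
  | succ s hs ih => rw [← act_F_w s (by omega), ih, map_zero]

/-- Every relation is an identity for an element of `ℬ` acting on `w_s` in `X ⊗ S`, carried across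
the tensor sign. -/
lemma isDiracString_ind (h : IsBottom (rep X) v a b d) (hF : (rep X F ^ (d + 1)) v = 0)
    (w' : ℕ → W) (hw' : ∀ s, 1 ≤ s → (w' s : X ⊗[ℂ] S) = w v d s) :
    IsDiracString (indAct W) (fun s => ind 1 (w' s)) a b d where
  sub_eq := h.sub_eq
  pos := h.pos
  map_D s hs := by
    rw [indAct_BB (AK_le_BB D_mem_AK) (w' := 0) (by rw [hw' s hs, act_D_w h s hs]; rfl), map_zero]
  map_invN s hs := by
    rw [indAct_BB (AK_le_BB invN_mem_AK) (w' := (-2 : ℂ) • w' s)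
      (by rw [Submodule.coe_smul, hw' s hs, act_invN_w]), map_smul]; rfl
  map_invT s hs := by
    rw [indAct_BB (AK_le_BB invT_mem_AK) (w' := (-(a + 1)) • w' s)
      (by rw [Submodule.coe_smul, hw' s hs, act_invT_w h]), map_smul]; rfl
  map_F s hs := by
    rw [indAct_BB (Δ_mem_BB _) (w' := w' (s + 1))
      (by rw [hw' s hs, hw' _ (by omega), act_F_w s hs])]; rfl
  last := by
    have : w' (d + 1) = 0 := Subtype.ext (by rw [hw' _ (by omega), w_last hF]; rfl)
    change indMap 1 (w' (d + 1)) = 0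
    rw [this, map_zero]
  map_E := by
    rw [indAct_BB (Δ_mem_BB _) (w' := 0) (by rw [hw' 1 le_rfl, act_E_w_one h]; rfl), map_zero]
  map_H₁ := by
    rw [indAct_BB (Δ_mem_BB _) (w' := (a - 1 / 2) • w' 1)
      (by rw [Submodule.coe_smul, hw' 1 le_rfl, act_H₁_w_one h]), map_smul]; rfl
  map_H₂ s hs := by
    rw [indAct_BB (Δ_mem_BB _) (w' := (b + s - 1 / 2) • w' s)
      (by rw [Submodule.coe_smul, hw' s hs, act_H₂_w h s hs]), map_smul]; rfl

/-- A subspace of `𝒜 ⊗_ℬ W` containing all `a ⊗ w_s` is everything, if `W` is spanned by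
the `w_s`. -/
lemma Ind_eq_top (hW : W = wSpan v d) (w' : ℕ → W)
    (hw' : ∀ s, 1 ≤ s → (w' s : X ⊗[ℂ] S) = w v d s) {P : Submodule ℂ (Ind W)}
    (hP : ∀ r s, 1 ≤ s → s ≤ d → ind r (w' s) ∈ P) : P = ⊤ := by
  have hspan : ∀ (r : A) (y : W), ind r y ∈ P := by
    intro r y
    have hle : wSpan v d ≤ (P.comap (indMap r)).map W.subtype := by
      refine Submodule.span_le.2 ?_
      rintro _ ⟨s, h1, h2, rfl⟩
      exact ⟨w' s, hP r s h1 h2, hw' s h1⟩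
    obtain ⟨y', hy', e⟩ := hle (hW ▸ y.2 : (y : X ⊗[ℂ] S) ∈ wSpan v d)
    rw [← Subtype.ext e]
    exact hy'
  exact Ind_eq_top_of_ind_mem hspan

end Induced

end SU21

/-! ### The main theorem -/

theorem mainTheorem3 {X : Type*} [AddCommGroup X] [Module ℂ X] [LieRingModule SU21.g X]
    [LieModule ℂ SU21.g X] (ρ : Representation ℂ SU21.K X) (q : Fin 3 → ℝ)
    (hX : SU21.IsNonholomorphicDiscreteSeries ρ q)
    (d : ℕ) (hd : (d : ℝ) = q 0 - q 1)
    (v : X) (hv : SU21.IsHighestWeightVector q v) :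
    (∀ b ∈ SU21.BB, ∀ y ∈ SU21.HD X, SU21.act X b y ∈ SU21.HD X) ∧
    ∃ w : Set.Icc 1 d → SU21.HD X, (∀ s, (w s : X ⊗[ℂ] SU21.S) = SU21.w v d s) ∧
      Submodule.span ℂ
        ({z : SU21.Ind (SU21.HD X) | ∃ (n m : ℕ) (s : Set.Icc 1 d),
            ∃ y ∈ ({SU21.cF₂, SU21.cE₁ * SU21.cF₂, SU21.cE₂ * SU21.cF₂, SU21.cE₁} :
              Set SU21.Cl),
            z = SU21.ind ((SU21.u SU21.E₁ ^ n * SU21.u SU21.F₂ ^ m) ⊗ₜ[ℂ] y) (w s)} ∪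
          {z : SU21.Ind (SU21.HD X) | ∃ (n m j : ℕ) (s : Set.Icc 1 d), j ≤ n + m ∧ s.1 = d ∧
            ∃ y ∈ ({SU21.cF₁, SU21.cE₁ * SU21.cF₁, SU21.cE₂ * SU21.cF₁, SU21.cE₂} :
              Set SU21.Cl),
            z = SU21.ind
              ((SU21.adF^[j] (SU21.u SU21.E₁ ^ n * SU21.u SU21.F₂ ^ m)) ⊗ₜ[ℂ] y) (w s)}) = ⊤ := by
  refine ⟨fun b hb y hy => SU21.act_mem_HD hb hy, ?_⟩
  have hW := hX.HD_eq hd hv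
  have hF := hX.F_pow_eq_zero hd hv
  have hbot := hX.isBottom hd hv
  have hmem : ∀ s, 1 ≤ s → SU21.w v d s ∈ SU21.HD X := by
    intro s h1
    rw [hW]
    rcases Nat.lt_or_ge d s with h2 | h2
    · rw [SU21.w_eq_zero hF h2]; exact Submodule.zero_mem _
    · exact Submodule.subset_span ⟨s, h1, h2, rfl⟩
  -- The family is indexed by all natural numbers because `F_Δ` leads from `w_d` to `w_(d+1) = 0`.
  -- The value at `0` is a default that no relation involves.
  let w : ℕ → SU21.HD X := fun s => if h : 1 ≤ s then ⟨_, hmem s h⟩ else 0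
  have hw : ∀ s, 1 ≤ s → (w s : X ⊗[ℂ] SU21.S) = SU21.w v d s := fun s h1 => by
    simp only [w, dif_pos h1]
  refine ⟨fun s => w s, fun s => hw s s.2.1, ?_⟩
  have hj := SU21.isDiracString_ind hbot hF w hw
  refine SU21.Ind_eq_top hW w hw fun r s h1 h2 => ?_
  rw [← SU21.indAct_one]
  refine hj.apply_mem _ (fun n m s h1 h2 y hy => ?_) (fun n m i hi y hy => ?_) r h1 h2
  · rw [SU21.indAct_one]
    exact Submodule.subset_span (Or.inl ⟨n, m, ⟨s, h1, h2⟩, y, hy, rfl⟩)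
  · rw [SU21.indAct_one]
    exact Submodule.subset_span
      (Or.inr ⟨n, m, i, ⟨d, hbot.pos, le_rfl⟩, hi, rfl, y, hy, rfl⟩)
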